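/- \textbf{Setting.} \emph{Indexed array logic} has index terms $I ::= I+n \mid i \mid n \mid |a|$, data terms $E ::= E+n \mid v \mid n \mid a[I]$ ($n\in\mathbb Z$ a constant, $i$ an index variable, $v$ a data variable, $a$ an array variable), atoms $I\bowtie I$ (index expressions) and $E\bowtie E$ (data expressions) with $\bowtie\,\in\{=,\ne,\le,<,\ge,>\}$, Boolean connectives, and quantification over index variables. Index variables (also the quantified ones) range over $\mathbb N$, data values over $\mathbb Z$, arrays are functions $\mathbb Z\to\mathbb Z$, and index terms are evaluated in $\mathbb Z$. A finite vocabulary $\mathcal V$ consists of system parameters (index variables whose value never changes), index, data and array variables; each $|a|$ is identified with a parameter. An \emph{array system} $\mathfrak T=(\mathcal V,\phi_I,\phi_T)$ has formulae $\phi_I$ over $\mathcal V$ and $\phi_T$ over $\mathcal V\uplus\mathcal V'$ (where $p'$ is $p$ for each parameter $p$). A path is a finite or infinite sequence of states (interpretations of $\mathcal V$) that starts in $\phi_I$ and whose consecutive states satisfy $\phi_T$ and agree on the parameters; it is maximal if it is infinite or its last state has no successor. A temporal array property \emph{holds} for $\mathfrak T$ if no maximal path satisfies its negation, and $\mathfrak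 T$ is \emph{$\psi$-progressing} if every maximal path satisfying $\psi$ is infinite. A formula is \emph{singly indexed} (SIA) if each of its data expressions contains at most one quantified index variable. An array formula is \emph{abstractable} if it has the form $\exists i_1\cdots i_l.\,\psi$ with $\psi$ SIA; $\mathfrak T$ is abstractable if $\phi_I$ and $\phi_T$ are. A temporal property is abstractable if it is generated by $\phi ::= \psi\mid\phi\vee\phi\mid\phi\wedge\phi\mid\exists i.\phi\mid\mathbf G\phi\mid\mathbf F\phi$ with $\psi$ SIA. \textbf{Abstraction.} Let $\phi=\forall i_1\cdots i_k.(\psi_1\Rightarrow\mathbf F\psi_2)$ be a liveness array property, let $\mathcal V^\star$ be $\mathcal V$ with fresh parameters $\bar c=c_1,\dots,c_k$, let $\psi_j^\star=\psi_j[\bar c/\bar i]$, and let $\mathcal P=\{P_1,\dots,P_m\}$ be indexed predicates over $\mathcal V^\star$, i.e. atoms over $\mathcal V^\star\uplus\{\mathtt i\}$. An abstract state is a pair $(t,w)$ where $t$ assigns a natural number to each of the $r$ parameters and index variables of $\mathcal V^\star$, and $w$ is a word over $\{0,1\}^m$ whose length is the largest parameter value under $t$. For a set $C$ of states, $\alpha^{\mathcal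 P}(C)$ is the set of abstract states $(t,w)$ such that some $s\in C$ restricts to $t$ and, for all $1\le i\le|w|$ and $k$, the $k$th bit of $w[i]$ is the truth value of $P_k[i/\mathtt i]$ in $s$. For an array formula $\chi$ over $\mathcal V^\star$ let $[\![\chi^{\mathcal P}]\!]$ be the set of abstract states obtained as follows. Bring $\chi$ (pulling quantifiers out from left to right) into prenex form with matrix $\bigvee_j(g_j\wedge h_j)$, $g_j$ a conjunction of index expressions and $h_j$ one of data expressions. Replace $h_j$ by the conjunction of all clauses $C$ that are implied by $h_j$ and whose literals have the form $P_k[t/\mathtt i]$ or $\neg P_k[t/\mathtt i]$, $t$ an index term of $h_j$ or of $\mathcal P$ (in terms of $\mathcal P$, $\mathtt i$ stands for an index term of $h_j$). Evaluate the result in $(t,w)$, reading a literal $P_k[u/\mathtt i]$ (resp. $\neg P_k[u/\mathtt i]$) as: if $1\le u\le|w|$, then the $k$th bit of $w[u]$ is $1$ (resp. $0$). For transition formulae do the same over $\mathcal V^\star\uplus\mathcal V^{\star\prime}$ with the predicates $\mathcal P\cup\mathcal P'$, an abstract state of which is a pair of abstract states over $\mathcal V^\star$ with equal parameter values. A set of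 abstract states, or of pairs of these, is represented by the language of the convolutions of its elements: numbers are written in unary, components are left-aligned and padded with zeros. Put \[R_I=[\![(\phi_I\wedge\psi_1^\star)^{\mathcal P}]\!],\qquad R_T=[\![\phi_T^{\mathcal P}]\!],\qquad R_E=[\![(\neg\psi_2^\star)^{\mathcal P}]\!],\qquad R_F=\text{the set of abstract states outside } R_E.\] \textbf{Theorem.} There is an algorithm that, given an array system $\mathfrak T$, a liveness array property $\phi=\forall i_1\cdots i_k.(\psi_1\Rightarrow\mathbf F\psi_2)$ and a finite set $\mathcal P$ of indexed predicates over $\mathcal V^\star$, such that $\mathfrak T$ and $\neg\phi\equiv\exists i_1\cdots i_k.(\psi_1\wedge\mathbf G\neg\psi_2)$ are abstractable, computes finite automata $\mathcal I$, $\mathcal T$, $\mathcal F$ that recognize the languages representing $R_I$, $R_T$, $R_F$, respectively. Here $R_I$, $R_T$, $R_E$ are regular abstractions, i.e. they include the $\alpha$-images of $\phi_I\wedge\psi_1^\star$, of $\phi_T$ (with predicates $\mathcal P\cup\mathcal P'$), and of $\neg\psi_2^\star$. Moreover, if $\mathfrak T$ is $\neg\phi$-progressing, then $\phi$ holds for $\mathfrak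 T$ whenever the liveness property $(\mathcal I,\mathcal T,\mathcal F)$ holds, i.e. whenever every infinite sequence of abstract states that starts in $\mathcal I$ and whose consecutive pairs are in $\mathcal T$ meets $\mathcal F$. -/

import Mathlib

/-!
## Indexed array logic

Index variables (including system parameters and quantified variables) range over `ℕ`, index terms
are evaluated in `ℤ`, array elements are integers, and an array is a function `ℤ → ℤ`.
-/

/-- A sorted vocabulary: system parameters, index variables, data variables and array variables.
The size of every array is identified with a system parameter. -/
structure Sig where
  Par : Type
  Idx : Type
  Dat : Type
  Arr : Type
  size : Arr → Par
  [finPar : Fintype Par]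

attribute [instance] Sig.finPar

/-- `V_int`: the parameters and the index variables. -/
abbrev Sig.Int (S : Sig) : Type := S.Par ⊕ S.Idx

/-- Sort-preserving maps of vocabularies. -/
structure Sig.Hom (S S' : Sig) where
  par : S.Par → S'.Par
  idx : S.Idx → S'.Idx
  dat : S.Dat → S'.Dat
  arr : S.Arr → S'.Arr
  size_arr : ∀ a, S'.size (arr a) = par (S.size a)

def Sig.Hom.id (S : Sig) : Sig.Hom S S := ⟨fun x => x, fun x => x, fun x => x, fun x => x, fun _ => rfl⟩

/-- A state: a sort-consistent interpretation of the vocabulary. -/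
structure State (S : Sig) where
  int : S.Int → ℕ
  dat : S.Dat → ℤ
  arr : S.Arr → ℤ → ℤ

/-- Index terms `I ::= I + n | i | n | |a|`; `bvar` refers to one of `n` further index variables
that do not belong to the vocabulary (de Bruijn indices: `0` is the innermost quantifier). -/
inductive ITerm (S : Sig) (n : ℕ) : Type where
  | var (x : S.Int)
  | bvar (i : Fin n)
  | const (c : ℤ)
  | size (a : S.Arr)
  | add (t : ITerm S n) (c : ℤ)

/-- Data terms `E ::= E + n | v | n | a[I]`. -/
inductive DTerm (S : Sig) (n : ℕ) : Type where
  | var (v : S.Dat)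
  | const (c : ℤ)
  | read (a : S.Arr) (t : ITerm S n)
  | add (e : DTerm S n) (c : ℤ)

inductive Cmp : Type where
  | eq | ne | le | lt | ge | gt

def Cmp.holds : Cmp → ℤ → ℤ → Prop
  | .eq, x, y => x = y
  | .ne, x, y => x ≠ y
  | .le, x, y => x ≤ y
  | .lt, x, y => x < y
  | .ge, x, y => x ≥ y
  | .gt, x, y => x > y

/-- The complementary comparison. -/
def Cmp.neg : Cmp → Cmp
  | .eq => .ne
  | .ne => .eq
  | .le => .gt
  | .lt => .ge
  | .ge => .lt
  | .gt => .le

/-- Atomic formulae: index expressions `I ⋈ I` and data expressions `E ⋈ E`. -/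
inductive Atom (S : Sig) (n : ℕ) : Type where
  | idx (l : ITerm S n) (c : Cmp) (r : ITerm S n)
  | dat (l : DTerm S n) (c : Cmp) (r : DTerm S n)

/-- Array formulae over the vocabulary `S` and `n` further free index variables. -/
inductive Fml (S : Sig) : ℕ → Type where
  | atom {n : ℕ} (a : Atom S n) : Fml S n
  | not {n : ℕ} (F : Fml S n) : Fml S n
  | or {n : ℕ} (F G : Fml S n) : Fml S n
  | and {n : ℕ} (F G : Fml S n) : Fml S n
  | ex {n : ℕ} (F : Fml S (n + 1)) : Fml S n
  | all {n : ℕ} (F : Fml S (n + 1)) : Fml S n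

section Semantics

variable {S : Sig} {n : ℕ}

def ITerm.eval (t : S.Int → ℕ) (b : Fin n → ℕ) : ITerm S n → ℤ
  | .var x => t x
  | .bvar i => b i
  | .const c => c
  | .size a => t (.inl (S.size a))
  | .add u c => u.eval t b + c

def DTerm.eval (s : State S) (b : Fin n → ℕ) : DTerm S n → ℤ
  | .var v => s.dat v
  | .const c => c
  | .read a u => s.arr a (u.eval s.int b)
  | .add e c => e.eval s b + c

def Atom.eval (s : State S) (b : Fin n → ℕ) : Atom S n → Prop
  | .idx l c r => c.holds (l.eval s.int b) (r.eval s.int b)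
  | .dat l c r => c.holds (l.eval s b) (r.eval s b)

def Fml.eval (s : State S) : {n : ℕ} → (Fin n → ℕ) → Fml S n → Prop
  | _, b, .atom a => a.eval s b
  | _, b, .not F => ¬ F.eval s b
  | _, b, .or F G => F.eval s b ∨ G.eval s b
  | _, b, .and F G => F.eval s b ∧ G.eval s b
  | _, b, .ex F => ∃ x : ℕ, F.eval s (Fin.cons x b)
  | _, b, .all F => ∀ x : ℕ, F.eval s (Fin.cons x b)

/-- `⟦φ⟧` for a formula without further free variables. -/
def Fml.sem (F : Fml S 0) : Set (State S) := {s | F.eval s Fin.elim0}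

end Semantics

/-! ### Substitution -/

section Substitution

variable {S S' : Sig} {n n' : ℕ}

/-- Rename the vocabulary along `f` and substitute `θ` for the further free variables. -/
def ITerm.map (f : Sig.Hom S S') (θ : Fin n → ITerm S' n') : ITerm S n → ITerm S' n'
  | .var x => .var (Sum.map f.par f.idx x)
  | .bvar i => θ i
  | .const c => .const c
  | .size a => .size (f.arr a)
  | .add t c => .add (t.map f θ) c

def DTerm.map (f : Sig.Hom S S') (θ : Fin n → ITerm S' n') : DTerm S n → DTerm S' n'
  | .var v => .var (f.dat v)
  | .const c => .const c
  | .read a t => .read (f.arr a) (t.map f θ)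
  | .add e c => .add (e.map f θ) c

def Atom.map (f : Sig.Hom S S') (θ : Fin n → ITerm S' n') : Atom S n → Atom S' n'
  | .idx l c r => .idx (l.map f θ) c (r.map f θ)
  | .dat l c r => .dat (l.map f θ) c (r.map f θ)

/-- The substitution `θ` under one quantifier. -/
def ITerm.lift (θ : Fin n → ITerm S n') : Fin (n + 1) → ITerm S (n' + 1) :=
  Fin.cons (.bvar 0) fun i => (θ i).map (Sig.Hom.id S) fun j => .bvar j.succ

def Fml.map (f : Sig.Hom S S') :
    {n n' : ℕ} → (Fin n → ITerm S' n') → Fml S n → Fml S' n'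
  | _, _, θ, .atom a => .atom (a.map f θ)
  | _, _, θ, .not F => .not (F.map f θ)
  | _, _, θ, .or F G => .or (F.map f θ) (G.map f θ)
  | _, _, θ, .and F G => .and (F.map f θ) (G.map f θ)
  | _, _, θ, .ex F => .ex (F.map f (ITerm.lift θ))
  | _, _, θ, .all F => .all (F.map f (ITerm.lift θ))

/-- `A[t/i]` for an atom `A` with the one further variable `i`. -/
def Atom.inst (A : Atom S 1) (t : ITerm S n) : Atom S n := A.map (Sig.Hom.id S) fun _ => t

def ITerm.inst (u : ITerm S 1) (t : ITerm S n) : ITerm S n := u.map (Sig.Hom.id S) fun _ => t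

def Atom.neg : Atom S n → Atom S n
  | .idx l c r => .idx l c.neg r
  | .dat l c r => .dat l c.neg r

/-- Negation, pushed inwards. -/
def Fml.neg : {n : ℕ} → Fml S n → Fml S n
  | _, .atom a => .atom a.neg
  | _, .not F => F
  | _, .or F G => .and F.neg G.neg
  | _, .and F G => .or F.neg G.neg
  | _, .ex F => .all F.neg
  | _, .all F => .ex F.neg

end Substitution

/-! ### Singly indexed and abstractable formulae -/

section SIA

variable {S : Sig} {n : ℕ}

def ITerm.bvars : ITerm S n → List (Fin n)
  | .bvar i => [i]
  | .add t _ => t.bvars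
  | _ => []

def DTerm.bvars : DTerm S n → List (Fin n)
  | .read _ t => t.bvars
  | .add e _ => e.bvars
  | _ => []

/-- `F.SIAWith q`: every data expression of `F` contains at most one variable that is quantified
in `F` or marked by `q`. -/
def Fml.SIAWith : {n : ℕ} → (Fin n → Prop) → Fml S n → Prop
  | _, _, .atom (.idx _ _ _) => True
  | _, q, .atom (.dat l _ r) =>
      ∀ i ∈ l.bvars ++ r.bvars, ∀ j ∈ l.bvars ++ r.bvars, q i → q j → i = j
  | _, q, .not F => F.SIAWith q
  | _, q, .or F G => F.SIAWith q ∧ G.SIAWith q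
  | _, q, .and F G => F.SIAWith q ∧ G.SIAWith q
  | _, q, .ex F => F.SIAWith (Fin.cons True q)
  | _, q, .all F => F.SIAWith (Fin.cons True q)

/-- Singly indexed array formulae. -/
def Fml.SIA (F : Fml S n) : Prop := F.SIAWith fun _ => False

/-- Abstractable array formulae: `∃ i₁ … iₖ. φ` with `φ` singly indexed. -/
inductive Fml.Abstractable : {n : ℕ} → Fml S n → Prop
  | sia {n : ℕ} {F : Fml S n} : F.SIA → F.Abstractable
  | ex {n : ℕ} {F : Fml S (n + 1)} : F.Abstractable → F.ex.Abstractable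

end SIA

/-! ## Temporal array properties -/

/-- Temporal array properties over `S` and `n` further free index variables. -/
inductive TFml (S : Sig) : ℕ → Type where
  | base {n : ℕ} (F : Fml S n) : TFml S n
  | not {n : ℕ} (F : TFml S n) : TFml S n
  | or {n : ℕ} (F G : TFml S n) : TFml S n
  | and {n : ℕ} (F G : TFml S n) : TFml S n
  | ex {n : ℕ} (F : TFml S (n + 1)) : TFml S n
  | all {n : ℕ} (F : TFml S (n + 1)) : TFml S n
  | globally {n : ℕ} (F : TFml S n) : TFml S n
  | eventually {n : ℕ} (F : TFml S n) : TFml S n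

section Temporal

variable {S : Sig}

/-- Satisfaction at position `i` of the finite or infinite sequence `s 0, …, s N`,
`N ∈ ℕ ∪ {ω}`. -/
def TFml.evalAt (s : ℕ → State S) (N : ℕ∞) : {n : ℕ} → (Fin n → ℕ) → ℕ → TFml S n → Prop
  | _, b, i, .base F => F.eval (s i) b
  | _, b, i, .not F => ¬ F.evalAt s N b i
  | _, b, i, .or F G => F.evalAt s N b i ∨ G.evalAt s N b i
  | _, b, i, .and F G => F.evalAt s N b i ∧ G.evalAt s N b i
  | _, b, i, .ex F => ∃ x : ℕ, F.evalAt s N (Fin.cons x b) i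
  | _, b, i, .all F => ∀ x : ℕ, F.evalAt s N (Fin.cons x b) i
  | _, b, i, .globally F => ∀ j : ℕ, i ≤ j → (j : ℕ∞) ≤ N → F.evalAt s N b j
  | _, b, i, .eventually F => ∃ j : ℕ, i ≤ j ∧ (j : ℕ∞) ≤ N ∧ F.evalAt s N b j

/-- The sequence `s 0, …, s N` satisfies `φ`. -/
def TFml.Sat (s : ℕ → State S) (N : ℕ∞) (φ : TFml S 0) : Prop := φ.evalAt s N Fin.elim0 0

/-- Negation, pushed inwards. -/
def TFml.neg : {n : ℕ} → TFml S n → TFml S n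
  | _, .base F => .base F.neg
  | _, .not F => F
  | _, .or F G => .and F.neg G.neg
  | _, .and F G => .or F.neg G.neg
  | _, .ex F => .all F.neg
  | _, .all F => .ex F.neg
  | _, .globally F => .eventually F.neg
  | _, .eventually F => .globally F.neg

/-- The grammar `φ ::= ψ | φ ∨ φ | φ ∧ φ | ∃ i. φ | G φ | F φ` with `ψ` singly indexed; the
connectives may also stand inside the maximal non-temporal subformulae. -/
inductive TFml.Abstractable : {n : ℕ} → TFml S n → Prop
  | sia {n : ℕ} {F : Fml S n} : F.SIA → (TFml.base F).Abstractable
  | base_or {n : ℕ} {F G : Fml S n} : (TFml.base F).Abstractable → (TFml.base G).Abstractable →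
      (TFml.base (F.or G)).Abstractable
  | base_and {n : ℕ} {F G : Fml S n} : (TFml.base F).Abstractable → (TFml.base G).Abstractable →
      (TFml.base (F.and G)).Abstractable
  | base_ex {n : ℕ} {F : Fml S (n + 1)} : (TFml.base F).Abstractable →
      (TFml.base F.ex).Abstractable
  | or {n : ℕ} {F G : TFml S n} : F.Abstractable → G.Abstractable → (F.or G).Abstractable
  | and {n : ℕ} {F G : TFml S n} : F.Abstractable → G.Abstractable → (F.and G).Abstractable
  | ex {n : ℕ} {F : TFml S (n + 1)} : F.Abstractable → F.ex.Abstractable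
  | globally {n : ℕ} {F : TFml S n} : F.Abstractable → F.globally.Abstractable
  | eventually {n : ℕ} {F : TFml S n} : F.Abstractable → F.eventually.Abstractable

/-- Universal closure. -/
def TFml.alls : (k : ℕ) → TFml S k → TFml S 0
  | 0, F => F
  | k + 1, F => TFml.alls k F.all

end Temporal

/-- The data of a liveness array property `∀ i₁ … iₖ. (ψ₁ ⇒ F ψ₂)`. -/
structure Liveness (S : Sig) where
  k : ℕ
  pre : Fml S k
  post : Fml S k

def Liveness.toTFml {S : Sig} (φ : Liveness S) : TFml S 0 :=
  TFml.alls φ.k (.or (.base φ.pre.not) (.eventually (.base φ.post)))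

/-! ## Array systems -/

/-- `V ⊎ V'`. System parameters are immutable, so there is one copy of them: `p'` is `p`. -/
abbrev Sig.trans (S : Sig) : Sig where
  Par := S.Par
  Idx := S.Idx ⊕ S.Idx
  Dat := S.Dat ⊕ S.Dat
  Arr := S.Arr ⊕ S.Arr
  size := Sum.elim S.size S.size

def Sig.unprimed (S : Sig) : Sig.Hom S S.trans := ⟨fun p => p, .inl, .inl, .inl, fun _ => rfl⟩

def Sig.primed (S : Sig) : Sig.Hom S S.trans := ⟨fun p => p, .inr, .inr, .inr, fun _ => rfl⟩

/-- `V* = V ⊎ {c₁, …, cₖ}` with fresh system parameters `cⱼ`. -/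
abbrev Sig.star (S : Sig) (k : ℕ) : Sig where
  Par := S.Par ⊕ Fin k
  Idx := S.Idx
  Dat := S.Dat
  Arr := S.Arr
  size := fun a => .inl (S.size a)

def Sig.toStar (S : Sig) (k : ℕ) : Sig.Hom S (S.star k) :=
  ⟨.inl, fun x => x, fun x => x, fun x => x, fun _ => rfl⟩

abbrev Sig.transToStar (S : Sig) (k : ℕ) : Sig.Hom S.trans (S.star k).trans where
  par := .inl
  idx := fun x => x
  dat := fun x => x
  arr := fun x => x
  size_arr := by rintro (a | a) <;> rfl

/-- `s · t'`, for states `s`, `t` with the same parameter values. -/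
def State.join {S : Sig} (s t : State S) : State S.trans where
  int := Sum.elim (fun p => s.int (.inl p))
    (Sum.elim (fun x => s.int (.inr x)) (fun x => t.int (.inr x)))
  dat := Sum.elim s.dat t.dat
  arr := Sum.elim s.arr t.arr

structure ArraySystem (S : Sig) where
  init : Fml S 0
  trans : Fml S.trans 0

namespace ArraySystem

variable {S : Sig} (M : ArraySystem S)

def Step (s t : State S) : Prop :=
  (∀ p : S.Par, t.int (.inl p) = s.int (.inl p)) ∧ s.join t ∈ M.trans.sem

/-- `s 0, …, s N` with `N ∈ ℕ ∪ {ω}` is a path; the values of `s` beyond `N` are irrelevant. -/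
def IsPath (s : ℕ → State S) (N : ℕ∞) : Prop :=
  s 0 ∈ M.init.sem ∧ ∀ i : ℕ, ((i + 1 : ℕ) : ℕ∞) ≤ N → M.Step (s i) (s (i + 1))

/-- A path that cannot be extended. -/
def IsMaxPath (s : ℕ → State S) (N : ℕ∞) : Prop :=
  M.IsPath s N ∧ ∀ i : ℕ, (i : ℕ∞) = N → ∀ t, ¬ M.Step (s i) t

/-- `φ` holds for the system: no maximal path satisfies `¬φ`. -/
def Holds (φ : TFml S 0) : Prop := ∀ s N, M.IsMaxPath s N → ¬ φ.not.Sat s N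

/-- Every maximal path that satisfies `φ` is infinite. -/
def Progressing (φ : TFml S 0) : Prop := ∀ s N, M.IsMaxPath s N → φ.Sat s N → N = ⊤

def Abstractable : Prop := M.init.Abstractable ∧ M.trans.Abstractable

end ArraySystem

/-! ## Indexed predicate abstraction

A family `P : K → Atom S 1` is a set of indexed predicates over `S`; the one further variable of
the atoms is the designated variable. A word over bitvectors is a `List (K → Bool)`. -/

/-- The abstract domain `ℕʳ × Σₘ*`. -/
abbrev AbsState (S : Sig) (K : Type) : Type := (S.Int → ℕ) × List (K → Bool)

section Abstraction

variable {S : Sig} {K : Type} {n : ℕ}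

/-- The letter at the 0-based position `i`, padded with zeros. -/
def letterAt (w : List (K → Bool)) (i : ℕ) : K → Bool := (w[i]?).getD fun _ => false

/-- The length of the word of an abstract state is the greatest parameter value. -/
def AbsState.Proper (a : AbsState S K) : Prop :=
  a.2.length = Finset.univ.sup fun p : S.Par => a.1 (.inl p)

/-- `s ⊨ Φ_w^P`. -/
def Encodes (P : K → Atom S 1) (s : State S) (w : List (K → Bool)) : Prop :=
  ∀ i < w.length, ∀ k, ((P k).eval s fun _ => i + 1) ↔ letterAt w i k = true

/-- The abstraction operation `α^P`. -/
def alpha (P : K → Atom S 1) (C : Set (State S)) : Set (AbsState S K) :=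
  {a | ∃ s ∈ C, a.1 = s.int ∧ AbsState.Proper a ∧ Encodes P s a.2}

/-! ### Prenex disjunctive normal form -/

/-- A quantifier prefix (`true` for `∃`) and a matrix in disjunctive normal form. -/
inductive PNF (S : Sig) : ℕ → Type where
  | mat {n : ℕ} (D : List (List (Atom S n))) : PNF S n
  | quant {n : ℕ} (e : Bool) (F : PNF S (n + 1)) : PNF S n

def weakenMat (D : List (List (Atom S n))) : List (List (Atom S (n + 1))) :=
  D.map fun c => c.map fun a => a.map (Sig.Hom.id S) fun i => .bvar i.succ

def PNF.map : {n n' : ℕ} → (Fin n → ITerm S n') → PNF S n → PNF S n'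
  | _, _, θ, .mat D => .mat (D.map fun c => c.map fun a => a.map (Sig.Hom.id S) θ)
  | _, _, θ, .quant e F => .quant e (F.map (ITerm.lift θ))

/-- Disjunction (`d = true`) or conjunction (`d = false`) of matrices. -/
def combine (d : Bool) (D E : List (List (Atom S n))) : List (List (Atom S n)) :=
  if d then D ++ E else D.flatMap fun c => E.map fun c' => c ++ c'

def PNF.mergeMat (d : Bool) : {n : ℕ} → List (List (Atom S n)) → PNF S n → PNF S n
  | _, D, .mat E => .mat (combine d D E)
  | _, D, .quant e F => .quant e (F.mergeMat d (weakenMat D))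

/-- Disjunction or conjunction of prenex formulae: first the quantifiers of the left one, then
those of the right one. -/
def PNF.merge (d : Bool) : {n : ℕ} → PNF S n → PNF S n → PNF S n
  | _, .mat D, G => G.mergeMat d D
  | _, .quant e F, G => .quant e (F.merge d (G.map fun i => .bvar i.succ))

/-- The prenex form of `F` (`pol = true`) or of `¬F` (`pol = false`). -/
def Fml.toPNF : {n : ℕ} → (pol : Bool) → Fml S n → PNF S n
  | _, pol, .atom a => .mat [[if pol then a else a.neg]]
  | _, pol, .not F => F.toPNF (!pol)
  | _, pol, .or F G => PNF.merge pol (F.toPNF pol) (G.toPNF pol)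
  | _, pol, .and F G => PNF.merge (!pol) (F.toPNF pol) (G.toPNF pol)
  | _, pol, .ex F => .quant pol (F.toPNF pol)
  | _, pol, .all F => .quant (!pol) (F.toPNF pol)

/-! ### The constraint-based abstraction procedure -/

/-- All index terms occurring in an index term. -/
def ITerm.subterms : ITerm S n → List (ITerm S n)
  | .add t c => .add t c :: t.subterms
  | t => [t]

def DTerm.indexTerms : DTerm S n → List (ITerm S n)
  | .read _ t => t.subterms
  | .add e _ => e.indexTerms
  | _ => []

def Atom.indexTerms : Atom S n → List (ITerm S n)
  | .idx l _ r => l.subterms ++ r.subterms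
  | .dat l _ r => l.indexTerms ++ r.indexTerms

def Atom.isDat : Atom S n → Bool
  | .idx _ _ _ => false
  | .dat _ _ _ => true

/-- The index terms of a conjunction `h` of data expressions and of the predicates `P`; in a term
of `P` the designated variable stands for an index term of `h`. -/
def termsOf (P : K → Atom S 1) (h : List (Atom S n)) : Set (ITerm S n) :=
  {t | (∃ a ∈ h, t ∈ a.indexTerms) ∨
    ∃ k, ∃ u ∈ (P k).indexTerms,
      (u.bvars = [] ∧ t = u.inst (.const 0)) ∨ (∃ a ∈ h, ∃ t' ∈ a.indexTerms, t = u.inst t')}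

/-- `(k, t, true)` is the literal `P_k[t/i]`, and `(k, t, false)` is `¬P_k[t/i]`. -/
abbrev PredLit (S : Sig) (K : Type) (n : ℕ) : Type := K × ITerm S n × Bool

/-- `h ⇒ ⋁ C` is valid in the indexed array logic. -/
def ValidClause (P : K → Atom S 1) (h : List (Atom S n)) (C : Set (PredLit S K n)) : Prop :=
  ∀ (s : State S) (b : Fin n → ℕ), (∀ a ∈ h, a.eval s b) →
    ∃ l ∈ C, (((P l.1).inst l.2.1).eval s b ↔ l.2.2 = true)

/-- `κ` of a literal: if the position `t` lies within the word, then the bit of the word there has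
the right value. -/
def kappaLit (a : AbsState S K) (b : Fin n → ℕ) (l : PredLit S K n) : Prop :=
  1 ≤ l.2.1.eval a.1 b → l.2.1.eval a.1 b ≤ a.2.length →
    letterAt a.2 (l.2.1.eval a.1 b - 1).toNat l.1 = l.2.2

/-- `κ(constr(h))`: the conjunction of all clauses `C` over the literals `P_k[t/i]`, `¬P_k[t/i]`,
`t` an index term of `h` or `P`, that follow from `h`. -/
def kappaConstr (P : K → Atom S 1) (h : List (Atom S n)) (a : AbsState S K) (b : Fin n → ℕ) :
    Prop :=
  ∀ C : Set (PredLit S K n), (∀ l ∈ C, l.2.1 ∈ termsOf P h) → ValidClause P h C →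
    ∃ l ∈ C, kappaLit a b l

/-- An index expression of the matrix is kept as it is; data expressions are treated by
`kappaConstr`. -/
def Atom.keep (a : AbsState S K) (b : Fin n → ℕ) : Atom S n → Prop
  | .idx l c r => c.holds (l.eval a.1 b) (r.eval a.1 b)
  | .dat _ _ _ => True

/-- `κ(φ*)`, where `φ*` replaces each `h_j` in the matrix `⋁ⱼ (g_j ∧ h_j)` by `constr(h_j)`. -/
def PNF.absEval (P : K → Atom S 1) (a : AbsState S K) : {n : ℕ} → (Fin n → ℕ) → PNF S n → Prop
  | _, b, .mat D => ∃ c ∈ D, (∀ A ∈ c, A.keep a b) ∧ kappaConstr P (c.filter Atom.isDat) a b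
  | _, b, .quant true F => ∃ x : ℕ, F.absEval P a (Fin.cons x b)
  | _, b, .quant false F => ∀ x : ℕ, F.absEval P a (Fin.cons x b)

/-- `⟦φ^P⟧`, as a set of abstract states. -/
def Fml.abs (P : K → Atom S 1) (F : Fml S 0) : Set (AbsState S K) :=
  {a | AbsState.Proper a ∧ (F.toPNF true).absEval P a Fin.elim0}

/-! ### Transition formulae -/

/-- `P * P'`. -/
def primePreds (P : K → Atom S 1) : K ⊕ K → Atom S.trans 1 :=
  Sum.elim (fun k => (P k).map S.unprimed .bvar) (fun k => (P k).map S.primed .bvar)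

/-- Convolution of words. -/
def convolve (u v : List (K → Bool)) : List (K ⊕ K → Bool) :=
  (List.range (max u.length v.length)).map fun i => Sum.elim (letterAt u i) (letterAt v i)

/-- `τ((s, u), (t, v)) = (s · t', u ⊙ v)`, for `s`, `t` with the same parameter values. -/
def tau (ab : AbsState S K × AbsState S K) : AbsState S.trans (K ⊕ K) :=
  (Sum.elim (fun p => ab.1.1 (.inl p))
    (Sum.elim (fun x => ab.1.1 (.inr x)) (fun x => ab.2.1 (.inr x))), convolve ab.1.2 ab.2.2)

/-- The relation on abstract states given by `φ^(P * P')` for a transition formula `φ`. -/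
def Fml.absTrans (P : K → Atom S 1) (F : Fml S.trans 0) : Set (AbsState S K × AbsState S K) :=
  {ab | AbsState.Proper ab.1 ∧ AbsState.Proper ab.2 ∧
    (∀ p : S.Par, ab.2.1 (.inl p) = ab.1.1 (.inl p)) ∧ tau ab ∈ F.abs (primePreds P)}

end Abstraction

/-! ## Finite automata -/

/-- A nondeterministic finite automaton, as finite data: initial states, accepting states, and
transitions `(q, letter, q')`. Letters are bitvectors. -/
abbrev FinAut : Type := List ℕ × List ℕ × List (ℕ × List Bool × ℕ)

def FinAut.toNFA (A : FinAut) : NFA (List Bool) ℕ where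
  start := {q | q ∈ A.1}
  accept := {q | q ∈ A.2.1}
  step q l := {q' | (q, l, q') ∈ A.2.2}

/-- The language recognized by the automaton. -/
def FinAut.lang (A : FinAut) : Set (List (List Bool)) := {w | w ∈ A.toNFA.accepts}

/-! ## Problem instances -/

/-- A finite vocabulary, given by the numbers of variables of each sort. -/
structure Vocab where
  par : ℕ
  idx : ℕ
  dat : ℕ
  arr : ℕ
  size : Fin arr → Fin par

abbrev Vocab.sig (V : Vocab) : Sig := ⟨Fin V.par, Fin V.idx, Fin V.dat, Fin V.arr, V.size⟩

/-- An array system, a liveness array property `∀ i₁ … iₖ. (ψ₁ ⇒ F ψ₂)`, and a finite set of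
indexed predicates over `V ⊎ {c₁, …, cₖ}`. -/
structure Problem where
  V : Vocab
  sys : ArraySystem V.sig
  prop : Liveness V.sig
  m : ℕ
  preds : Fin m → Atom (V.sig.star prop.k) 1

namespace Problem

variable (x : Problem)

/-- `V*`. -/
abbrev sigStar : Sig := x.V.sig.star x.prop.k

abbrev Abs : Type := AbsState x.sigStar (Fin x.m)

/-- `ψ[c/i]`. -/
def skolem (ψ : Fml x.V.sig x.prop.k) : Fml x.sigStar 0 :=
  ψ.map (x.V.sig.toStar x.prop.k) fun j => .var (.inl (.inr j))

/-- `φ_I ∧ ψ₁[c/i]`. -/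
def initStar : Fml x.sigStar 0 :=
  .and (x.sys.init.map (x.V.sig.toStar x.prop.k) Fin.elim0) (x.skolem x.prop.pre)

/-- `φ_T`, over the vocabulary `V*`. -/
def transStar : Fml x.sigStar.trans 0 :=
  x.sys.trans.map (x.V.sig.transToStar x.prop.k) Fin.elim0

/-- `¬ψ₂[c/i]`. -/
def notFinStar : Fml x.sigStar 0 := .not (x.skolem x.prop.post)

def relI : Set x.Abs := x.initStar.abs x.preds

def relT : Set (x.Abs × x.Abs) := x.transStar.absTrans x.preds

def relE : Set x.Abs := x.notFinStar.abs x.preds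

/-- The complement of `relE` in the abstract state space. -/
def relF : Set x.Abs := {a | AbsState.Proper a ∧ a ∉ x.relE}

/-- The bits at the 0-based position `i`: a number `n` is read as `1ⁿ`, and shorter components are
padded with zeros. The order is: parameters in `V`, fresh parameters, index variables,
predicates. -/
def letter (a : x.Abs) (i : ℕ) : List Bool :=
  List.ofFn (fun p : Fin x.V.par => decide (i < a.1 (.inl (.inl p)))) ++
  List.ofFn (fun c : Fin x.prop.k => decide (i < a.1 (.inl (.inr c)))) ++
  List.ofFn (fun y : Fin x.V.idx => decide (i < a.1 (.inr y))) ++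
  List.ofFn (fun k : Fin x.m => letterAt a.2 i k)

/-- The length of the language representation: the maximum over all components. -/
def len (a : x.Abs) : ℕ :=
  max (max (Finset.univ.sup fun p : Fin x.V.par => a.1 (.inl (.inl p)))
    (Finset.univ.sup fun c : Fin x.prop.k => a.1 (.inl (.inr c))))
    (max (Finset.univ.sup fun y : Fin x.V.idx => a.1 (.inr y)) a.2.length)

/-- The word representing an abstract state (the convolution of its components). -/
def enc (a : x.Abs) : List (List Bool) := (List.range (x.len a)).map (x.letter a)

/-- The word representing a pair of abstract states. -/
def encPair (ab : x.Abs × x.Abs) : List (List Bool) :=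
  (List.range (max (x.len ab.1) (x.len ab.2))).map fun i => x.letter ab.1 i ++ x.letter ab.2 i

/-- The liveness property `(I, T, F)`: every infinite path of abstract states that starts in `I`
and follows `T` meets `F`. -/
def Live (I T F : FinAut) : Prop :=
  ∀ π : ℕ → x.Abs, (∀ i, AbsState.Proper (π i)) → x.enc (π 0) ∈ I.lang →
    (∀ i, x.encPair (π i, π (i + 1)) ∈ T.lang) → ∃ i, x.enc (π i) ∈ F.lang

end Problem

/-! ### Gödel numbers of problem instances -/

section Code

variable {S : Sig} {n : ℕ}

instance [Encodable S.Idx] : Encodable S.trans.Idx := inferInstanceAs (Encodable (S.Idx ⊕ S.Idx))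
instance [Encodable S.Dat] : Encodable S.trans.Dat := inferInstanceAs (Encodable (S.Dat ⊕ S.Dat))
instance [Encodable S.Arr] : Encodable S.trans.Arr := inferInstanceAs (Encodable (S.Arr ⊕ S.Arr))
instance [Encodable S.Par] : Encodable S.trans.Par := inferInstanceAs (Encodable S.Par)
instance (k : ℕ) [Encodable S.Par] : Encodable (S.star k).Par :=
  inferInstanceAs (Encodable (S.Par ⊕ Fin k))
instance (k : ℕ) [Encodable S.Idx] : Encodable (S.star k).Idx := inferInstanceAs (Encodable S.Idx)
instance (k : ℕ) [Encodable S.Dat] : Encodable (S.star k).Dat := inferInstanceAs (Encodable S.Dat)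
instance (k : ℕ) [Encodable S.Arr] : Encodable (S.star k).Arr := inferInstanceAs (Encodable S.Arr)
instance (V : Vocab) : Encodable V.sig.Par := inferInstanceAs (Encodable (Fin V.par))
instance (V : Vocab) : Encodable V.sig.Idx := inferInstanceAs (Encodable (Fin V.idx))
instance (V : Vocab) : Encodable V.sig.Dat := inferInstanceAs (Encodable (Fin V.dat))
instance (V : Vocab) : Encodable V.sig.Arr := inferInstanceAs (Encodable (Fin V.arr))

variable [Encodable S.Par] [Encodable S.Idx] [Encodable S.Dat] [Encodable S.Arr]

def ITerm.code : ITerm S n → ℕ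
  | .var x => Nat.pair 1 (Encodable.encode x)
  | .bvar i => Nat.pair 2 i
  | .const c => Nat.pair 3 (Encodable.encode c)
  | .size a => Nat.pair 4 (Encodable.encode a)
  | .add t c => Nat.pair 5 (Nat.pair t.code (Encodable.encode c))

def DTerm.code : DTerm S n → ℕ
  | .var v => Nat.pair 1 (Encodable.encode v)
  | .const c => Nat.pair 2 (Encodable.encode c)
  | .read a t => Nat.pair 3 (Nat.pair (Encodable.encode a) t.code)
  | .add e c => Nat.pair 4 (Nat.pair e.code (Encodable.encode c))

def Cmp.code : Cmp → ℕ
  | .eq => 0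
  | .ne => 1
  | .le => 2
  | .lt => 3
  | .ge => 4
  | .gt => 5

def Atom.code : Atom S n → ℕ
  | .idx l c r => Nat.pair 1 (Nat.pair c.code (Nat.pair l.code r.code))
  | .dat l c r => Nat.pair 2 (Nat.pair c.code (Nat.pair l.code r.code))

def Fml.code : {n : ℕ} → Fml S n → ℕ
  | _, .atom a => Nat.pair 1 a.code
  | _, .not F => Nat.pair 2 F.code
  | _, .or F G => Nat.pair 3 (Nat.pair F.code G.code)
  | _, .and F G => Nat.pair 4 (Nat.pair F.code G.code)
  | _, .ex F => Nat.pair 5 F.code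
  | _, .all F => Nat.pair 6 F.code

end Code

/-- The input as a list of numbers: the vocabulary, the formulae, and the predicates. -/
def Problem.code (x : Problem) : List ℕ :=
  [x.V.par, x.V.idx, x.V.dat, x.V.arr] ++ List.ofFn (fun a => (x.V.size a : ℕ)) ++
  [x.sys.init.code, x.sys.trans.code, x.prop.k, x.prop.pre.code, x.prop.post.code, x.m] ++
  List.ofFn (fun k => (x.preds k).code)

/-! ## Automation for primitive recursive functions -/

-- Each of the three languages has two computable features: membership of a word is decidable, and
-- the number of left quotients has a computable bound `N`. These determine an automaton
-- (`nerodeAut`, `lang_nerodeAut`): words of length at most `N` represent all left quotients, and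
-- words of length at most `N ^ 2` separate different ones, so finitely many membership tests yield
-- all transitions.
--
-- Data expressions. All clauses implied by a conjunction `h` hold in an abstract state iff `h` has
-- a model in which the predicates, at the terms that fall within the word, have the truth values
-- recorded there (`kappaConstr_iff`): the critical clause consists of all literals that fail in the
-- abstract state. Satisfiability of conjunctions of atoms is decidable since only boundedly many
-- values matter and the gaps between them can be compressed (`Sat.small`, `satB_iff`).
--
-- Index expressions and quantifiers. A pair of a valuation `v` and bits `W` can be cut at a
-- position and another right piece glued on (`glue`). The truth of a quantifier-free matrix depends
-- only on bounded differences of values and on the bits near the values (`matB_congr`), so left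
-- pieces fall into finitely many classes with respect to gluing (`hasIndex_matB`). A quantifier
-- changes a bound `N` for the number of classes to `2 ^ N * N`, as in a subset construction
-- (`HasIndex.ex`). The bound serves twice: a pumping argument limits the range of every quantifier
-- (`HasIndex.pump`, `evalPre_iff_evalPreB`), which makes membership decidable, and since
-- concatenation of words is gluing, it limits the number of left quotients
-- (`nerodeIndex_wordLang`).
--
-- The computation works on untyped numerical data and is primitive recursive. Prenex forms are read
-- off the Gödel numbers directly and agree with the typed ones (`represents_rawF`, `absEval_iff`).
--
-- Soundness. A state that encodes an abstract state is itself the model required by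
-- `kappaConstr_iff`, whence the inclusions for `alpha` (`alpha_subset_abs`). A maximal path that
-- violates the property is infinite by progress. With the violating index values as fresh constant
-- parameters, its statewise abstraction starts in `relI`, follows `relT` and stays in `relE`, so it
-- avoids `relF` (`exists_abstract_path`). As `enc` is injective on proper abstract states, this
-- refutes the liveness property of the automata.

attribute [fun_prop] Primrec

namespace Primrec

variable {α β γ σ : Type} [Primcodable α] [Primcodable β] [Primcodable γ] [Primcodable σ]

@[fun_prop] theorem fun_id : Primrec (fun x : α => x) := Primrec.id

@[fun_prop] theorem fun_const (x : σ) : Primrec fun _ : α => x := Primrec.const x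

@[fun_prop] theorem fun_comp {f : β → σ} {g : α → β} (hf : Primrec f) (hg : Primrec g) :
    Primrec fun a => f (g a) := hf.comp hg

@[fun_prop] theorem fun_fst {f : α → β × γ} (hf : Primrec f) : Primrec fun a => (f a).1 :=
  fst.comp hf

@[fun_prop] theorem fun_snd {f : α → β × γ} (hf : Primrec f) : Primrec fun a => (f a).2 :=
  snd.comp hf

@[fun_prop] theorem fun_pair {f : α → β} {g : α → γ} (hf : Primrec f) (hg : Primrec g) :
    Primrec fun a => (f a, g a) := hf.pair hg

@[fun_prop] theorem fun_some {f : α → β} (hf : Primrec f) : Primrec fun a => some (f a) :=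
  option_some.comp hf

@[fun_prop] theorem fun_encode {f : α → β} (hf : Primrec f) :
    Primrec fun a => Encodable.encode (f a) := Primrec.encode.comp hf

/-! ### Booleans and case distinctions -/

@[fun_prop] theorem fun_and {f g : α → Bool} (hf : Primrec f) (hg : Primrec g) :
    Primrec fun a => f a && g a := Primrec.and.comp hf hg

@[fun_prop] theorem fun_or {f g : α → Bool} (hf : Primrec f) (hg : Primrec g) :
    Primrec fun a => f a || g a := Primrec.or.comp hf hg

@[fun_prop] theorem fun_not {f : α → Bool} (hf : Primrec f) : Primrec fun a => !f a :=
  Primrec.not.comp hf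

@[fun_prop] theorem fun_decide_eq [DecidableEq β] {f g : α → β} (hf : Primrec f)
    (hg : Primrec g) : Primrec fun a => decide (f a = g a) := (Primrec.eq.comp hf hg).decide

@[fun_prop] theorem fun_beq [BEq β] [LawfulBEq β] {f g : α → β} (hf : Primrec f)
    (hg : Primrec g) : Primrec fun a => f a == g a := by
  classical
  exact (fun_decide_eq hf hg).of_eq fun a => by rw [Bool.eq_iff_iff, decide_eq_true_eq, beq_iff_eq]

@[fun_prop] theorem fun_ite {c : α → Prop} [DecidablePred c] {f g : α → σ}
    (hc : Primrec fun a => decide (c a)) (hf : Primrec f) (hg : Primrec g) :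
    Primrec fun a => if c a then f a else g a :=
  ite ⟨inferInstance, hc⟩ hf hg

/-! ### Natural numbers -/

@[fun_prop] theorem fun_add {f g : α → ℕ} (hf : Primrec f) (hg : Primrec g) :
    Primrec fun a => f a + g a := nat_add.comp hf hg

@[fun_prop] theorem fun_sub {f g : α → ℕ} (hf : Primrec f) (hg : Primrec g) :
    Primrec fun a => f a - g a := nat_sub.comp hf hg

@[fun_prop] theorem fun_mul {f g : α → ℕ} (hf : Primrec f) (hg : Primrec g) :
    Primrec fun a => f a * g a := nat_mul.comp hf hg

@[fun_prop] theorem fun_pow {f g : α → ℕ} (hf : Primrec f) (hg : Primrec g) :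
    Primrec fun a => f a ^ g a :=
  (Primrec₂.unpaired'.1 Nat.Primrec.pow : Primrec₂ fun m n : ℕ => m ^ n).comp hf hg

@[fun_prop] theorem fun_div {f g : α → ℕ} (hf : Primrec f) (hg : Primrec g) :
    Primrec fun a => f a / g a := nat_div.comp hf hg

@[fun_prop] theorem fun_mod {f g : α → ℕ} (hf : Primrec f) (hg : Primrec g) :
    Primrec fun a => f a % g a := nat_mod.comp hf hg

@[fun_prop] theorem fun_max {f g : α → ℕ} (hf : Primrec f) (hg : Primrec g) :
    Primrec fun a => max (f a) (g a) := nat_max.comp hf hg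

@[fun_prop] theorem fun_natPair {f g : α → ℕ} (hf : Primrec f) (hg : Primrec g) :
    Primrec fun a => Nat.pair (f a) (g a) := Primrec₂.natPair.comp hf hg

@[fun_prop] theorem fun_unpair {f : α → ℕ} (hf : Primrec f) :
    Primrec fun a => Nat.unpair (f a) := unpair.comp hf

@[fun_prop] theorem fun_decide_le {f g : α → ℕ} (hf : Primrec f) (hg : Primrec g) :
    Primrec fun a => decide (f a ≤ g a) := (nat_le.comp hf hg).decide

@[fun_prop] theorem fun_decide_lt {f g : α → ℕ} (hf : Primrec f) (hg : Primrec g) :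
    Primrec fun a => decide (f a < g a) := (nat_lt.comp hf hg).decide

@[fun_prop] theorem fun_natRec {f : α → ℕ} {g : α → σ} {h : α → ℕ → σ → σ} (hf : Primrec f)
    (hg : Primrec g) (hh : Primrec fun p : α × ℕ × σ => h p.1 p.2.1 p.2.2) :
    Primrec fun a => (Nat.rec (motive := fun _ => σ) (g a) (fun n x => h a n x) (f a) : σ) :=
  nat_rec' (h := fun a p => h a p.1 p.2) hf hg hh

/-! ### Lists -/

@[fun_prop] theorem fun_cons {f : α → β} {g : α → List β} (hf : Primrec f) (hg : Primrec g) :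
    Primrec fun a => f a :: g a := list_cons.comp hf hg

@[fun_prop] theorem fun_append {f g : α → List β} (hf : Primrec f) (hg : Primrec g) :
    Primrec fun a => f a ++ g a := list_append.comp hf hg

@[fun_prop] theorem fun_range {f : α → ℕ} (hf : Primrec f) :
    Primrec fun a => List.range (f a) := list_range.comp hf

@[fun_prop] theorem fun_length {f : α → List β} (hf : Primrec f) :
    Primrec fun a => (f a).length := list_length.comp hf

@[fun_prop] theorem fun_getD {f : α → List β} {g : α → ℕ} {d : α → β} (hf : Primrec f)
    (hg : Primrec g) (hd : Primrec d) : Primrec fun a => (f a).getD (g a) (d a) := by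
  simp only [List.getD_eq_getElem?_getD]
  exact option_getD.comp (list_getElem?.comp hf hg) hd

@[fun_prop] theorem fun_idxOf [BEq β] [LawfulBEq β] {f : α → β} {g : α → List β}
    (hf : Primrec f) (hg : Primrec g) : Primrec fun a => (g a).idxOf (f a) :=
  list_findIdx hg (show Primrec fun p : α × β => p.2 == f p.1 by fun_prop)

@[fun_prop] theorem fun_map {f : α → List β} {g : α → β → σ} (hf : Primrec f)
    (hg : Primrec fun p : α × β => g p.1 p.2) : Primrec fun a => (f a).map (g a) :=
  list_map hf hg

@[fun_prop] theorem fun_flatMap {f : α → List β} {g : α → β → List σ} (hf : Primrec f)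
    (hg : Primrec fun p : α × β => g p.1 p.2) : Primrec fun a => (f a).flatMap (g a) :=
  list_flatMap hf hg

@[fun_prop] theorem fun_foldr {f : α → List β} {g : α → σ} {h : α → β → σ → σ} (hf : Primrec f)
    (hg : Primrec g) (hh : Primrec fun p : α × β × σ => h p.1 p.2.1 p.2.2) :
    Primrec fun a => (f a).foldr (fun b s => h a b s) (g a) :=
  list_foldr (h := fun a p => h a p.1 p.2) hf hg hh

@[fun_prop] theorem fun_filter {f : α → List β} {p : α → β → Bool} (hf : Primrec f)
    (hp : Primrec fun x : α × β => p x.1 x.2) : Primrec fun a => (f a).filter (p a) := by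
  have h : ∀ a, (f a).filter (p a) = (f a).flatMap fun b => if p a b then [b] else [] := by
    intro a
    induction f a with
    | nil => rfl
    | cons b l ih => by_cases hb : p a b <;> simp [hb, ih]
  simp only [h]
  fun_prop

@[fun_prop] theorem fun_any {f : α → List β} {p : α → β → Bool} (hf : Primrec f)
    (hp : Primrec fun x : α × β => p x.1 x.2) : Primrec fun a => (f a).any (p a) := by
  have h : ∀ a, (f a).any (p a) = (f a).foldr (fun b s => p a b || s) false := by
    intro a
    induction f a with
    | nil => rfl
    | cons b l ih => simp only [List.any_cons, List.foldr_cons, ih]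
  simp only [h]
  fun_prop

@[fun_prop] theorem fun_all {f : α → List β} {p : α → β → Bool} (hf : Primrec f)
    (hp : Primrec fun x : α × β => p x.1 x.2) : Primrec fun a => (f a).all (p a) := by
  have h : ∀ a, (f a).all (p a) = (f a).foldr (fun b s => p a b && s) true := by
    intro a
    induction f a with
    | nil => rfl
    | cons b l ih => simp only [List.all_cons, List.foldr_cons, ih]
  simp only [h]
  fun_prop

/-! ### Integers -/

/-- The coding of the integers interleaves: even codes are the nonnegative integers, odd codes the
negative ones. Integer arithmetic thereby reduces to parity and halving of codes. -/
theorem encode_int_natCast (n : ℕ) : Encodable.encode (n : ℤ) = 2 * n := rfl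

theorem encode_int_negSucc (n : ℕ) : Encodable.encode (Int.negSucc n) = 2 * n + 1 := rfl

theorem natAbs_le_encode (z : ℤ) : z.natAbs ≤ Encodable.encode z := by
  cases z with
  | ofNat n => rw [Int.ofNat_eq_natCast, encode_int_natCast]; simp; omega
  | negSucc n => rw [encode_int_negSucc]; simp; omega

theorem encode_int_le (z : ℤ) : Encodable.encode z ≤ 2 * z.natAbs := by
  cases z with
  | ofNat n => rw [Int.ofNat_eq_natCast, encode_int_natCast]; simp
  | negSucc n => rw [encode_int_negSucc]; simp

@[fun_prop] theorem fun_natCast {f : α → ℕ} (hf : Primrec f) : Primrec fun a => (f a : ℤ) :=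
  encode_iff.1 (show Primrec fun a => 2 * f a by fun_prop)

@[fun_prop] theorem fun_toNat {f : α → ℤ} (hf : Primrec f) : Primrec fun a => (f a).toNat := by
  have h : ∀ z : ℤ, z.toNat =
      if Encodable.encode z % 2 = 0 then Encodable.encode z / 2 else 0 := by
    rintro (n | n)
    · rw [Int.ofNat_eq_natCast, encode_int_natCast]; simp
    · rw [encode_int_negSucc, if_neg (by omega)]; rfl
  simp only [h]
  fun_prop

@[fun_prop] theorem fun_neg {f : α → ℤ} (hf : Primrec f) : Primrec fun a => -(f a) := by
  -- Apart from zero, negation exchanges the neighbouring codes `2n + 2` and `2n + 1`; zero stays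
  -- fixed because subtraction is truncated.
  have h : ∀ z : ℤ, Encodable.encode (-z) =
      if Encodable.encode z % 2 = 0 then Encodable.encode z - 1 else Encodable.encode z + 1 := by
    rintro (n | n)
    · rw [Int.ofNat_eq_natCast, encode_int_natCast]
      cases n with
      | zero => rfl
      | succ n =>
        rw [show -((n + 1 : ℕ) : ℤ) = Int.negSucc n from rfl, encode_int_negSucc,
          if_pos (by omega)]
        omega
    · rw [encode_int_negSucc, if_neg (by omega),
        show -(Int.negSucc n) = ((n + 1 : ℕ) : ℤ) from rfl, encode_int_natCast]
      omega
  refine encode_iff.1 ?_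
  simp only [h]
  fun_prop

theorem fun_natCast_sub {f g : α → ℕ} (hf : Primrec f) (hg : Primrec g) :
    Primrec fun a => (f a : ℤ) - g a := by
  have h : ∀ m n : ℕ, (m : ℤ) - n = if n ≤ m then ((m - n : ℕ) : ℤ) else -((n - m : ℕ) : ℤ) := by
    intro m n
    split_ifs <;> omega
  simp only [h]
  fun_prop

@[fun_prop] theorem fun_intAdd {f g : α → ℤ} (hf : Primrec f) (hg : Primrec g) :
    Primrec fun a => f a + g a := by
  have h : ∀ x y : ℤ, x + y = ((x.toNat + y.toNat : ℕ) : ℤ) - ((-x).toNat + (-y).toNat : ℕ) := by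
    intro x y
    omega
  simp only [h]
  exact fun_natCast_sub (by fun_prop) (by fun_prop)

@[fun_prop] theorem fun_intSub {f g : α → ℤ} (hf : Primrec f) (hg : Primrec g) :
    Primrec fun a => f a - g a := by
  simp only [sub_eq_add_neg]
  fun_prop

@[fun_prop] theorem fun_decide_intLe {f g : α → ℤ} (hf : Primrec f) (hg : Primrec g) :
    Primrec fun a => decide (f a ≤ g a) := by
  have h : ∀ x y : ℤ, decide (x ≤ y) = decide ((x - y).toNat = 0) := by
    intro x y
    congr 1
    exact propext ⟨fun _ => by omega, fun _ => by omega⟩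
  simp only [h]
  fun_prop

@[fun_prop] theorem fun_decide_intLt {f g : α → ℤ} (hf : Primrec f) (hg : Primrec g) :
    Primrec fun a => decide (f a < g a) := by
  have h : ∀ x y : ℤ, decide (x < y) = decide (x + 1 ≤ y) := by
    intro x y
    congr 1
  simp only [h]
  fun_prop

end Primrec

/-! ## Recursion on codes -/

section CodeFold

variable {α σ : Type}

/-- Recursion on a code `n = pair tag u`, where the recursive values are available at `u` and at
the two components of `u`. -/
def codeFold (G : α → ℕ → σ → σ → σ → σ) (d : σ) (a : α) (n : ℕ) : σ :=
  let u := n.unpair.2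
  G a n (if u < n then codeFold G d a u else d)
    (if u.unpair.1 < n then codeFold G d a u.unpair.1 else d)
    (if u.unpair.2 < n then codeFold G d a u.unpair.2 else d)
termination_by n
decreasing_by all_goals (simp only [u] at *; assumption)

/-- A positive tag makes the payload strictly smaller than the code, so all guards in `codeFold` are
met and the default never appears. This is why the tags of all term and formula codes start at 1. -/
theorem codeFold_pair (G : α → ℕ → σ → σ → σ → σ) (d : σ) (a : α) (t u : ℕ) :
    codeFold G d a (Nat.pair (t + 1) u) =
      G a (Nat.pair (t + 1) u) (codeFold G d a u) (codeFold G d a u.unpair.1)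
        (codeFold G d a u.unpair.2) := by
  have h : u < Nat.pair (t + 1) u := by
    rw [Nat.pair]
    split_ifs with h
    · nlinarith
    · nlinarith
  rw [codeFold]
  simp only [Nat.unpair_pair]
  rw [if_pos h, if_pos (lt_of_le_of_lt (Nat.unpair_left_le u) h),
    if_pos (lt_of_le_of_lt (Nat.unpair_right_le u) h)]

theorem primrec_codeFold [Primcodable α] [Primcodable σ] {G : α → ℕ → σ → σ → σ → σ} (d : σ)
    (hG : Primrec fun p : α × ℕ × σ × σ × σ => G p.1 p.2.1 p.2.2.1 p.2.2.2.1 p.2.2.2.2) :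
    Primrec fun p : α × ℕ => codeFold G d p.1 p.2 := by
  refine Primrec.nat_strong_rec (codeFold G d)
    (g := fun a l => some (G a l.length (l.getD l.length.unpair.2 d)
      (l.getD l.length.unpair.2.unpair.1 d) (l.getD l.length.unpair.2.unpair.2 d))) ?_ ?_
  · exact Primrec.fun_some (Primrec.fun_comp (f := fun p : α × ℕ × σ × σ × σ =>
      G p.1 p.2.1 p.2.2.1 p.2.2.2.1 p.2.2.2.2)
      (g := fun p : α × List σ => (p.1, p.2.length, p.2.getD p.2.length.unpair.2 d,
        p.2.getD p.2.length.unpair.2.unpair.1 d, p.2.getD p.2.length.unpair.2.unpair.2 d))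
      hG (by fun_prop))
  · intro a n
    -- Looking beyond the end of the table of earlier values returns `d`, which is exactly what the
    -- guards of `codeFold` do.
    have key : ∀ k, ((List.range n).map (codeFold G d a)).getD k d =
        if k < n then codeFold G d a k else d := by
      intro k
      split_ifs with h <;> simp [List.getD_eq_getElem?_getD, h]
    rw [codeFold]
    simp only [key, List.length_map, List.length_range]

end CodeFold

/-! ## Tuples over a list -/

section Tuples

variable {α : Type}

/-- All lists of length `n` with entries in `l`. -/
def tuples (l : List α) (n : ℕ) : List (List α) :=
  Nat.rec (motive := fun _ => List (List α)) [[]]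
    (fun _ t => t.flatMap fun w => l.map fun a => a :: w) n

theorem mem_tuples {l : List α} {n : ℕ} {w : List α} :
    w ∈ tuples l n ↔ w.length = n ∧ ∀ a ∈ w, a ∈ l := by
  induction n generalizing w with
  | zero => simp +contextual [tuples]
  | succ n ih =>
    have : tuples l (n + 1) = (tuples l n).flatMap fun w => l.map fun a => a :: w := rfl
    rw [this]
    cases w with
    | nil => simp
    | cons a w => simp [ih]; tauto

@[fun_prop] theorem primrec_tuples [Primcodable α] :
    Primrec fun p : List α × ℕ => tuples p.1 p.2 := by
  unfold tuples
  fun_prop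

end Tuples


/-! ## Untyped quantifier-free array formulae -/

namespace Flat

/-- `(j, c)` is the index term `x_j + c`, where the slot `0` holds the constant zero. -/
abbrev FI : Type := ℕ × ℤ

/-- `(a, t, c)` is the data term `a[t] + c`, where the array `0` is constantly zero. -/
abbrev FD : Type := ℕ × FI × ℤ

/-- Sort (`true` for data expressions), comparison, both sides, and the occurring index terms. -/
abbrev FAtom : Type := Bool × ℕ × FD × FD × List FI

def fiEval (v : ℕ → ℤ) (t : FI) : ℤ := v t.1 + t.2

def fdEval (v : ℕ → ℤ) (A : ℕ → ℤ → ℤ) (isDat : Bool) (d : FD) : ℤ :=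
  (if isDat then A d.1 (fiEval v d.2.1) else fiEval v d.2.1) + d.2.2

/-- The numbers are those of `Cmp.code`; every number from 5 on is read as `>`. -/
def cmpB (c : ℕ) (x y : ℤ) : Bool :=
  if c = 0 then decide (x = y) else if c = 1 then !decide (x = y)
  else if c = 2 then decide (x ≤ y) else if c = 3 then decide (x < y)
  else if c = 4 then decide (y ≤ x) else decide (y < x)

def negCode (c : ℕ) : ℕ :=
  if c = 0 then 1 else if c = 1 then 0 else if c = 2 then 5 else if c = 3 then 4
  else if c = 4 then 3 else 2

def faEval (v : ℕ → ℤ) (A : ℕ → ℤ → ℤ) (a : FAtom) : Bool :=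
  cmpB a.2.1 (fdEval v A a.1 a.2.2.1) (fdEval v A a.1 a.2.2.2.1)

theorem cmpB_negCode (c : ℕ) (x y : ℤ) : cmpB (negCode c) x y = !cmpB c x y := by
  unfold cmpB negCode
  grind

theorem cmpB_congr {c : ℕ} {x y x' y' : ℤ} (h₁ : x < y ↔ x' < y') (h₂ : y < x ↔ y' < x') :
    cmpB c x y = cmpB c x' y' := by
  have h₃ : x = y ↔ x' = y' := by omega
  have h₄ : x ≤ y ↔ x' ≤ y' := by omega
  have h₅ : y ≤ x ↔ y' ≤ x' := by omega
  simp only [cmpB, h₁, h₂, h₃, h₄, h₅]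

/-- Slot 0 and array 0 supply the constant zero, so that constants need no syntax of their own.
Nonnegativity reflects that index variables range over `ℕ`. -/
def IsModel (v : ℕ → ℤ) (A : ℕ → ℤ → ℤ) : Prop :=
  v 0 = 0 ∧ (∀ j, 0 ≤ v j) ∧ ∀ z, A 0 z = 0

def Sat (cs : List FAtom) : Prop := ∃ v A, IsModel v A ∧ ∀ a ∈ cs, faEval v A a = true

/-! ### Compression of gaps -/

section Compress

variable (N : Finset ℤ)

def rank (z : ℤ) : ℤ := (N.filter (· < z)).card

/-- Squeezes every gap of `N` so that the elements of `N` become consecutive integers, normalized to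
fix zero. -/
def compress (z : ℤ) : ℤ := rank N z - rank N 0

theorem rank_mono {x y : ℤ} (h : x ≤ y) : rank N x ≤ rank N y := by
  unfold rank
  exact_mod_cast Finset.card_le_card
    (Finset.monotone_filter_right _ fun _ _ hz => lt_of_lt_of_le hz h)

theorem rank_succ {z : ℤ} (hz : z ∈ N) : rank N (z + 1) = rank N z + 1 := by
  unfold rank
  have : N.filter (· < z + 1) = insert z (N.filter (· < z)) := by
    ext y
    simp only [Finset.mem_filter, Finset.mem_insert]
    constructor
    · rintro ⟨h₁, h₂⟩
      by_cases h : y = z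
      · exact Or.inl h
      · exact Or.inr ⟨h₁, by omega⟩
    · rintro (rfl | ⟨h₁, h₂⟩)
      · exact ⟨hz, by omega⟩
      · exact ⟨h₁, by omega⟩
  rw [this, Finset.card_insert_of_notMem (by simp)]
  push_cast
  ring

theorem rank_add {z : ℤ} (n : ℕ) (h : ∀ i < n, z + (i : ℤ) ∈ N) :
    rank N (z + n) = rank N z + n := by
  induction n with
  | zero => simp
  | succ n ih =>
    have := rank_succ N (h n (by omega))
    push_cast
    rw [← add_assoc, this, ih fun i hi => h i (by omega)]
    ring

theorem compress_zero : compress N 0 = 0 := sub_self _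

theorem compress_lt {x y : ℤ} (hx : x ∈ N) (h : x < y) : compress N x < compress N y := by
  have h₁ := rank_succ N hx
  have h₂ := rank_mono N (show x + 1 ≤ y by omega)
  unfold compress
  omega

theorem compress_nonneg {x : ℤ} (h : 0 ≤ x) : 0 ≤ compress N x :=
  sub_nonneg.2 (rank_mono N h)

theorem compress_natAbs_le (z : ℤ) : (compress N z).natAbs ≤ N.card := by
  have h : ∀ z, 0 ≤ rank N z ∧ rank N z ≤ N.card := fun z =>
    ⟨by unfold rank; positivity, by
      unfold rank; exact_mod_cast Finset.card_le_card (Finset.filter_subset _ _)⟩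
  have h₁ := h z
  have h₂ := h 0
  unfold compress
  omega

theorem compress_lt_iff {x y : ℤ} (hx : x ∈ N) (hy : y ∈ N) :
    compress N x < compress N y ↔ x < y := by
  refine ⟨fun h => ?_, compress_lt N hx⟩
  by_contra h'
  rcases (not_lt.1 h').eq_or_lt with rfl | h''
  · exact lt_irrefl _ h
  · exact lt_asymm h (compress_lt N hy h'')

/-- The points of distance at most `M` from `S`. -/
noncomputable def nbhd (S : Finset ℤ) (M : ℕ) : Finset ℤ := S.biUnion fun v => Finset.Icc (v - M) (v + M)

theorem mem_nbhd {S : Finset ℤ} {M : ℕ} {v c : ℤ} (hv : v ∈ S) (hc : c.natAbs ≤ M) :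
    v + c ∈ nbhd S M := by
  simp only [nbhd, Finset.mem_biUnion, Finset.mem_Icc]
  exact ⟨v, hv, by omega, by omega⟩

theorem card_nbhd_le (S : Finset ℤ) (M : ℕ) : (nbhd S M).card ≤ S.card * (2 * M + 1) := by
  refine Finset.card_biUnion_le_card_mul _ _ _ fun v _ => ?_
  simp only [Int.card_Icc]
  omega

/-- All points between `v` and `v + c` lie in the neighbourhood, so nothing is squeezed there and
the offset survives. -/
theorem compress_add {S : Finset ℤ} {M : ℕ} {v c : ℤ} (hv : v ∈ S) (hc : c.natAbs ≤ M) :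
    compress (nbhd S M) (v + c) = compress (nbhd S M) v + c := by
  unfold compress
  rcases le_total 0 c with h | h
  · obtain ⟨n, rfl⟩ := Int.eq_ofNat_of_zero_le h
    rw [rank_add _ n fun i hi => mem_nbhd hv (by omega)]
    ring
  · obtain ⟨n, hn⟩ := Int.eq_ofNat_of_zero_le (Int.neg_nonneg_of_nonpos h)
    obtain rfl : c = -n := by omega
    have := rank_add (nbhd S M) (z := v + -n) n fun i hi => by
      rw [add_assoc]
      exact mem_nbhd hv (by omega)
    rw [neg_add_cancel_right] at this
    omega

end Compress

/-! ### The small model property -/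

/-- All numbers in the atom are at most `s`. -/
def FAtom.Bounded (s : ℕ) (a : FAtom) : Prop :=
  (a.2.2.1.1 ≤ s ∧ a.2.2.1.2.1.1 ≤ s ∧ a.2.2.1.2.1.2.natAbs ≤ s ∧ a.2.2.1.2.2.natAbs ≤ s) ∧
  (a.2.2.2.1.1 ≤ s ∧ a.2.2.2.1.2.1.1 ≤ s ∧ a.2.2.2.1.2.1.2.natAbs ≤ s ∧
    a.2.2.2.1.2.2.natAbs ≤ s) ∧
  ∀ t ∈ a.2.2.2.2, t.1 ≤ s ∧ t.2.natAbs ≤ s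

theorem encode_mem_le {α : Type} [Encodable α] {a : α} {l : List α} (h : a ∈ l) :
    Encodable.encode a ≤ Encodable.encode l := by
  induction l with
  | nil => simp at h
  | cons b l ih =>
    rw [Encodable.encode_list_cons]
    rcases List.mem_cons.1 h with rfl | h
    · exact (Nat.left_le_pair _ _).trans (Nat.le_succ _)
    · exact (ih h).trans ((Nat.right_le_pair _ _).trans (Nat.le_succ _))

theorem length_le_encode {α : Type} [Encodable α] (l : List α) :
    l.length ≤ Encodable.encode l := by
  induction l with
  | nil => simp
  | cons b l ih =>
    rw [Encodable.encode_list_cons]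
    exact Nat.succ_le_succ (ih.trans (Nat.right_le_pair _ _))

theorem encode_fst_le {α β : Type} [Encodable α] [Encodable β] (p : α × β) :
    Encodable.encode p.1 ≤ Encodable.encode p := by
  rw [Encodable.encode_prod_val]
  exact Nat.left_le_pair _ _

theorem encode_snd_le {α β : Type} [Encodable α] [Encodable β] (p : α × β) :
    Encodable.encode p.2 ≤ Encodable.encode p := by
  rw [Encodable.encode_prod_val]
  exact Nat.right_le_pair _ _

theorem FI.le_encode (t : FI) : t.1 ≤ Encodable.encode t ∧ t.2.natAbs ≤ Encodable.encode t :=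
  ⟨encode_fst_le t, (Primrec.natAbs_le_encode _).trans (encode_snd_le t)⟩

theorem FD.le_encode (d : FD) : d.1 ≤ Encodable.encode d ∧ d.2.1.1 ≤ Encodable.encode d ∧
    d.2.1.2.natAbs ≤ Encodable.encode d ∧ d.2.2.natAbs ≤ Encodable.encode d := by
  have h₁ := encode_snd_le d
  have h₂ := encode_fst_le d.2
  have h₃ := encode_snd_le d.2
  have h₄ := FI.le_encode d.2.1
  have h₅ := Primrec.natAbs_le_encode d.2.2
  exact ⟨encode_fst_le d, by omega, by omega, by omega⟩

/-- Pairing dominates both arguments, so a Gödel number is a crude but computable bound for all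
numbers inside the coded object. -/
theorem FAtom.bounded_encode (a : FAtom) : a.Bounded (Encodable.encode a) := by
  have h₁ := encode_snd_le a
  have h₂ := encode_snd_le a.2
  have h₃ := encode_fst_le a.2.2
  have h₄ := encode_snd_le a.2.2
  have h₅ := encode_fst_le a.2.2.2
  have h₆ := encode_snd_le a.2.2.2
  have h₇ := FD.le_encode a.2.2.1
  have h₈ := FD.le_encode a.2.2.2.1
  refine ⟨⟨?_, ?_, ?_, ?_⟩, ⟨?_, ?_, ?_, ?_⟩, fun t ht => ?_⟩ <;> try omega
  have h₉ := FI.le_encode t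
  have h₀ := encode_mem_le ht
  omega

theorem FAtom.Bounded.mono {s s' : ℕ} {a : FAtom} (h : a.Bounded s) (hs : s ≤ s') :
    a.Bounded s' := by
  obtain ⟨⟨h₁, h₂, h₃, h₄⟩, ⟨h₅, h₆, h₇, h₈⟩, h₉⟩ := h
  refine ⟨⟨?_, ?_, ?_, ?_⟩, ⟨?_, ?_, ?_, ?_⟩, fun t ht => ?_⟩ <;> try omega
  have := h₉ t ht
  omega

/-- A bound for the values of the index variables in a small model. -/
def intBound (s : ℕ) : ℕ := (s + 1) * (2 * (2 * s) + 1)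

/-- A bound for the array elements in a small model. -/
def datBound (s : ℕ) : ℕ := ((s + 1) * intBound s + 1) * (2 * (2 * s) + 1)

/-- If a conjunction of atoms is satisfiable, then by a model with bounded values. -/
theorem Sat.small {cs : List FAtom} {s : ℕ} (hs : ∀ a ∈ cs, a.Bounded s) (h : Sat cs) :
    ∃ v A, IsModel v A ∧ (∀ a ∈ cs, faEval v A a = true) ∧
      (∀ j, (v j).natAbs ≤ intBound s ∧ (s < j → v j = 0)) ∧
      ∀ i z, (A i z).natAbs ≤ datBound s ∧ (s < i ∨ intBound s < z.natAbs → A i z = 0) := by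
  classical
  obtain ⟨v, A, ⟨hv0, hv, hA⟩, hcs⟩ := h
  -- Only slots up to `s` occur. An index expression adds an inner and an outer offset, each at most
  -- `s`, hence the radius `2 * s`.
  set S₁ : Finset ℤ := (Finset.range (s + 1)).image v with hS₁
  set N₁ := nbhd S₁ (2 * s) with hN₁
  -- All reads of the conjunction happen at positions in `N₁`, so these are the relevant array
  -- elements.
  set S₂ : Finset ℤ := insert 0 (((Finset.range (s + 1)) ×ˢ N₁).image fun p => A p.1 p.2) with hS₂
  set N₂ := nbhd S₂ (2 * s) with hN₂
  have hS₁v : ∀ j ≤ s, v j ∈ S₁ := fun j hj =>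
    Finset.mem_image_of_mem v (Finset.mem_range.2 (by omega))
  have hcard₁ : N₁.card ≤ intBound s := (card_nbhd_le _ _).trans <|
    Nat.mul_le_mul_right _ (Finset.card_image_le.trans (by simp))
  have hcard₂ : N₂.card ≤ datBound s := by
    refine (card_nbhd_le _ _).trans (Nat.mul_le_mul_right _ ?_)
    refine (Finset.card_insert_le _ _).trans (Nat.succ_le_succ ?_)
    refine Finset.card_image_le.trans ?_
    rw [Finset.card_product, Finset.card_range]
    exact Nat.mul_le_mul_left _ hcard₁
  have hinj : ∀ p ∈ N₁, ∀ q ∈ N₁, compress N₁ p = compress N₁ q → p = q := by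
    intro p hp q hq hpq
    have h₁ := compress_lt_iff N₁ hp hq
    have h₂ := compress_lt_iff N₁ hq hp
    omega
  let v' : ℕ → ℤ := fun j => if j ≤ s then compress N₁ (v j) else 0
  -- Positions are transported along `compress N₁`, which is injective on `N₁`, and elements along
  -- `compress N₂`; every other position gets the value zero, which makes the model finite.
  let A' : ℕ → ℤ → ℤ := fun i z =>
    if h : i ≤ s ∧ ∃ p ∈ N₁, compress N₁ p = z then compress N₂ (A i h.2.choose) else 0
  have hA' : ∀ i ≤ s, ∀ p ∈ N₁, A' i (compress N₁ p) = compress N₂ (A i p) := by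
    intro i hi p hp
    have hex : i ≤ s ∧ ∃ q ∈ N₁, compress N₁ q = compress N₁ p := ⟨hi, p, hp, rfl⟩
    have hch := hex.2.choose_spec
    simp only [A', dif_pos hex]
    rw [hinj _ hch.1 _ hp hch.2]
  have hfi : ∀ t : FI, t.1 ≤ s → t.2.natAbs ≤ 2 * s →
      fiEval v' t = compress N₁ (fiEval v t) ∧ fiEval v t ∈ N₁ := by
    intro t h₁ h₂
    refine ⟨?_, mem_nbhd (hS₁v _ h₁) h₂⟩
    simp only [fiEval, v', if_pos h₁]
    exact (compress_add (hS₁v _ h₁) h₂).symm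
  have hfd : ∀ (b : Bool) (d : FD), d.1 ≤ s → d.2.1.1 ≤ s → d.2.1.2.natAbs ≤ s →
      d.2.2.natAbs ≤ s →
      fdEval v' A' b d = compress (if b then N₂ else N₁) (fdEval v A b d) ∧
        fdEval v A b d ∈ (if b then N₂ else N₁) := by
    intro b d h₁ h₂ h₃ h₄
    obtain ⟨h₅, h₆⟩ := hfi d.2.1 h₂ (by omega)
    cases b with
    | false =>
      -- The outer offset is absorbed into the index term, whose total offset stays within the
      -- radius.
      obtain ⟨h₇, h₈⟩ := hfi (d.2.1.1, d.2.1.2 + d.2.2) h₂ (by simp only; omega)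
      have : ∀ w : ℕ → ℤ, fiEval w (d.2.1.1, d.2.1.2 + d.2.2) = fiEval w d.2.1 + d.2.2 :=
        fun w => (add_assoc _ _ _).symm
      rw [this, this] at h₇
      rw [this] at h₈
      exact ⟨h₇, h₈⟩
    | true =>
      have hm : A d.1 (fiEval v d.2.1) ∈ S₂ := Finset.mem_insert_of_mem
        (Finset.mem_image.2 ⟨(d.1, fiEval v d.2.1),
          Finset.mem_product.2 ⟨Finset.mem_range.2 (by omega), h₆⟩, rfl⟩)
      have hoff : d.2.2.natAbs ≤ 2 * s := by omega
      refine ⟨?_, mem_nbhd hm hoff⟩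
      simp only [fdEval, if_true]
      rw [h₅, hA' _ h₁ _ h₆, compress_add hm hoff]
  refine ⟨v', A', ⟨?_, fun j => ?_, fun z => ?_⟩, fun a ha => ?_, fun j => ⟨?_, fun hj => ?_⟩,
    fun i z => ⟨?_, fun hi => ?_⟩⟩
  · simp only [v', hv0, compress_zero, ite_self]
  · simp only [v']
    split_ifs
    exacts [compress_nonneg _ (hv j), le_rfl]
  · simp only [A']
    split_ifs
    · rw [hA, compress_zero]
    · rfl
  · obtain ⟨⟨h₁, h₂, h₃, h₄⟩, ⟨h₅, h₆, h₇, h₈⟩, -⟩ := hs a ha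
    rw [← hcs a ha]
    obtain ⟨e₁, m₁⟩ := hfd a.1 a.2.2.1 h₁ h₂ h₃ h₄
    obtain ⟨e₂, m₂⟩ := hfd a.1 a.2.2.2.1 h₅ h₆ h₇ h₈
    unfold faEval
    rw [e₁, e₂]
    exact cmpB_congr (compress_lt_iff _ m₁ m₂) (compress_lt_iff _ m₂ m₁)
  · simp only [v']
    split_ifs
    exacts [(compress_natAbs_le _ _).trans hcard₁, by simp]
  · simp only [v', if_neg (not_le.2 hj)]
  · simp only [A']
    split_ifs
    exacts [(compress_natAbs_le _ _).trans hcard₂, by simp]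
  · simp only [A']
    rw [dif_neg]
    rintro ⟨h₁, p, -, rfl⟩
    have := compress_natAbs_le N₁ p
    omega

/-! ### Deciding satisfiability -/

/-- The valuation given by a list. -/
def listVal (l : List ℕ) (j : ℕ) : ℤ := if j = 0 then 0 else (l.getD j 0 : ℕ)

/-- The arrays given by a list of elements. -/
def listArr (t : List ℤ) (i : ℕ) (z : ℤ) : ℤ :=
  if i = 0 then 0 else t.getD (Nat.pair i (Encodable.encode z)) 0

def intRange (B : ℕ) : List ℤ := (List.range (2 * B + 1)).map fun i : ℕ => (i : ℤ) - B

theorem mem_intRange {B : ℕ} {z : ℤ} : z ∈ intRange B ↔ z.natAbs ≤ B := by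
  simp only [intRange, List.mem_map, List.mem_range]
  constructor
  · rintro ⟨i, hi, rfl⟩
    omega
  · intro h
    exact ⟨(z + B).toNat, by omega, by omega⟩

/-- Exhaustive search through the models left by `Sat.small`, with the Gödel number of the
conjunction as `s`. All arrays sit in one table indexed by `Nat.pair i (encode z)`; an integer of
absolute value at most `B` has a code of at most `2 * B`, which determines the length of the table.
-/
def satB (cs : List FAtom) : Bool :=
  let s := Encodable.encode cs
  (tuples (List.range (intBound s + 1)) (s + 1)).any fun l =>
    (tuples (intRange (datBound s)) (Nat.pair s (2 * intBound s) + 1)).any fun t =>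
      cs.all fun a => faEval (listVal l) (listArr t) a

theorem satB_iff (cs : List FAtom) : satB cs = true ↔ Sat cs := by
  simp only [satB, List.any_eq_true, List.all_eq_true, mem_tuples]
  constructor
  · rintro ⟨l, -, t, -, h⟩
    exact ⟨listVal l, listArr t, ⟨by simp [listVal], fun j => by simp only [listVal]; split_ifs <;>
      omega, fun z => by simp [listArr]⟩, h⟩
  · intro h
    set s := Encodable.encode cs
    obtain ⟨v, A, ⟨hv0, hv, hA⟩, hcs, hvb, hAb⟩ := h.small (s := s) fun a ha =>
      (FAtom.bounded_encode a).mono (encode_mem_le ha)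
    set K := Nat.pair s (2 * intBound s) + 1
    let l : List ℕ := (List.range (s + 1)).map fun j => (v j).toNat
    let t : List ℤ := (List.range K).map fun k =>
      A k.unpair.1 (Denumerable.ofNat ℤ k.unpair.2)
    have hl : listVal l = v := by
      funext j
      simp only [listVal]
      split_ifs with hj
      · rw [hj, hv0]
      · by_cases hjs : j < s + 1
        · simp [l, List.getD_eq_getElem?_getD, hjs, hv j]
        · simp [l, List.getD_eq_getElem?_getD, hjs, (hvb j).2 (by omega)]
    have ht : listArr t = A := by
      funext i z
      simp only [listArr]
      split_ifs with hi
      · rw [hi, hA]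
      · by_cases hk : Nat.pair i (Encodable.encode z) < K
        · simp only [t, List.getD_eq_getElem?_getD, List.getElem?_map, List.getElem?_range hk,
            Option.map_some, Option.getD_some, Nat.unpair_pair]
          exact congrArg (A i) (Denumerable.ofNat_encode z)
        · have : s < i ∨ intBound s < z.natAbs := by
            by_contra hcon
            push Not at hcon
            refine hk (Nat.lt_succ_of_le ?_)
            have hz := Primrec.encode_int_le z
            have hl : StrictMono fun i => Nat.pair i (Encodable.encode z) :=
              fun _ _ h => Nat.pair_lt_pair_left _ h
            have hr : StrictMono fun e => Nat.pair s e := fun _ _ h => Nat.pair_lt_pair_right _ h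
            exact (hl.monotone hcon.1).trans (hr.monotone (by omega))
          rw [(hAb i z).2 this, List.getD_eq_getElem?_getD, List.getElem?_eq_none (by simpa [t]
            using hk)]
          rfl
    refine ⟨l, ⟨by simp [l], fun x hx => ?_⟩, t, ⟨by simp [t], fun x hx => ?_⟩, ?_⟩
    · obtain ⟨j, -, rfl⟩ := List.mem_map.1 hx
      have := (hvb j).1
      exact List.mem_range.2 (by omega)
    · obtain ⟨k, -, rfl⟩ := List.mem_map.1 hx
      exact mem_intRange.2 (hAb _ _).1
    · rw [hl, ht]
      exact hcs

@[fun_prop] theorem primrec_intBound : Primrec intBound := by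
  unfold intBound
  fun_prop

@[fun_prop] theorem primrec_datBound : Primrec datBound := by
  unfold datBound
  fun_prop

@[fun_prop] theorem primrec_intRange : Primrec intRange := by
  unfold intRange
  fun_prop

@[fun_prop] theorem primrec_cmpB : Primrec fun p : ℕ × ℤ × ℤ => cmpB p.1 p.2.1 p.2.2 := by
  unfold cmpB
  fun_prop

@[fun_prop] theorem primrec_negCode : Primrec negCode := by
  unfold negCode
  fun_prop

@[fun_prop] theorem primrec_listVal : Primrec fun p : List ℕ × ℕ => listVal p.1 p.2 := by
  unfold listVal
  fun_prop

@[fun_prop] theorem primrec_listArr :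
    Primrec fun p : List ℤ × ℕ × ℤ => listArr p.1 p.2.1 p.2.2 := by
  unfold listArr
  fun_prop

@[fun_prop] theorem primrec_fiEval {α : Type} [Primcodable α] {v : α → ℕ → ℤ} {t : α → FI}
    (hv : Primrec fun p : α × ℕ => v p.1 p.2) (ht : Primrec t) :
    Primrec fun a => fiEval (v a) (t a) := by
  unfold fiEval
  exact Primrec.fun_intAdd (Primrec.fun_comp hv (Primrec.fun_pair Primrec.fun_id (by fun_prop)))
    (by fun_prop)

theorem primrec_fdEval {α : Type} [Primcodable α] {v : α → ℕ → ℤ} {A : α → ℕ → ℤ → ℤ}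
    {b : α → Bool} {d : α → FD} (hv : Primrec fun p : α × ℕ => v p.1 p.2)
    (hA : Primrec fun p : α × ℕ × ℤ => A p.1 p.2.1 p.2.2) (hb : Primrec b) (hd : Primrec d) :
    Primrec fun a => fdEval (v a) (A a) (b a) (d a) := by
  have h : Primrec fun a => fiEval (v a) (d a).2.1 := primrec_fiEval hv (by fun_prop)
  have h' : Primrec fun a => A a (d a).1 (fiEval (v a) (d a).2.1) :=
    Primrec.fun_comp (f := fun p : α × ℕ × ℤ => A p.1 p.2.1 p.2.2)
      (g := fun a => (a, (d a).1, fiEval (v a) (d a).2.1)) hA (by fun_prop)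
  unfold fdEval
  fun_prop

@[fun_prop] theorem primrec_faEval {α : Type} [Primcodable α] {v : α → ℕ → ℤ}
    {A : α → ℕ → ℤ → ℤ} {c : α → FAtom} (hv : Primrec fun p : α × ℕ => v p.1 p.2)
    (hA : Primrec fun p : α × ℕ × ℤ => A p.1 p.2.1 p.2.2) (hc : Primrec c) :
    Primrec fun a => faEval (v a) (A a) (c a) := by
  have h₁ : Primrec fun a => fdEval (v a) (A a) (c a).1 (c a).2.2.1 :=
    primrec_fdEval hv hA (by fun_prop) (by fun_prop)
  have h₂ : Primrec fun a => fdEval (v a) (A a) (c a).1 (c a).2.2.2.1 :=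
    primrec_fdEval hv hA (by fun_prop) (by fun_prop)
  unfold faEval
  fun_prop

@[fun_prop] theorem primrec_satB : Primrec satB := by
  unfold satB
  fun_prop

end Flat


/-! ## Untyped prenex formulae over words -/

namespace Flat

/-- Substitute `τ` for the designated variable, which has the slot `1`. -/
def instFI (τ u : FI) : FI := if u.1 = 1 then (τ.1, τ.2 + u.2) else u

def instFD (τ : FI) (d : FD) : FD := (d.1, instFI τ d.2.1, d.2.2)

/-- The atom `P[τ/i]` if `bit` holds, and its negation otherwise. -/
def litFA (bit : Bool) (τ : FI) (a : FAtom) : FAtom :=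
  (a.1, if bit then a.2.1 else negCode a.2.1, instFD τ a.2.2.1, instFD τ a.2.2.2.1, [])

/-- The index terms of a conjunction and of the predicates. -/
def termsFA (preds c : List FAtom) : List FI :=
  let hs := (c.filter fun a => a.1).flatMap fun a => a.2.2.2.2
  hs ++ (preds.flatMap fun a => a.2.2.2.2).flatMap fun u =>
    if u.1 = 1 then hs.map fun τ => instFI τ u else [u]

/-- The greatest value among the slots `ps`. -/
def maxVal (ps : List ℕ) (v : ℕ → ℕ) : ℕ := (ps.map v).foldr max 0

def intVal (v : ℕ → ℕ) (j : ℕ) : ℤ := v j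

/-- The data expressions of a conjunction together with the requirements of the word `W`. -/
def constraints (preds : List FAtom) (ps : List ℕ) (v : ℕ → ℕ) (W : ℕ → ℕ → Bool)
    (c : List FAtom) : List FAtom :=
  (c.filter fun a => a.1) ++ (termsFA preds c).flatMap fun τ =>
    if (decide (1 ≤ fiEval (intVal v) τ) && decide (fiEval (intVal v) τ ≤ maxVal ps v)) = true then
      (List.range preds.length).map fun k =>
        litFA (W (fiEval (intVal v) τ - 1).toNat k) τ (preds.getD k default)
    else []

/-- Index expressions are evaluated under `v`. The data expressions only have to be satisfiable
together with the literals demanded by `W`, in a model that may disagree with `v`, because the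
clauses of the abstraction are consequences of the data expressions alone. -/
def matB (D : List (List FAtom)) (preds : List FAtom) (ps : List ℕ) (v : ℕ → ℕ)
    (W : ℕ → ℕ → Bool) : Bool :=
  D.any fun c => (c.all fun a => a.1 || faEval (intVal v) (fun _ _ => 0) a) &&
    satB (constraints preds ps v W c)

/-- Quantifiers over the slots `j, j + 1, …` in front of `M`. -/
def evalPre (M : (ℕ → ℕ) → Prop) : List Bool → ℕ → (ℕ → ℕ) → Prop
  | [], _, v => M v
  | true :: es, j, v => ∃ x, evalPre M es (j + 1) (Function.update v j x)
  | false :: es, j, v => ∀ x, evalPre M es (j + 1) (Function.update v j x)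

theorem le_maxVal_iff {ps : List ℕ} {v : ℕ → ℕ} {x : ℤ} :
    x ≤ maxVal ps v ↔ x ≤ 0 ∨ ∃ p ∈ ps, x ≤ v p := by
  induction ps with
  | nil => simp [maxVal]
  | cons p ps ih =>
    have : maxVal (p :: ps) v = max (v p) (maxVal ps v) := rfl
    rw [this]
    push_cast
    rw [le_max_iff, ih]
    simp
    tauto

/-! ### Local similarity -/

/-- `(v, W)` and `(v', W')` agree on bounded differences and on the bits close to the values. -/
def Sim (s R : ℕ) (v : ℕ → ℕ) (W : ℕ → ℕ → Bool) (v' : ℕ → ℕ) (W' : ℕ → ℕ → Bool) : Prop :=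
  (∀ i ≤ s, ∀ j ≤ s, ∀ c : ℤ, c.natAbs ≤ R → ((v i : ℤ) + c ≤ v j ↔ (v' i : ℤ) + c ≤ v' j)) ∧
  ∀ i ≤ s, ∀ c : ℤ, c.natAbs ≤ R → 1 ≤ (v i : ℤ) + c → ∀ k ≤ s,
    W ((v i : ℤ) + c - 1).toNat k = W' ((v' i : ℤ) + c - 1).toNat k

/-- The factor 2 comes from instantiation: putting a term for the designated variable adds the
offsets of both terms. -/
theorem termsFA_bounded {preds c : List FAtom} {s : ℕ} (hp : ∀ a ∈ preds, a.Bounded s)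
    (hc : ∀ a ∈ c, a.Bounded s) {t : FI} (ht : t ∈ termsFA preds c) :
    t.1 ≤ s ∧ t.2.natAbs ≤ 2 * s := by
  have hh : ∀ t ∈ (c.filter fun a => a.1).flatMap (fun a : FAtom => a.2.2.2.2),
      t.1 ≤ s ∧ t.2.natAbs ≤ s := by
    intro t ht
    obtain ⟨a, ha, hta⟩ := List.mem_flatMap.1 ht
    exact (hc a (List.mem_filter.1 ha).1).2.2 t hta
  simp only [termsFA] at ht
  rcases List.mem_append.1 ht with ht | ht
  · have := hh t ht
    omega
  · obtain ⟨u, hu, htu⟩ := List.mem_flatMap.1 ht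
    obtain ⟨a, ha, hua⟩ := List.mem_flatMap.1 hu
    have hub := (hp a ha).2.2 u hua
    split_ifs at htu with h1
    · obtain ⟨τ, hτ, rfl⟩ := List.mem_map.1 htu
      have := hh τ hτ
      simp only [instFI, if_pos h1]
      omega
    · obtain rfl := List.mem_singleton.1 htu
      omega

/-- The pair `(v, W)` enters the constraints only through the question which terms lie within the
word, and through the bits there. The former compares a slot plus a bounded offset with 1 or with a
parameter; slot 0 plays the role of zero. `Sim` controls both. -/
theorem constraints_congr {preds c : List FAtom} {ps : List ℕ} {s : ℕ}
    (hp : ∀ a ∈ preds, a.Bounded s) (hlen : preds.length ≤ s) (hps : ∀ p ∈ ps, p ≤ s)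
    (hc : ∀ a ∈ c, a.Bounded s) {v v' : ℕ → ℕ} {W W' : ℕ → ℕ → Bool}
    (hv : v 0 = 0) (hv' : v' 0 = 0) (h : Sim s (4 * s + 1) v W v' W') :
    constraints preds ps v W c = constraints preds ps v' W' c := by
  unfold constraints
  congr 1
  refine List.flatMap_congr fun τ hτ => ?_
  obtain ⟨h₁, h₂⟩ := termsFA_bounded hp hc hτ
  have e₁ : decide (1 ≤ fiEval (intVal v) τ) = decide (1 ≤ fiEval (intVal v') τ) := by
    have := h.1 0 (by omega) τ.1 h₁ (1 - τ.2) (by omega)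
    rw [hv, hv'] at this
    simp only [fiEval, intVal]
    refine decide_eq_decide.2 ?_
    omega
  have e₂ : decide (fiEval (intVal v) τ ≤ maxVal ps v) =
      decide (fiEval (intVal v') τ ≤ maxVal ps v') := by
    refine decide_eq_decide.2 ?_
    rw [le_maxVal_iff, le_maxVal_iff]
    have h0 := h.1 τ.1 h₁ 0 (by omega) τ.2 (by omega)
    rw [hv, hv'] at h0
    refine or_congr h0 (exists_congr fun p => and_congr_right fun hp => ?_)
    exact h.1 τ.1 h₁ p (hps p hp) τ.2 (by omega)
  rw [← e₁, ← e₂]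
  split_ifs with hcond
  · refine List.map_congr_left fun k hk => ?_
    rw [Bool.and_eq_true, decide_eq_true_eq] at hcond
    have := h.2 τ.1 h₁ τ.2 (by omega) hcond.1 k (by have := List.mem_range.1 hk; omega)
    simp only [fiEval, intVal, this]
  · rfl

theorem matB_congr {D : List (List FAtom)} {preds : List FAtom} {ps : List ℕ} {s : ℕ}
    (hp : ∀ a ∈ preds, a.Bounded s) (hlen : preds.length ≤ s) (hps : ∀ p ∈ ps, p ≤ s)
    (hD : ∀ c ∈ D, ∀ a ∈ c, a.Bounded s) {v v' : ℕ → ℕ} {W W' : ℕ → ℕ → Bool}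
    (hv : v 0 = 0) (hv' : v' 0 = 0) (h : Sim s (4 * s + 1) v W v' W') :
    matB D preds ps v W = matB D preds ps v' W' := by
  have key : ∀ c ∈ D, (((c.all fun a => a.1 || faEval (intVal v) (fun _ _ => 0) a) &&
      satB (constraints preds ps v W c)) = true ↔
      ((c.all fun a => a.1 || faEval (intVal v') (fun _ _ => 0) a) &&
      satB (constraints preds ps v' W' c)) = true) := by
    intro c hc
    rw [constraints_congr hp hlen hps (hD c hc) hv hv' h, Bool.and_eq_true, Bool.and_eq_true]
    refine and_congr_left fun _ => ?_
    rw [List.all_eq_true, List.all_eq_true]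
    refine forall₂_congr fun a ha => ?_
    obtain ⟨⟨-, h₁, h₂, h₃⟩, ⟨-, h₄, h₅, h₆⟩, -⟩ := hD c hc a ha
    rcases hb : a.1 with _ | _
    · have e₁ := h.1 _ h₁ _ h₄ (a.2.2.1.2.1.2 + a.2.2.1.2.2 - a.2.2.2.1.2.1.2 - a.2.2.2.1.2.2)
        (by omega)
      have e₂ := h.1 _ h₄ _ h₁ (a.2.2.2.1.2.1.2 + a.2.2.2.1.2.2 - a.2.2.1.2.1.2 - a.2.2.1.2.2)
        (by omega)
      simp only [Bool.false_or, faEval, hb, fdEval, fiEval, intVal]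
      rw [cmpB_congr]
      · simp only [Bool.false_eq_true, if_false]
        omega
      · simp only [Bool.false_eq_true, if_false]
        omega
    · simp
  unfold matB
  rw [Bool.eq_iff_iff, List.any_eq_true, List.any_eq_true]
  exact exists_congr fun c => and_congr_right fun hc => key c hc

/-! ### Cutting and gluing -/

/-- Values below the cut `p` belong to the left piece, and then `v₂ i` is ignored. For the others
the left piece only records that they are not below the cut. -/
def glue (v : ℕ → ℕ) (p : ℕ) (v₂ : ℕ → ℕ) (i : ℕ) : ℕ := if v i < p then v i else p + v₂ i

def glueW (W : ℕ → ℕ → Bool) (p : ℕ) (W₂ : ℕ → ℕ → Bool) (i : ℕ) : ℕ → Bool :=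
  if i < p then W i else W₂ (i - p)

/-- The pieces of objects up to a cut fall into at most `N` classes with respect to the effect of
gluing on `X`. -/
def HasIndex (X : (ℕ → ℕ) → (ℕ → ℕ → Bool) → Prop) (N : ℕ) : Prop :=
  ∃ (C : Type) (_ : Fintype C), Fintype.card C ≤ N ∧
    ∃ c : (ℕ → ℕ) → (ℕ → ℕ → Bool) → ℕ → C, ∀ v W p v' W' p', v 0 = 0 → v' 0 = 0 →
      c v W p = c v' W' p' → ∀ v₂ W₂, v₂ 0 = 0 →
        (X (glue v p v₂) (glueW W p W₂) ↔ X (glue v' p' v₂) (glueW W' p' W₂))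

theorem HasIndex.not {X : (ℕ → ℕ) → (ℕ → ℕ → Bool) → Prop} {N : ℕ} (h : HasIndex X N) :
    HasIndex (fun v W => ¬ X v W) N := by
  obtain ⟨C, i, hC, c, hc⟩ := h
  exact ⟨C, i, hC, c, fun v W p v' W' p' h₁ h₂ h₃ v₂ W₂ h₄ =>
    not_congr (hc v W p v' W' p' h₁ h₂ h₃ v₂ W₂ h₄)⟩

theorem HasIndex.congr {X Y : (ℕ → ℕ) → (ℕ → ℕ → Bool) → Prop} {N : ℕ} (h : HasIndex X N)
    (hXY : ∀ v W, X v W ↔ Y v W) : HasIndex Y N := by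
  have : X = Y := by
    funext v W
    exact propext (hXY v W)
  rwa [← this]

/-- The colours of pieces of objects that determine local similarity after gluing. -/
abbrev SimColor (s R : ℕ) : Type :=
  (Fin (s + 1) → Fin (R + 2)) × (Fin (s + 1) × Fin (s + 1) × Fin (2 * R + 1) → Bool) ×
    (Fin (s + 1) × Fin (2 * R + 1) × Fin (s + 1) → Bool) × (Fin (R + 1) × Fin (s + 1) → Bool)

/-- The components are: the distance of each value to the cut, capped at `R + 1` and zero from the
cut on; all comparisons with bounded offset; the bits within distance `R` of the values; and the
last `R + 1` letters before the cut, which values slightly to the right of it can see. -/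
def simColor (s R : ℕ) (v : ℕ → ℕ) (W : ℕ → ℕ → Bool) (p : ℕ) : SimColor s R :=
  (fun i => ⟨min (p - v i) (R + 1), by omega⟩,
    fun x => decide ((v x.1 : ℤ) + ((x.2.2 : ℕ) - R : ℤ) ≤ v x.2.1),
    fun x => W ((v x.1 : ℤ) + ((x.2.1 : ℕ) - R : ℤ) - 1).toNat x.2.2,
    fun x => W (p - 1 - x.1) x.2)

/-- The number of colours. -/
def simIndex (s R : ℕ) : ℕ :=
  (R + 2) ^ (s + 1) * (2 ^ ((s + 1) * ((s + 1) * (2 * R + 1))) *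
    (2 ^ ((s + 1) * ((2 * R + 1) * (s + 1))) * 2 ^ ((R + 1) * (s + 1))))

theorem card_simColor (s R : ℕ) : Fintype.card (SimColor s R) = simIndex s R := by
  simp [simIndex]

/-- Two values on the same side of the cut compare as in their piece. If they lie on different
sides, an offset of size at most `R` matters only when the left value is within `R` of the cut, and
the capped distance then determines it exactly. -/
theorem sim_glue {s R : ℕ} {v v' : ℕ → ℕ} {W W' : ℕ → ℕ → Bool} {p p' : ℕ} (hv : v 0 = 0)
    (hv' : v' 0 = 0) (h : simColor s R v W p = simColor s R v' W' p') {v₂ : ℕ → ℕ}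
    (W₂ : ℕ → ℕ → Bool) :
    Sim s R (glue v p v₂) (glueW W p W₂) (glue v' p' v₂) (glueW W' p' W₂) := by
  simp only [simColor, Prod.mk.injEq] at h
  obtain ⟨h₁, h₂, h₃, h₄⟩ := h
  have h₁ : ∀ i ≤ s, min (p - v i) (R + 1) = min (p' - v' i) (R + 1) := fun i hi =>
    congrArg Fin.val (congrFun h₁ ⟨i, by omega⟩)
  have h₂ : ∀ i ≤ s, ∀ j ≤ s, ∀ c : ℤ, c.natAbs ≤ R →
      ((v i : ℤ) + c ≤ v j ↔ (v' i : ℤ) + c ≤ v' j) := by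
    intro i hi j hj c hc
    have := decide_eq_decide.1
      (congrFun h₂ (⟨i, by omega⟩, ⟨j, by omega⟩, ⟨(c + R).toNat, by omega⟩))
    simp only at this
    rwa [show (((c + R).toNat : ℕ) : ℤ) - R = c by omega] at this
  have h₃ : ∀ i ≤ s, ∀ c : ℤ, c.natAbs ≤ R → ∀ k ≤ s,
      W ((v i : ℤ) + c - 1).toNat k = W' ((v' i : ℤ) + c - 1).toNat k := by
    intro i hi c hc k hk
    have := congrFun h₃ (⟨i, by omega⟩, ⟨(c + R).toNat, by omega⟩, ⟨k, by omega⟩)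
    simp only at this
    rwa [show (((c + R).toNat : ℕ) : ℤ) - R = c by omega] at this
  have h₄ : ∀ r ≤ R, ∀ k ≤ s, W (p - 1 - r) k = W' (p' - 1 - r) k := fun r hr k hk =>
    congrFun h₄ (⟨r, by omega⟩, ⟨k, by omega⟩)
  -- As slot 0 has the value zero, its colour is the length of the left piece, capped at `R + 1`.
  have h0 := h₁ 0 (by omega)
  rw [hv, hv'] at h0
  constructor
  · intro i hi j hj c hc
    have hi' := h₁ i hi
    have hj' := h₁ j hj
    have hij := h₂ i hi j hj c hc
    simp only [glue]
    split_ifs <;> omega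
  · intro i hi c hc hpos k hk
    have hi' := h₁ i hi
    have hW := h₃ i hi c hc k hk
    simp only [glue] at hpos ⊢
    by_cases hvi : v i < p
    · have hvi' : v' i < p' := by omega
      simp only [if_pos hvi, if_pos hvi'] at hpos ⊢
      unfold glueW
      -- The position may leave the left piece; then the value is within `R` of the cut, and its
      -- uncapped distance fixes the position in the right piece.
      by_cases hq : ((v i : ℤ) + c - 1).toNat < p
      · rw [if_pos hq, if_pos (by omega), hW]
      · rw [if_neg hq, if_neg (by omega)]
        congr 1
        omega
    · have hvi' : ¬ v' i < p' := by omega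
      simp only [if_neg hvi, if_neg hvi'] at hpos ⊢
      push_cast at hpos ⊢
      unfold glueW
      -- A position that falls back across the cut hits one of the last letters of the left piece,
      -- which are part of the colour.
      by_cases hq : 0 ≤ (v₂ i : ℤ) + c - 1
      · rw [if_neg (by omega), if_neg (by omega)]
        congr 1
        omega
      · rw [if_pos (by omega), if_pos (by omega)]
        have := h₄ (-(v₂ i : ℤ) - c).toNat (by omega) k hk
        convert this using 2 <;> omega

theorem hasIndex_matB {D : List (List FAtom)} {preds : List FAtom} {ps : List ℕ} {s : ℕ}
    (hp : ∀ a ∈ preds, a.Bounded s) (hlen : preds.length ≤ s) (hps : ∀ p ∈ ps, p ≤ s)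
    (hD : ∀ c ∈ D, ∀ a ∈ c, a.Bounded s) :
    HasIndex (fun v W => matB D preds ps v W = true) (simIndex s (4 * s + 1)) := by
  have hg : ∀ (v v₂ : ℕ → ℕ) (p : ℕ), v 0 = 0 → v₂ 0 = 0 → glue v p v₂ 0 = 0 := by
    intro v v₂ p h₁ h₂
    simp only [glue, h₁, h₂]
    split_ifs <;> omega
  refine ⟨SimColor s (4 * s + 1), inferInstance, (card_simColor _ _).le, simColor s (4 * s + 1),
    fun v W p v' W' p' h₁ h₂ h₃ v₂ W₂ h₄ => ?_⟩
  beta_reduce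
  rw [matB_congr hp hlen hps hD (hg v v₂ p h₁ h₄) (hg v' v₂ p' h₂ h₄) (sim_glue h₁ h₂ h₃ W₂)]

/-! ### Quantifiers -/

/-- A witness left of the cut is stored in the left piece; the value 0 in the right piece is
arbitrary, since gluing ignores it. -/
theorem glue_update_lt {v v₂ : ℕ → ℕ} {p j x : ℕ} (h : x < p) :
    Function.update (glue v p v₂) j x =
      glue (Function.update v j x) p (Function.update v₂ j 0) := by
  funext i
  by_cases hi : i = j
  · subst hi
    simp [glue, h]
  · simp [glue, hi]

/-- For a witness right of the cut the left piece holds the marker `p`, independently of the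
witness. -/
theorem glue_update_ge {v v₂ : ℕ → ℕ} {p j x : ℕ} (h : p ≤ x) :
    Function.update (glue v p v₂) j x =
      glue (Function.update v j p) p (Function.update v₂ j (x - p)) := by
  funext i
  by_cases hi : i = j
  · subst hi
    simp [glue, h]
  · simp [glue, hi]

def stepIndex (N : ℕ) : ℕ := 2 ^ N * N

theorem le_stepIndex (N : ℕ) : N ≤ stepIndex N := Nat.le_mul_of_pos_left _ (by positivity)

/-- The new class of a left piece is the set of old classes reached by witnesses left of the cut,
together with the one old class obtained when the witness lies to the right. This gives at most `2 ^
N * N` classes. -/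
theorem HasIndex.ex {X : (ℕ → ℕ) → (ℕ → ℕ → Bool) → Prop} {N : ℕ} (h : HasIndex X N) {j : ℕ}
    (hj : 0 < j) : HasIndex (fun v W => ∃ x, X (Function.update v j x) W) (stepIndex N) := by
  classical
  obtain ⟨C, i, hC, c, hc⟩ := h
  have hu : ∀ (v : ℕ → ℕ) (x : ℕ), v 0 = 0 → Function.update v j x 0 = 0 := by
    intro v x hv
    rw [Function.update_of_ne (by omega), hv]
  refine ⟨Set C × C, inferInstance, ?_, fun v W p =>
    ({d | ∃ x < p, d = c (Function.update v j x) W p}, c (Function.update v j p) W p), ?_⟩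
  · rw [Fintype.card_prod, Fintype.card_set]
    exact Nat.mul_le_mul (Nat.pow_le_pow_right (by omega) hC) hC
  · suffices H : ∀ v W p v' W' p', v 0 = 0 → v' 0 = 0 →
        {d | ∃ x < p, d = c (Function.update v j x) W p} =
          {d | ∃ x < p', d = c (Function.update v' j x) W' p'} →
        c (Function.update v j p) W p = c (Function.update v' j p') W' p' →
        ∀ v₂ W₂, v₂ 0 = 0 → (∃ x, X (Function.update (glue v p v₂) j x) (glueW W p W₂)) →
          ∃ x, X (Function.update (glue v' p' v₂) j x) (glueW W' p' W₂) by
      intro v W p v' W' p' h₁ h₂ h₃ v₂ W₂ h₄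
      obtain ⟨h₃, h₅⟩ := Prod.mk.inj h₃
      exact ⟨H v W p v' W' p' h₁ h₂ h₃ h₅ v₂ W₂ h₄,
        H v' W' p' v W p h₂ h₁ h₃.symm h₅.symm v₂ W₂ h₄⟩
    rintro v W p v' W' p' h₁ h₂ h₃ h₅ v₂ W₂ h₄ ⟨x, hx⟩
    rcases lt_or_ge x p with hxp | hxp
    · have hmem : c (Function.update v j x) W p ∈
          {d | ∃ x < p', d = c (Function.update v' j x) W' p'} := by
        rw [← h₃]
        exact ⟨x, hxp, rfl⟩
      obtain ⟨x', hx', he⟩ := hmem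
      refine ⟨x', ?_⟩
      rw [glue_update_lt hxp] at hx
      rw [glue_update_lt hx']
      exact (hc _ _ _ _ _ _ (hu _ _ h₁) (hu _ _ h₂) he _ _ (hu _ _ h₄)).1 hx
    · refine ⟨p' + (x - p), ?_⟩
      rw [glue_update_ge hxp] at hx
      rw [glue_update_ge (by omega), Nat.add_sub_cancel_left]
      exact (hc _ _ _ _ _ _ (hu _ _ h₁) (hu _ _ h₂) h₅ _ _ (hu _ _ h₄)).1 hx

theorem HasIndex.all {X : (ℕ → ℕ) → (ℕ → ℕ → Bool) → Prop} {N : ℕ} (h : HasIndex X N) {j : ℕ}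
    (hj : 0 < j) : HasIndex (fun v W => ∀ x, X (Function.update v j x) W) (stepIndex N) :=
  (h.not.ex hj).not.congr fun v W => by simp

theorem hasIndex_evalPre {M : (ℕ → ℕ) → (ℕ → ℕ → Bool) → Prop} {N : ℕ} (h : HasIndex M N) :
    ∀ (pre : List Bool) (j : ℕ), 0 < j →
      HasIndex (fun v W => evalPre (fun v => M v W) pre j v) (stepIndex^[pre.length] N)
  | [], _, _ => h
  | true :: es, j, hj => by
    rw [List.length_cons, Function.iterate_succ_apply']
    exact (hasIndex_evalPre h es (j + 1) (by omega)).ex hj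
  | false :: es, j, hj => by
    rw [List.length_cons, Function.iterate_succ_apply']
    exact (hasIndex_evalPre h es (j + 1) (by omega)).all hj

/-! ### Bounded quantifiers -/

/-- Quantifiers over the slots `j, j + 1, …`, where the `i`-th one ranges over `0, …, U + i N`. -/
def evalPreB (M : (ℕ → ℕ) → Prop) (N : ℕ) : List Bool → ℕ → ℕ → (ℕ → ℕ) → Prop
  | [], _, _, v => M v
  | true :: es, j, U, v => ∃ x ≤ U + N, evalPreB M N es (j + 1) (U + N) (Function.update v j x)
  | false :: es, j, U, v => ∀ x ≤ U + N, evalPreB M N es (j + 1) (U + N) (Function.update v j x)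

/-- From `U` on all bits vanish, and only slot `j` can have a value beyond `U`. If the least witness
exceeded `U + N`, two of the `N + 1` cuts at `U + 1, …, U + 1 + N` would have the same class;
removing the stretch between them would give a smaller witness. -/
theorem HasIndex.pump {X : (ℕ → ℕ) → (ℕ → ℕ → Bool) → Prop} {N : ℕ} (h : HasIndex X N) {j : ℕ}
    (hj : 0 < j) {v : ℕ → ℕ} {W : ℕ → ℕ → Bool} {U : ℕ} (hv0 : v 0 = 0) (hv : ∀ i, v i ≤ U)
    (hW : ∀ i k, U ≤ i → W i k = false) (hex : ∃ x, X (Function.update v j x) W) :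
    ∃ x ≤ U + N, X (Function.update v j x) W := by
  classical
  obtain ⟨C, i, hC, c, hc⟩ := h
  refine ⟨Nat.find hex, ?_, Nat.find_spec hex⟩
  by_contra hlt
  set x := Nat.find hex with hx
  have hcard : Fintype.card C < Fintype.card (Fin (N + 1)) := by
    rw [Fintype.card_fin]
    omega
  -- Beyond `U` the right piece carries no information except the rest of the witness: all its other
  -- slots are zero and its bits are false.
  have hglue : ∀ p y : ℕ, U < p →
      glue (Function.update v j x) p (Function.update 0 j y) =
        Function.update v j (if x < p then x else p + y) := by
    intro p y hp
    funext k
    by_cases hk : k = j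
    · subst hk
      simp [glue]
    · have := hv k
      simp only [glue, Function.update_of_ne hk]
      rw [if_pos (by omega)]
  have hglueW : ∀ p : ℕ, U < p → glueW W p (fun _ _ => false) = W := by
    intro p hp
    funext k l
    unfold glueW
    split_ifs with hk
    · rfl
    · exact (hW _ _ (by omega)).symm
  have hu : ∀ (v : ℕ → ℕ) (x : ℕ), v 0 = 0 → Function.update v j x 0 = 0 := by
    intro v x hv
    rw [Function.update_of_ne (by omega), hv]
  suffices H : ∀ s t : Fin (N + 1), s < t →
      c (Function.update v j x) W (U + 1 + s) = c (Function.update v j x) W (U + 1 + t) → False by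
    obtain ⟨s, t, hst, he⟩ := Fintype.exists_ne_map_eq_of_card_lt
      (fun t : Fin (N + 1) => c (Function.update v j x) W (U + 1 + t)) hcard
    rcases lt_or_gt_of_ne hst with hst | hst
    · exact H s t hst he
    · exact H t s hst he.symm
  intro s t hst he
  have hst' : (s : ℕ) < t := hst
  have ht := t.2
  have := hc _ _ _ _ _ _ (hu v x hv0) (hu v x hv0) he (Function.update 0 j (x - (U + 1 + t)))
    (fun _ _ => false) (hu _ _ rfl)
  rw [hglue _ _ (by omega), hglue _ _ (by omega), hglueW _ (by omega), hglueW _ (by omega),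
    if_neg (by omega), if_neg (by omega),
    show U + 1 + (t : ℕ) + (x - (U + 1 + t)) = x by omega] at this
  exact Nat.find_min hex (m := U + 1 + s + (x - (U + 1 + t))) (by omega)
    (this.2 (Nat.find_spec hex))

theorem iterate_stepIndex_mono {m n N : ℕ} (h : m ≤ n) :
    stepIndex^[m] N ≤ stepIndex^[n] N :=
  monotone_nat_of_le_succ (f := fun n => stepIndex^[n] N) (fun n => by
    rw [Function.iterate_succ_apply']
    exact le_stepIndex _) h

theorem HasIndex.mono {X : (ℕ → ℕ) → (ℕ → ℕ → Bool) → Prop} {N N' : ℕ} (h : HasIndex X N)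
    (hN : N ≤ N') : HasIndex X N' := by
  obtain ⟨C, i, hC, c, hc⟩ := h
  exact ⟨C, i, hC.trans hN, c, hc⟩

/-- `N` bounds the index of every tail of the prefix, so `HasIndex.pump` applies at each quantifier,
and a bounded witness raises the bound on the values by `N`. Universal quantifiers are treated
through a counterexample, since complements have the same index. -/
theorem evalPre_iff_evalPreB {M : (ℕ → ℕ) → (ℕ → ℕ → Bool) → Prop} {N₀ N : ℕ}
    (h : HasIndex M N₀) {W : ℕ → ℕ → Bool} :
    ∀ (pre : List Bool) (j U : ℕ) (v : ℕ → ℕ), 0 < j → stepIndex^[pre.length] N₀ ≤ N →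
      v 0 = 0 → (∀ i, v i ≤ U) → (∀ i k, U ≤ i → W i k = false) →
      (evalPre (fun v => M v W) pre j v ↔ evalPreB (fun v => M v W) N pre j U v)
  | [], _, _, _, _, _, _, _, _ => Iff.rfl
  | e :: es, j, U, v, hj, hN, hv0, hv, hW => by
    have hN' : stepIndex^[es.length] N₀ ≤ N :=
      (iterate_stepIndex_mono (by simp)).trans hN
    have hX := (hasIndex_evalPre h es (j + 1) (by omega)).mono hN'
    have hu : ∀ x ≤ U + N, ∀ i, Function.update v j x i ≤ U + N := by
      intro x hx i
      by_cases hi : i = j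
      · subst hi
        simpa using hx
      · rw [Function.update_of_ne hi]
        exact (hv i).trans (by omega)
    have ih : ∀ x ≤ U + N, (evalPre (fun v => M v W) es (j + 1) (Function.update v j x) ↔
        evalPreB (fun v => M v W) N es (j + 1) (U + N) (Function.update v j x)) := fun x hx =>
      evalPre_iff_evalPreB h es (j + 1) (U + N) _ (by omega) hN'
        (by rw [Function.update_of_ne (by omega), hv0]) (hu x hx)
        (fun i k hi => hW i k (by omega))
    cases e with
    | true =>
      simp only [evalPre, evalPreB]
      constructor
      · intro hex
        obtain ⟨x, hx, hxX⟩ := hX.pump hj hv0 hv hW hex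
        exact ⟨x, hx, (ih x hx).1 hxX⟩
      · rintro ⟨x, hx, hxX⟩
        exact ⟨x, (ih x hx).2 hxX⟩
    | false =>
      simp only [evalPre, evalPreB]
      constructor
      · exact fun hall x hx => (ih x hx).1 (hall x)
      · intro hall
        by_contra hcon
        push Not at hcon
        obtain ⟨x, hx, hxX⟩ := hX.not.pump hj hv0 hv hW hcon
        exact hxX ((ih x hx).2 (hall x hx))

end Flat


/-! ## Words over bitvectors -/

namespace Flat

/-! ### Counting -/

/-- The number of `i < n` with `b i`. -/
def cnt (b : ℕ → Bool) (n : ℕ) : ℕ := ((List.range n).filter b).length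

theorem cnt_le (b : ℕ → Bool) (n : ℕ) : cnt b n ≤ n :=
  (List.length_filter_le _ _).trans (by simp)

theorem cnt_add (b : ℕ → Bool) (m n : ℕ) : cnt b (m + n) = cnt b m + cnt (fun i => b (m + i)) n := by
  simp only [cnt, List.range_add, List.filter_append, List.length_append, List.filter_map,
    List.length_map]
  rfl

theorem cnt_congr {b b' : ℕ → Bool} {n : ℕ} (h : ∀ i < n, b i = b' i) : cnt b n = cnt b' n := by
  unfold cnt
  rw [List.filter_congr fun i hi => h i (List.mem_range.1 hi)]

theorem cnt_lt (V n : ℕ) : cnt (fun i => decide (i < V)) n = min V n := by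
  induction n with
  | zero => simp [cnt]
  | succ n ih =>
    rw [cnt_add, ih]
    by_cases h : n < V
    · simp [cnt, h]
      omega
    · simp [cnt, h]
      omega

/-- The first `n` values of `b` are a unary number. -/
def IsUnary (b : ℕ → Bool) (n : ℕ) : Prop := ∀ i < n, b i = decide (i < cnt b n)

theorem isUnary_of {b : ℕ → Bool} {n V : ℕ} (h : ∀ i < n, b i = decide (i < V)) :
    IsUnary b n ∧ cnt b n = min V n := by
  have hc : cnt b n = min V n := (cnt_congr h).trans (cnt_lt V n)
  refine ⟨fun i hi => ?_, hc⟩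
  rw [h i hi, hc]
  exact decide_eq_decide.2 (by omega)

theorem isUnary_add (b : ℕ → Bool) (m n : ℕ) : IsUnary b (m + n) ↔
    IsUnary b m ∧ IsUnary (fun i => b (m + i)) n ∧
      (cnt b m < m → cnt (fun i => b (m + i)) n = 0) := by
  have hadd := cnt_add b m n
  constructor
  · intro h
    have h₁ := isUnary_of (n := m) fun i hi => h i (by omega)
    have h₂ := isUnary_of (b := fun i => b (m + i)) (n := n) (V := cnt b (m + n) - m)
      fun i hi => (h (m + i) (by omega)).trans (decide_eq_decide.2 (by omega))
    refine ⟨h₁.1, h₂.1, fun hlt => ?_⟩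
    have := h₁.2
    omega
  · rintro ⟨h₁, h₂, h₃⟩ i hi
    have := cnt_le b m
    by_cases hm : i < m
    · rw [h₁ i hm]
      exact decide_eq_decide.2 (by omega)
    · obtain ⟨k, rfl⟩ := Nat.exists_eq_add_of_le (not_lt.1 hm)
      exact (h₂ k (by omega)).trans (decide_eq_decide.2 (by omega))

/-! ### Layouts -/

/-- The columns of a word: `(true, j)` is the value of the slot `j` in unary, and `(false, k)` the
`k`-th predicate. -/
abbrev Layout : Type := List (Bool × ℕ)

def numSlots (l : Layout) : List ℕ := (l.filter fun x => x.1).map fun x => x.2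

theorem mem_numSlots {l : Layout} {j : ℕ} : j ∈ numSlots l ↔ (true, j) ∈ l := by
  simp [numSlots]

def letterOf (l : Layout) (v : ℕ → ℕ) (W : ℕ → ℕ → Bool) (i : ℕ) : List Bool :=
  l.map fun x => if x.1 = true then decide (i < v x.2) else W i x.2

/-- The word that represents `(v, W)`. -/
def wordOf (l : Layout) (v : ℕ → ℕ) (W : ℕ → ℕ → Bool) : List (List Bool) :=
  (List.range (maxVal (numSlots l) v)).map (letterOf l v W)

/-- The bit in the column `x` at the position `i`. -/
def colBit (l : Layout) (u : List (List Bool)) (x : Bool × ℕ) (i : ℕ) : Bool :=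
  (u.getD i []).getD (l.idxOf x) false

/-- Counting ones defines a value for every word, including words that represent nothing, and makes
decoding additive under concatenation. -/
def decV (l : Layout) (u : List (List Bool)) (j : ℕ) : ℕ := cnt (colBit l u (true, j)) u.length

def decW (l : Layout) (u : List (List Bool)) (i k : ℕ) : Bool := colBit l u (false, k) i

theorem getD_map_idxOf {l : Layout} {x : Bool × ℕ} (hx : x ∈ l) (h : Bool × ℕ → Bool) :
    (l.map h).getD (l.idxOf x) false = h x := by
  rw [List.getD_eq_getElem?_getD, List.getElem?_map,
    List.getElem?_eq_getElem (List.idxOf_lt_length_of_mem hx), List.getElem_idxOf]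
  rfl

theorem getD_map_range {α : Type} (f : ℕ → α) (n i : ℕ) (d : α) :
    ((List.range n).map f).getD i d = if i < n then f i else d := by
  split_ifs with h <;> simp [List.getD_eq_getElem?_getD, h]

theorem le_maxVal {ps : List ℕ} {v : ℕ → ℕ} {p : ℕ} (hp : p ∈ ps) : v p ≤ maxVal ps v := by
  have := (le_maxVal_iff (ps := ps) (v := v) (x := v p)).2 (Or.inr ⟨p, hp, le_rfl⟩)
  exact_mod_cast this

theorem maxVal_le {ps : List ℕ} {v : ℕ → ℕ} {n : ℕ} (h : ∀ p ∈ ps, v p ≤ n) : maxVal ps v ≤ n := by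
  rcases (le_maxVal_iff (ps := ps) (v := v) (x := maxVal ps v)).1 le_rfl with h' | ⟨p, hp, h'⟩
  · omega
  · have := h p hp
    omega

theorem lt_maxVal_iff {ps : List ℕ} {v : ℕ → ℕ} {n : ℕ} : n < maxVal ps v ↔ ∃ p ∈ ps, n < v p := by
  have := le_maxVal_iff (ps := ps) (v := v) (x := n + 1)
  rw [show ((n : ℤ) + 1 ≤ maxVal ps v) ↔ n < maxVal ps v by omega] at this
  rw [this]
  constructor
  · rintro (h | ⟨p, hp, h⟩)
    · omega
    · exact ⟨p, hp, by omega⟩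
  · rintro ⟨p, hp, h⟩
    exact Or.inr ⟨p, hp, by omega⟩

theorem decV_wordOf {l : Layout} {v : ℕ → ℕ} (W : ℕ → ℕ → Bool)
    (hv : ∀ j, j ∉ numSlots l → v j = 0) : decV l (wordOf l v W) = v := by
  funext j
  have hlen : (wordOf l v W).length = maxVal (numSlots l) v := by simp [wordOf]
  by_cases hj : j ∈ numSlots l
  · have hle := le_maxVal (v := v) hj
    have h : ∀ i < maxVal (numSlots l) v, colBit l (wordOf l v W) (true, j) i = decide (i < v j) := by
      intro i hi
      rw [colBit, wordOf, getD_map_range, if_pos hi, letterOf, getD_map_idxOf (mem_numSlots.1 hj)]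
      rfl
    rw [decV, hlen, (isUnary_of h).2]
    omega
  · have h : ∀ i < maxVal (numSlots l) v, colBit l (wordOf l v W) (true, j) i = decide (i < 0) := by
      intro i hi
      rw [colBit, wordOf, getD_map_range, if_pos hi, List.idxOf_eq_length
        (fun h => hj (mem_numSlots.2 h)), List.getD_eq_getElem?_getD,
        List.getElem?_eq_none (by simp [letterOf])]
      rfl
    rw [decV, hlen, (isUnary_of h).2, hv j hj]
    omega

theorem decW_wordOf {l : Layout} {v : ℕ → ℕ} {W : ℕ → ℕ → Bool}
    (hW : ∀ i k, W i k = true → i < maxVal (numSlots l) v ∧ (false, k) ∈ l) :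
    decW l (wordOf l v W) = W := by
  funext i k
  rw [decW, colBit, wordOf, getD_map_range]
  by_cases hk : (false, k) ∈ l
  · split_ifs with hi
    · rw [letterOf, getD_map_idxOf hk]
      rfl
    · by_contra hne
      have : W i k = true := by
        cases h : W i k
        · exact absurd h.symm hne
        · rfl
      exact hi (hW i k this).1
  · have hWf : W i k = false := by
      by_contra hne
      exact hk (hW i k (by simpa using hne)).2
    rw [hWf, List.idxOf_eq_length hk, List.getD_eq_getElem?_getD, List.getElem?_eq_none]
    · rfl
    · split_ifs <;> simp [letterOf]

/-! ### Prefixes of representations -/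

/-- Every letter of `u` has the bits that are prescribed by the values read off from `u`. -/
def Coherent (l : Layout) (u : List (List Bool)) : Prop :=
  ∀ i < u.length, u.getD i [] = letterOf l (decV l u) (decW l u) i

/-- A coherent word can fail to be a representation only by having letters beyond the largest value.
-/
theorem wordOf_dec_iff {l : Layout} {u : List (List Bool)} :
    wordOf l (decV l u) (decW l u) = u ↔
      Coherent l u ∧ maxVal (numSlots l) (decV l u) = u.length := by
  constructor
  · intro h
    have hlen : maxVal (numSlots l) (decV l u) = u.length := by
      conv_rhs => rw [← h]
      simp [wordOf]
    refine ⟨fun i hi => ?_, hlen⟩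
    conv_lhs => rw [← h]
    rw [wordOf, getD_map_range, if_pos (by omega)]
  · rintro ⟨h, hlen⟩
    refine List.ext_getElem (by simp [wordOf, hlen]) fun i h₁ h₂ => ?_
    have := h i h₂
    rw [List.getD_eq_getElem _ _ h₂] at this
    rw [this]
    simp [wordOf]

/-- `colBit` looks at the first column for a slot. If a slot occurs in several columns, as the
parameters do in words for pairs of states, the first condition forces the copies to agree. -/
theorem coherent_iff {l : Layout} {u : List (List Bool)} : Coherent l u ↔
    (∀ i < u.length, u.getD i [] = l.map fun x => colBit l u x i) ∧
      ∀ j ∈ numSlots l, IsUnary (colBit l u (true, j)) u.length := by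
  constructor
  · intro h
    have key : ∀ x ∈ l, ∀ i < u.length, colBit l u x i =
        if x.1 = true then decide (i < decV l u x.2) else decW l u i x.2 := by
      intro x hx i hi
      rw [colBit, h i hi, letterOf, getD_map_idxOf hx]
    refine ⟨fun i hi => ?_, fun j hj i hi => ?_⟩
    · rw [h i hi, letterOf]
      exact List.map_congr_left fun x hx => (key x hx i hi).symm
    · exact key (true, j) (mem_numSlots.1 hj) i hi
  · rintro ⟨h₁, h₂⟩ i hi
    rw [h₁ i hi, letterOf]
    refine List.map_congr_left fun x hx => ?_
    obtain ⟨_ | _, k⟩ := x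
    · rfl
    · exact h₂ k (mem_numSlots.2 hx) i hi

section Append

variable {l : Layout} {u z : List (List Bool)}

theorem colBit_append_left {x : Bool × ℕ} {i : ℕ} (hi : i < u.length) :
    colBit l (u ++ z) x i = colBit l u x i := by
  simp only [colBit]
  rw [List.getD_append _ _ _ _ hi]

theorem colBit_append_right {x : Bool × ℕ} (i : ℕ) :
    colBit l (u ++ z) x (u.length + i) = colBit l z x i := by
  simp only [colBit]
  rw [List.getD_append_right _ _ _ _ (by omega), Nat.add_sub_cancel_left]

theorem decV_append (j : ℕ) : decV l (u ++ z) j = decV l u j + decV l z j := by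
  rw [decV, List.length_append, cnt_add]
  congr 1
  · exact cnt_congr fun i hi => colBit_append_left hi
  · exact cnt_congr fun i _ => colBit_append_right i

theorem decW_append : decW l (u ++ z) = glueW (decW l u) u.length (decW l z) := by
  funext i k
  unfold glueW
  split_ifs with hi
  · exact colBit_append_left hi
  · obtain ⟨m, rfl⟩ := Nat.exists_eq_add_of_le (not_lt.1 hi)
    rw [Nat.add_sub_cancel_left]
    exact colBit_append_right m

theorem decV_le (j : ℕ) : decV l u j ≤ u.length := cnt_le _ _

theorem decV_eq_zero {j : ℕ} (hj : j ∉ numSlots l) (hu : Coherent l u) : decV l u j = 0 := by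
  have h : ∀ i < u.length, colBit l u (true, j) i = decide (i < 0) := by
    intro i hi
    rw [colBit, hu i hi, List.idxOf_eq_length (fun h => hj (mem_numSlots.2 h)),
      List.getD_eq_getElem?_getD, List.getElem?_eq_none (by simp [letterOf])]
    rfl
  rw [decV, (isUnary_of h).2]
  omega

/-- Across a cut the pieces interact only through the set of unary numbers that have already ended:
these must not continue. -/
theorem coherent_append : Coherent l (u ++ z) ↔ Coherent l u ∧ Coherent l z ∧
    ∀ j ∈ numSlots l, decV l u j < u.length → decV l z j = 0 := by
  have h₁ : (∀ i < (u ++ z).length, (u ++ z).getD i [] = l.map fun x => colBit l (u ++ z) x i) ↔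
      (∀ i < u.length, u.getD i [] = l.map fun x => colBit l u x i) ∧
      ∀ i < z.length, z.getD i [] = l.map fun x => colBit l z x i := by
    constructor
    · intro h
      constructor
      · intro i hi
        have := h i (by simp; omega)
        simpa only [List.getD_append _ _ _ _ hi, colBit_append_left hi] using this
      · intro i hi
        have := h (u.length + i) (by simp; omega)
        simpa only [List.getD_append_right u z [] (u.length + i) (by omega),
          Nat.add_sub_cancel_left, colBit_append_right] using this
    · rintro ⟨h, h'⟩ i hi
      by_cases hiu : i < u.length
      · simpa only [List.getD_append _ _ _ _ hiu, colBit_append_left hiu] using h i hiu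
      · obtain ⟨m, rfl⟩ := Nat.exists_eq_add_of_le (not_lt.1 hiu)
        simpa only [List.getD_append_right u z [] (u.length + m) (by omega),
          Nat.add_sub_cancel_left, colBit_append_right] using
          h' m (by rw [List.length_append] at hi; omega)
  have h₂ : ∀ j, IsUnary (colBit l (u ++ z) (true, j)) (u ++ z).length ↔
      IsUnary (colBit l u (true, j)) u.length ∧ IsUnary (colBit l z (true, j)) z.length ∧
        (decV l u j < u.length → decV l z j = 0) := by
    intro j
    have e₁ : cnt (colBit l (u ++ z) (true, j)) u.length = decV l u j :=
      cnt_congr fun i hi => colBit_append_left hi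
    have e₂ : (fun i => colBit l (u ++ z) (true, j) (u.length + i)) = colBit l z (true, j) :=
      funext fun i => colBit_append_right i
    have e₃ : IsUnary (colBit l (u ++ z) (true, j)) u.length ↔
        IsUnary (colBit l u (true, j)) u.length := by
      unfold IsUnary
      rw [e₁]
      exact forall₂_congr fun i hi => by rw [colBit_append_left hi]; rfl
    rw [List.length_append, isUnary_add, e₁, e₂, e₃]
    rfl
  rw [coherent_iff, coherent_iff, coherent_iff, h₁]
  simp only [h₂]
  constructor
  · rintro ⟨⟨a, b⟩, c⟩
    exact ⟨⟨a, fun j hj => (c j hj).1⟩, ⟨b, fun j hj => (c j hj).2.1⟩, fun j hj => (c j hj).2.2⟩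
  · rintro ⟨⟨a, c⟩, ⟨b, d⟩, e⟩
    exact ⟨⟨a, b⟩, fun j hj => ⟨c j hj, d j hj, e j hj⟩⟩

/-- The bridge between words and gluing: a number that has ended within `u` gets nothing from `z`,
and one that has not ended equals the length of `u`. -/
theorem decV_append_eq_glue (h : Coherent l (u ++ z)) :
    decV l (u ++ z) = glue (decV l u) u.length (decV l z) := by
  obtain ⟨hu, hz, h⟩ := coherent_append.1 h
  funext j
  rw [decV_append, glue]
  by_cases hj : j ∈ numSlots l
  · have := h j hj
    have := decV_le (l := l) (u := u) j
    split_ifs <;> omega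
  · rw [decV_eq_zero hj hu, decV_eq_zero hj hz]
    split_ifs <;> omega

end Append

/-! ### The language of a predicate on representations -/

/-- The bits of the predicates vanish from the greatest value of the slots `ps` on. -/
def Supported (ps : List ℕ) (v : ℕ → ℕ) (W : ℕ → ℕ → Bool) : Prop :=
  ∀ i k, W i k = true → i < maxVal ps v

/-- The words that represent some `(v, W)` with property `X`. -/
def wordLang (l : Layout) (ps : List ℕ) (X : (ℕ → ℕ) → (ℕ → ℕ → Bool) → Prop) :
    Set (List (List Bool)) :=
  {u | wordOf l (decV l u) (decW l u) = u ∧ Supported ps (decV l u) (decW l u) ∧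
    X (decV l u) (decW l u)}

/-- `L` has at most `N` left quotients. -/
def NerodeIndex (L : Set (List (List Bool))) (N : ℕ) : Prop :=
  ∃ (C : Type) (_ : Fintype C), Fintype.card C ≤ N ∧ ∃ c : List (List Bool) → C,
    ∀ u u', c u = c u' → ∀ z, u ++ z ∈ L ↔ u' ++ z ∈ L

/-- A prefix is characterized by three flags (coherence, emptiness, and whether its bits are
supported by parameters), by the columns whose unary number has ended, and by its class with respect
to `X`. This explains the factors `8`, `2 ^ l.length` and `N`. -/
theorem nerodeIndex_wordLang {l : Layout} {ps : List ℕ}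
    {X : (ℕ → ℕ) → (ℕ → ℕ → Bool) → Prop} {N : ℕ} (hX : HasIndex X N) (h0 : 0 ∉ numSlots l)
    (hps : ∀ p ∈ ps, p ∈ numSlots l) : NerodeIndex (wordLang l ps X) (8 * 2 ^ l.length * N) := by
  classical
  obtain ⟨C, inst, hC, c, hc⟩ := hX
  refine ⟨(Bool × Bool × Bool) × (Fin l.length → Bool) × C, inferInstance, ?_, fun u =>
    ((decide (Coherent l u), decide (u.length = 0),
      decide (∀ i k, decW l u i k = true → ∃ p ∈ ps, i < decV l u p ∨ u.length ≤ decV l u p)),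
      fun i => decide (decV l u (l[i]).2 < u.length), c (decV l u) (decW l u) u.length), ?_⟩
  · simp only [Fintype.card_prod, Fintype.card_bool, Fintype.card_fun, Fintype.card_fin]
    calc _ = 8 * 2 ^ l.length * Fintype.card C := by ring
      _ ≤ _ := Nat.mul_le_mul_left _ hC
  suffices H : ∀ u u', Coherent l u → Coherent l u' → (u.length = 0 ↔ u'.length = 0) →
      ((∀ i k, decW l u i k = true → ∃ p ∈ ps, i < decV l u p ∨ u.length ≤ decV l u p) ↔
        ∀ i k, decW l u' i k = true → ∃ p ∈ ps, i < decV l u' p ∨ u'.length ≤ decV l u' p) →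
      (∀ j ∈ numSlots l, decV l u j < u.length ↔ decV l u' j < u'.length) →
      c (decV l u) (decW l u) u.length = c (decV l u') (decW l u') u'.length →
      ∀ z, u ++ z ∈ wordLang l ps X → u' ++ z ∈ wordLang l ps X by
    intro u u' he z
    simp only [Prod.mk.injEq, decide_eq_decide] at he
    obtain ⟨⟨h₁, h₂, h₃⟩, h₄, h₅⟩ := he
    have h₄ : ∀ j ∈ numSlots l, decV l u j < u.length ↔ decV l u' j < u'.length := by
      intro j hj
      obtain ⟨i, hi, hij⟩ := List.getElem_of_mem (mem_numSlots.1 hj)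
      have := decide_eq_decide.1 (congrFun h₄ ⟨i, hi⟩)
      simpa only [Fin.getElem_fin, hij] using this
    by_cases hu : Coherent l u
    · have hu' := h₁.1 hu
      exact ⟨H u u' hu hu' h₂ h₃ h₄ h₅ z, H u' u hu' hu h₂.symm h₃.symm
        (fun j hj => (h₄ j hj).symm) h₅.symm z⟩
    · have hu' := fun h => hu (h₁.2 h)
      constructor
      · exact fun h => absurd (coherent_append.1 (wordOf_dec_iff.1 h.1).1).1 hu
      · exact fun h => absurd (coherent_append.1 (wordOf_dec_iff.1 h.1).1).1 hu'
  rintro u u' hu hu' h₂ h₃ h₄ h₅ z ⟨hw, hs, hx⟩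
  obtain ⟨hco, hlen⟩ := wordOf_dec_iff.1 hw
  obtain ⟨-, hz, hbd⟩ := coherent_append.1 hco
  have hco' : Coherent l (u' ++ z) :=
    coherent_append.2 ⟨hu', hz, fun j hj hlt => hbd j hj ((h₄ j hj).2 hlt)⟩
  have hV := decV_append_eq_glue hco
  have hV' := decV_append_eq_glue hco'
  refine ⟨wordOf_dec_iff.2 ⟨hco', ?_⟩, ?_, ?_⟩
  · refine le_antisymm (maxVal_le fun j _ => decV_le j) ?_
    rcases Nat.eq_zero_or_pos (u' ++ z).length with h | h
    · omega
    -- Some slot attains the full length, so it has not ended in `u` and fills `z`; the same slot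
    -- has not ended in `u'`. The emptiness flag ensures that `u ++ z` is nonempty too.
    · have hpos : (u ++ z).length - 1 < maxVal (numSlots l) (decV l (u ++ z)) := by
        rw [hlen]
        rw [List.length_append] at h ⊢
        omega
      obtain ⟨j, hj, hlt⟩ := lt_maxVal_iff.1 hpos
      refine le_trans ?_ (le_maxVal hj)
      have h₆ := h₄ j hj
      have h₇ := decV_le (l := l) (u := u) j
      have h₈ := decV_le (l := l) (u := z) j
      have h₉ := decV_le (l := l) (u := u') j
      rw [decV_append] at hlt ⊢
      rw [List.length_append] at hlt h ⊢
      omega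
  · intro i k hik
    rw [lt_maxVal_iff]
    have hs' : ∀ i k, decW l (u ++ z) i k = true → ∃ p ∈ ps, i < decV l (u ++ z) p :=
      fun i k h => lt_maxVal_iff.1 (hs i k h)
    rw [decW_append] at hik hs'
    rw [hV] at hs'
    rw [hV']
    unfold glueW at hik hs'
    unfold glue at hs' ⊢
    by_cases hi : i < u'.length
    · rw [if_pos hi] at hik
      have hl : ∀ i k, decW l u i k = true →
          ∃ p ∈ ps, i < decV l u p ∨ u.length ≤ decV l u p := by
        intro m k' hmk
        have hm : m < u.length := by
          by_contra hm
          have hnil : u.getD m [] = [] := List.getD_eq_default _ _ (by omega)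
          rw [decW, colBit, hnil] at hmk
          simp at hmk
        obtain ⟨p, hp, hlt⟩ := hs' m k' (by rw [if_pos hm]; exact hmk)
        refine ⟨p, hp, ?_⟩
        split_ifs at hlt <;> omega
      obtain ⟨p, hp, hlt⟩ := h₃.1 hl i k hik
      refine ⟨p, hp, ?_⟩
      split_ifs <;> omega
    · rw [if_neg hi] at hik
      -- A bit in the right piece is moved to the corresponding position behind `u`; the parameter
      -- that supports it there reaches beyond the cut, and hence also beyond the cut of `u'`.
      obtain ⟨p, hp, hlt⟩ := hs' (u.length + (i - u'.length)) k (by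
        rw [if_neg (by omega), Nat.add_sub_cancel_left]
        exact hik)
      refine ⟨p, hp, ?_⟩
      have := h₄ p (hps p hp)
      split_ifs at hlt ⊢ <;> omega
  · rw [decW_append, hV] at hx
    rw [decW_append, hV']
    exact (hc _ _ _ _ _ _ (decV_eq_zero h0 hu) (decV_eq_zero h0 hu') h₅ _ _
      (decV_eq_zero h0 hz)).1 hx

end Flat


/-! ## An automaton from a membership test and a bound for the number of left quotients -/

namespace Flat

/-- All words of length at most `n`. -/
def wordsUpTo (Al : List (List Bool)) (n : ℕ) : List (List (List Bool)) :=
  (List.range (n + 1)).flatMap fun k => tuples Al k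

theorem mem_wordsUpTo {Al : List (List Bool)} {n : ℕ} {w : List (List Bool)} :
    w ∈ wordsUpTo Al n ↔ w.length ≤ n ∧ ∀ a ∈ w, a ∈ Al := by
  simp only [wordsUpTo, List.mem_flatMap, mem_tuples, List.mem_range]
  constructor
  · rintro ⟨k, hk, rfl, h⟩
    exact ⟨by omega, h⟩
  · rintro ⟨h, h'⟩
    exact ⟨_, by omega, rfl, h'⟩

/-- The states are the words of length at most `N`; `u` goes to `v` by the letter `a` if `u a` and
`v` cannot be distinguished by short words. -/
def nerodeAut (mem : List (List Bool) → Bool) (Al : List (List Bool)) (N : ℕ) : FinAut :=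
  ([Encodable.encode ([] : List (List Bool))],
    ((wordsUpTo Al N).filter fun u => mem u).map fun u => Encodable.encode u,
    (wordsUpTo Al N).flatMap fun u => Al.flatMap fun a =>
      ((wordsUpTo Al N).filter fun v =>
        (wordsUpTo Al (N ^ 2)).all fun z => mem (u ++ a :: z) == mem (v ++ z)).map
          fun v => (Encodable.encode u, a, Encodable.encode v))

/-! ### Short representatives and separators of left quotients, and correctness of the automaton -/

section

variable {L : Set (List (List Bool))} {Al : List (List Bool)} {N : ℕ}

/-- Among the prefixes of length `0, …, N` of a longer word two have the same class; deleting the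
factor between them preserves the left quotient and shortens the word. -/
theorem NerodeIndex.exists_short (hN : NerodeIndex L N) (u : List (List Bool))
    (hu : ∀ a ∈ u, a ∈ Al) :
    ∃ v ∈ wordsUpTo Al N, ∀ z, v ++ z ∈ L ↔ u ++ z ∈ L := by
  classical
  induction hn : u.length using Nat.strong_induction_on generalizing u with
  | _ n ih =>
  by_cases hle : u.length ≤ N
  · exact ⟨u, mem_wordsUpTo.2 ⟨hle, hu⟩, fun z => Iff.rfl⟩
  obtain ⟨C, inst, hC, c, hc⟩ := hN
  have hcard : Fintype.card C < Fintype.card (Fin (N + 1)) := by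
    rw [Fintype.card_fin]
    omega
  suffices H : ∀ i j : Fin (N + 1), i < j → c (u.take i) = c (u.take j) →
      ∃ v ∈ wordsUpTo Al N, ∀ z, v ++ z ∈ L ↔ u ++ z ∈ L by
    obtain ⟨i, j, hij, he⟩ := Fintype.exists_ne_map_eq_of_card_lt
      (fun i : Fin (N + 1) => c (u.take i)) hcard
    rcases lt_or_gt_of_ne hij with hij | hij
    · exact H i j hij he
    · exact H j i hij he.symm
  intro i j hij he
  have hij' : (i : ℕ) < j := hij
  have hj := j.2
  obtain ⟨v, hv, hvu⟩ := ih (u.take i ++ u.drop j).length (by simp; omega)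
    (u.take i ++ u.drop j) (fun a ha => by
      rcases List.mem_append.1 ha with ha | ha
      · exact hu a (List.mem_of_mem_take ha)
      · exact hu a (List.mem_of_mem_drop ha)) rfl
  refine ⟨v, hv, fun z => (hvu z).trans ?_⟩
  rw [List.append_assoc, hc _ _ he, ← List.append_assoc, List.take_append_drop]

/-- While `z` is read, the pair of classes reached from `u` and from `v` takes at most `N ^ 2`
values. A longer `z` therefore has a factor on which the pair returns, and this factor can be
deleted. -/
theorem NerodeIndex.exists_short_separator (hN : NerodeIndex L N)
    (hL : ∀ w ∈ L, ∀ a ∈ w, a ∈ Al) {u v : List (List Bool)}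
    (h : ∀ z ∈ wordsUpTo Al (N ^ 2), u ++ z ∈ L ↔ v ++ z ∈ L) (z : List (List Bool)) :
    u ++ z ∈ L ↔ v ++ z ∈ L := by
  classical
  induction hn : z.length using Nat.strong_induction_on generalizing z with
  | _ n ih =>
  by_cases hz : ∀ a ∈ z, a ∈ Al
  swap
  -- A foreign letter in `z` keeps both words out of the language.
  · push Not at hz
    obtain ⟨a, ha, haA⟩ := hz
    exact ⟨fun h => absurd (hL _ h a (List.mem_append_right _ ha)) haA,
      fun h => absurd (hL _ h a (List.mem_append_right _ ha)) haA⟩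
  by_cases hle : z.length ≤ N ^ 2
  · exact h z (mem_wordsUpTo.2 ⟨hle, hz⟩)
  obtain ⟨C, inst, hC, c, hc⟩ := hN
  have hcard : Fintype.card (C × C) < Fintype.card (Fin (N ^ 2 + 1)) := by
    rw [Fintype.card_fin, Fintype.card_prod, pow_two]
    exact Nat.lt_succ_of_le (Nat.mul_le_mul hC hC)
  suffices H : ∀ i j : Fin (N ^ 2 + 1), i < j → c (u ++ z.take i) = c (u ++ z.take j) →
      c (v ++ z.take i) = c (v ++ z.take j) → (u ++ z ∈ L ↔ v ++ z ∈ L) by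
    obtain ⟨i, j, hij, he⟩ := Fintype.exists_ne_map_eq_of_card_lt
      (fun i : Fin (N ^ 2 + 1) => (c (u ++ z.take i), c (v ++ z.take i))) hcard
    obtain ⟨h₁, h₂⟩ := Prod.mk.inj he
    rcases lt_or_gt_of_ne hij with hij | hij
    · exact H i j hij h₁ h₂
    · exact H j i hij h₁.symm h₂.symm
  intro i j hij h₁ h₂
  have hij' : (i : ℕ) < j := hij
  have hj := j.2
  have key : ∀ w, c (w ++ z.take i) = c (w ++ z.take j) →
      (w ++ z ∈ L ↔ w ++ (z.take i ++ z.drop j) ∈ L) := by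
    intro w hw
    rw [← List.append_assoc, hc _ _ hw, List.append_assoc, List.take_append_drop]
  rw [key u h₁, key v h₂]
  exact ih _ (by simp; omega) _ rfl

/-- The automaton may be nondeterministic, since several short words can share a left quotient.
Every state reached by `w` has the left quotient of `w`, and at least one state is reached if `w` is
over the alphabet; so acceptance at any reached state is membership of `w`. -/
theorem lang_nerodeAut (mem : List (List Bool) → Bool) (hmem : ∀ u, mem u = true ↔ u ∈ L)
    (hL : ∀ w ∈ L, ∀ a ∈ w, a ∈ Al) (hN : NerodeIndex L N) :
    (nerodeAut mem Al N).lang = L := by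
  have hstep : ∀ q a q', q' ∈ (nerodeAut mem Al N).toNFA.step q a ↔
      ∃ u ∈ wordsUpTo Al N, a ∈ Al ∧ ∃ v ∈ wordsUpTo Al N, q = Encodable.encode u ∧
        q' = Encodable.encode v ∧ ∀ z, u ++ [a] ++ z ∈ L ↔ v ++ z ∈ L := by
    intro q a q'
    have hbeq : ∀ x y, (mem x == mem y) = true ↔ (x ∈ L ↔ y ∈ L) := by
      intro x y
      rw [beq_iff_eq, Bool.eq_iff_iff, hmem, hmem]
    simp only [nerodeAut, FinAut.toNFA, Set.mem_ofPred_eq, List.mem_flatMap, List.mem_map,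
      List.mem_filter, List.all_eq_true, hbeq, Prod.mk.injEq]
    constructor
    · rintro ⟨u, hu, b, hb, v, ⟨hv, hz⟩, rfl, rfl, rfl⟩
      refine ⟨u, hu, hb, v, hv, rfl, rfl, hN.exists_short_separator hL fun z hz' => ?_⟩
      simpa using hz z hz'
    · rintro ⟨u, hu, hb, v, hv, rfl, rfl, hz⟩
      exact ⟨u, hu, a, hb, v, ⟨hv, fun z _ => by simpa using hz z⟩, rfl, rfl, rfl⟩
  have hnil : ∀ q, q ∈ (nerodeAut mem Al N).toNFA.eval [] ↔
      q = Encodable.encode ([] : List (List Bool)) := by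
    intro q
    simp [nerodeAut, FinAut.toNFA]
  have hsound : ∀ w q, q ∈ (nerodeAut mem Al N).toNFA.eval w →
      ∃ v ∈ wordsUpTo Al N, q = Encodable.encode v ∧ ∀ z, v ++ z ∈ L ↔ w ++ z ∈ L := by
    intro w
    induction w using List.reverseRecOn with
    | nil =>
      intro q hq
      exact ⟨[], mem_wordsUpTo.2 (by simp), (hnil q).1 hq, fun z => Iff.rfl⟩
    | append_singleton w a ih =>
      intro q hq
      rw [NFA.eval_append_singleton, NFA.mem_stepSet] at hq
      obtain ⟨p, hp, hq⟩ := hq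
      obtain ⟨u', hu', rfl, hu'w⟩ := ih p hp
      obtain ⟨u, hu, ha, v, hv, he, rfl, h⟩ := (hstep _ _ _).1 hq
      obtain rfl := Encodable.encode_injective he
      refine ⟨v, hv, rfl, fun z => (h z).symm.trans ?_⟩
      rw [List.append_assoc, hu'w, List.append_assoc]
  have hcomplete : ∀ w : List (List Bool), (∀ a ∈ w, a ∈ Al) →
      ∃ q, q ∈ (nerodeAut mem Al N).toNFA.eval w := by
    intro w
    induction w using List.reverseRecOn with
    | nil => exact fun _ => ⟨_, (hnil _).2 rfl⟩
    | append_singleton w a ih =>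
      intro hw
      obtain ⟨p, hp⟩ := ih fun b hb => hw b (List.mem_append_left _ hb)
      obtain ⟨u, hu, rfl, -⟩ := hsound w p hp
      have ha : a ∈ Al := hw a (by simp)
      obtain ⟨v, hv, huv⟩ := hN.exists_short (Al := Al) (u ++ [a]) fun b hb => by
        rcases List.mem_append.1 hb with hb | hb
        · exact (mem_wordsUpTo.1 hu).2 b hb
        · rwa [List.mem_singleton.1 hb]
      refine ⟨Encodable.encode v, ?_⟩
      rw [NFA.eval_append_singleton, NFA.mem_stepSet]
      exact ⟨_, hp, (hstep _ _ _).2 ⟨u, hu, ha, v, hv, rfl, rfl, fun z => (huv z).symm⟩⟩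
  have hacc : ∀ v ∈ wordsUpTo Al N,
      Encodable.encode v ∈ (nerodeAut mem Al N).toNFA.accept ↔ v ∈ L := by
    intro v hv
    simp only [nerodeAut, FinAut.toNFA, Set.mem_ofPred_eq, List.mem_map, List.mem_filter, hmem]
    constructor
    · rintro ⟨u, ⟨-, hu⟩, he⟩
      rwa [← Encodable.encode_injective he]
    · exact fun h => ⟨v, ⟨hv, h⟩, rfl⟩
  ext w
  simp only [FinAut.lang, Set.mem_ofPred_eq, NFA.mem_accepts]
  constructor
  · rintro ⟨q, hq, hw⟩
    obtain ⟨v, hv, rfl, hvw⟩ := hsound w q hw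
    have := hvw []
    simp only [List.append_nil] at this
    exact this.1 ((hacc v hv).1 hq)
  · intro hw
    obtain ⟨q, hq⟩ := hcomplete w (hL w hw)
    obtain ⟨v, hv, rfl, hvw⟩ := hsound w q hq
    have := hvw []
    simp only [List.append_nil] at this
    exact ⟨_, (hacc v hv).2 (this.2 hw), hq⟩

end

@[fun_prop] theorem primrec_wordsUpTo :
    Primrec fun p : List (List Bool) × ℕ => wordsUpTo p.1 p.2 := by
  unfold wordsUpTo
  fun_prop

theorem primrec_nerodeAut {α : Type} [Primcodable α] {mem : α → List (List Bool) → Bool}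
    {Al : α → List (List Bool)} {N : α → ℕ}
    (hmem : Primrec fun p : α × List (List Bool) => mem p.1 p.2) (hAl : Primrec Al)
    (hN : Primrec N) : Primrec fun a => nerodeAut (mem a) (Al a) (N a) := by
  unfold nerodeAut
  fun_prop

end Flat


/-! ## Deciding membership in the language of a prenex formula -/

namespace Flat

/-- A negation flag, a quantifier prefix, a matrix in disjunctive normal form, predicates, the slot
of the first quantified variable, the slots of the parameters, and a layout. -/
abbrev Spec : Type :=
  Bool × List Bool × List (List FAtom) × List FAtom × ℕ × List ℕ × Layout

namespace Spec

def neg (Φ : Spec) : Bool := Φ.1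
def pre (Φ : Spec) : List Bool := Φ.2.1
def mat (Φ : Spec) : List (List FAtom) := Φ.2.2.1
def preds (Φ : Spec) : List FAtom := Φ.2.2.2.1
def slot (Φ : Spec) : ℕ := Φ.2.2.2.2.1
def pars (Φ : Spec) : List ℕ := Φ.2.2.2.2.2.1
def lay (Φ : Spec) : Layout := Φ.2.2.2.2.2.2

@[fun_prop] theorem primrec_neg : Primrec neg := by unfold neg; fun_prop
@[fun_prop] theorem primrec_pre : Primrec pre := by unfold pre; fun_prop
@[fun_prop] theorem primrec_mat : Primrec mat := by unfold mat; fun_prop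
@[fun_prop] theorem primrec_preds : Primrec preds := by unfold preds; fun_prop
@[fun_prop] theorem primrec_slot : Primrec slot := by unfold slot; fun_prop
@[fun_prop] theorem primrec_pars : Primrec pars := by unfold pars; fun_prop
@[fun_prop] theorem primrec_lay : Primrec lay := by unfold lay; fun_prop

def body (Φ : Spec) (v : ℕ → ℕ) (W : ℕ → ℕ → Bool) : Prop :=
  evalPre (fun v => matB Φ.mat Φ.preds Φ.pars v W = true) Φ.pre Φ.slot v

def Holds (Φ : Spec) (v : ℕ → ℕ) (W : ℕ → ℕ → Bool) : Prop :=
  if Φ.neg = true then ¬ Φ.body v W else Φ.body v W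

structure WellFormed (Φ : Spec) : Prop where
  pars_subset : ∀ p ∈ Φ.pars, p ∈ numSlots Φ.lay
  slot_lt : ∀ j ∈ numSlots Φ.lay, 0 < j ∧ j < Φ.slot
  slot_pos : 0 < Φ.slot

/-- A bound for the numbers that occur in `Φ`. -/
def size (Φ : Spec) : ℕ := Encodable.encode Φ

/-- One application of `stepIndex` per quantifier, as a primitive recursion along the prefix. -/
def index (Φ : Spec) : ℕ :=
  Nat.rec (motive := fun _ => ℕ) (simIndex Φ.size (4 * Φ.size + 1)) (fun _ x => stepIndex x)
    Φ.pre.length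

theorem index_eq (Φ : Spec) :
    Φ.index = stepIndex^[Φ.pre.length] (simIndex Φ.size (4 * Φ.size + 1)) := by
  unfold index
  induction Φ.pre.length with
  | zero => rfl
  | succ n ih => rw [Function.iterate_succ_apply', ← ih]

theorem encode_parts_le (Φ : Spec) : Encodable.encode Φ.mat ≤ Φ.size ∧
    Encodable.encode Φ.preds ≤ Φ.size ∧ Encodable.encode Φ.pars ≤ Φ.size := by
  have h₁ := encode_snd_le Φ
  have h₂ := encode_snd_le Φ.2
  have h₃ := encode_fst_le Φ.2.2
  have h₄ := encode_snd_le Φ.2.2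
  have h₅ := encode_fst_le Φ.2.2.2
  have h₆ := encode_snd_le Φ.2.2.2
  have h₇ := encode_snd_le Φ.2.2.2.2
  have h₈ := encode_fst_le Φ.2.2.2.2.2
  unfold size mat preds pars
  omega

theorem hasIndex_mat (Φ : Spec) :
    HasIndex (fun v W => matB Φ.mat Φ.preds Φ.pars v W = true)
      (simIndex Φ.size (4 * Φ.size + 1)) := by
  obtain ⟨h₁, h₂, h₃⟩ := Φ.encode_parts_le
  refine hasIndex_matB (fun a ha => ?_) ((length_le_encode _).trans h₂) (fun p hp => ?_)
    fun c hc a ha => ?_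
  · exact (FAtom.bounded_encode a).mono ((encode_mem_le ha).trans h₂)
  · exact (encode_mem_le hp).trans h₃
  · exact (FAtom.bounded_encode a).mono
      (((encode_mem_le ha).trans (encode_mem_le hc)).trans h₁)

theorem hasIndex_holds (Φ : Spec) (h : 0 < Φ.slot) : HasIndex Φ.Holds Φ.index := by
  have hb : HasIndex Φ.body Φ.index := by
    rw [index_eq]
    exact hasIndex_evalPre Φ.hasIndex_mat Φ.pre Φ.slot h
  by_cases hn : Φ.neg = true
  · exact hb.not.congr fun v W => by simp [Holds, hn]
  · exact hb.congr fun v W => by simp [Holds, hn]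

end Spec

/-! ### Evaluation with bounded quantifiers -/

section Bounded

/-- The extensions of the valuation `l` by values of `i` bounded quantified variables. -/
def envs (l : List ℕ) (U N : ℕ) (i : ℕ) : List (List ℕ) :=
  Nat.rec (motive := fun _ => List (List ℕ)) [l]
    (fun i E => E.flatMap fun b => (List.range (U + (i + 1) * N + 1)).map fun x => b ++ [x]) i

/-- The valuations of all but the last `n` quantified variables that satisfy the rest. -/
def goodEnvs (m : List ℕ → Bool) (pre : List Bool) (l : List ℕ) (U N : ℕ) (n : ℕ) :
    List (List ℕ) :=
  Nat.rec (motive := fun _ => List (List ℕ))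
    ((envs l U N pre.length).filter fun b => m b)
    (fun n T => (envs l U N (pre.length - (n + 1))).filter fun b =>
      if pre.getD (pre.length - (n + 1)) false = true then
        (List.range (U + (pre.length - n) * N + 1)).any fun x => T.any fun c => c == b ++ [x]
      else
        (List.range (U + (pre.length - n) * N + 1)).all fun x => T.any fun c => c == b ++ [x]) n

/-- The prefix is evaluated from the inside out by tables of environments. This is a primitive
recursion on the number of quantifiers, whereas following the prefix from the outside would recurse
with varying valuations. -/
def evalB (m : List ℕ → Bool) (pre : List Bool) (l : List ℕ) (U N : ℕ) : Bool :=
  (goodEnvs m pre l U N pre.length).any fun c => c == l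

theorem envs_succ (l : List ℕ) (U N i : ℕ) : envs l U N (i + 1) =
    (envs l U N i).flatMap fun b =>
      (List.range (U + (i + 1) * N + 1)).map fun x => b ++ [x] := rfl

theorem mem_envs_succ {l : List ℕ} {U N i : ℕ} {c : List ℕ} : c ∈ envs l U N (i + 1) ↔
    ∃ b ∈ envs l U N i, ∃ x ≤ U + (i + 1) * N, c = b ++ [x] := by
  rw [envs_succ]
  simp only [List.mem_flatMap, List.mem_map, List.mem_range, Nat.lt_succ_iff, eq_comm]

theorem length_of_mem_envs {l : List ℕ} {U N i : ℕ} {b : List ℕ} (h : b ∈ envs l U N i) :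
    b.length = l.length + i := by
  induction i generalizing b with
  | zero => rw [List.mem_singleton.1 h, add_zero]
  | succ i ih =>
    obtain ⟨b, hb, x, -, rfl⟩ := mem_envs_succ.1 h
    rw [List.length_append, ih hb]
    rfl

def valOf (b : List ℕ) (j : ℕ) : ℕ := b.getD j 0

theorem valOf_append (b : List ℕ) (x : ℕ) :
    valOf (b ++ [x]) = Function.update (valOf b) b.length x := by
  funext j
  unfold valOf
  rcases lt_trichotomy j b.length with h | rfl | h
  · rw [Function.update_of_ne h.ne, List.getD_append _ _ _ _ h]
  · rw [Function.update_self, List.getD_append_right _ _ _ _ le_rfl, Nat.sub_self]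
    rfl
  · rw [Function.update_of_ne h.ne', List.getD_eq_default _ _ h.le,
      List.getD_eq_default _ _ (by simp; omega)]

/-- Invariant: after `n` rounds the table consists of the environments for all but the last `n`
quantifiers under which the remaining formula holds. -/
theorem evalB_iff {m : List ℕ → Bool} {M : (ℕ → ℕ) → Prop} (hm : ∀ b, m b = true ↔ M (valOf b))
    (pre : List Bool) (l : List ℕ) (U N : ℕ) :
    evalB m pre l U N = true ↔ evalPreB M N pre l.length U (valOf l) := by
  have key : ∀ n ≤ pre.length, ∀ b, b ∈ goodEnvs m pre l U N n ↔
      b ∈ envs l U N (pre.length - n) ∧ evalPreB M N (pre.drop (pre.length - n))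
        (l.length + (pre.length - n)) (U + (pre.length - n) * N) (valOf b) := by
    intro n
    induction n with
    | zero =>
      intro _ b
      have : goodEnvs m pre l U N 0 = (envs l U N pre.length).filter fun b => m b := rfl
      rw [this, List.mem_filter, Nat.sub_zero, List.drop_length, hm]
      rfl
    | succ n ih =>
      intro hn b
      obtain ⟨i, hi⟩ : ∃ i, pre.length - (n + 1) = i := ⟨_, rfl⟩
      have hi' : pre.length - n = i + 1 := by omega
      have hil : i < pre.length := by omega
      have hrec : goodEnvs m pre l U N (n + 1) =
          (envs l U N (pre.length - (n + 1))).filter fun b =>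
            if pre.getD (pre.length - (n + 1)) false = true then
              (List.range (U + (pre.length - n) * N + 1)).any fun x =>
                (goodEnvs m pre l U N n).any fun c => c == b ++ [x]
            else
              (List.range (U + (pre.length - n) * N + 1)).all fun x =>
                (goodEnvs m pre l U N n).any fun c => c == b ++ [x] := rfl
      rw [hrec, List.mem_filter]
      refine and_congr_right fun hb => ?_
      rw [hi] at hb ⊢
      have hbl := length_of_mem_envs hb
      have hmem : ∀ x ≤ U + (i + 1) * N,
          (((goodEnvs m pre l U N n).any fun c => c == b ++ [x]) = true ↔
          evalPreB M N (pre.drop (i + 1)) (l.length + i + 1) (U + i * N + N)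
            (Function.update (valOf b) (l.length + i) x)) := by
        intro x hx
        have h₁ : ((goodEnvs m pre l U N n).any fun c => c == b ++ [x]) = true ↔
            b ++ [x] ∈ goodEnvs m pre l U N n := by
          rw [List.any_eq_true]
          constructor
          · rintro ⟨c, hc, hcb⟩
            obtain rfl := beq_iff_eq.1 hcb
            exact hc
          · exact fun h => ⟨_, h, beq_self_eq_true _⟩
        rw [h₁, ih (by omega), hi', valOf_append, hbl,
          show U + (i + 1) * N = U + i * N + N by ring, show l.length + (i + 1) = l.length + i + 1
          by ring]
        exact and_iff_right (mem_envs_succ.2 ⟨b, hb, x, hx, rfl⟩)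
      have hU : U + i * N + N = U + (i + 1) * N := by ring
      rw [hi', List.drop_eq_getElem_cons hil, List.getD_eq_getElem _ _ hil]
      cases pre[i] with
      | true =>
        simp only [if_true, List.any_eq_true (l := List.range _), List.mem_range,
          Nat.lt_succ_iff, evalPreB, hU]
        exact exists_congr fun x => and_congr_right fun hx => by rw [hmem x hx, hU]
      | false =>
        simp only [Bool.false_eq_true, if_false, List.all_eq_true (l := List.range _),
          List.mem_range, Nat.lt_succ_iff, evalPreB, hU]
        exact forall₂_congr fun x hx => by rw [hmem x hx, hU]
  have := key pre.length le_rfl l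
  rw [Nat.sub_self, List.drop_zero, Nat.zero_mul, Nat.add_zero, Nat.add_zero] at this
  have hl : l ∈ envs l U N 0 := List.mem_singleton.2 rfl
  rw [← (this.trans (and_iff_right hl)), evalB, List.any_eq_true]
  constructor
  · rintro ⟨c, hc, hcl⟩
    obtain rfl := beq_iff_eq.1 hcl
    exact hc
  · exact fun h => ⟨_, h, beq_self_eq_true _⟩

end Bounded

/-! ### The membership test and the automaton -/

/-- The bits of the predicates vanish from the position `n` on. -/
def supportedB (l : Layout) (u : List (List Bool)) (n : ℕ) : Bool :=
  (List.range u.length).all fun i => l.all fun x => x.1 || !decW l u i x.2 || decide (i < n)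

namespace Spec

/-- The initial environment lists the slots below `Φ.slot`, so the first appended entry is the first
quantified slot. The length of `u` bounds all decoded values, and all bits vanish from there on, as
the bounded evaluation requires. -/
def holdsB (Φ : Spec) (u : List (List Bool)) : Bool :=
  evalB (fun b => matB Φ.mat Φ.preds Φ.pars (valOf b) (decW Φ.lay u)) Φ.pre
    ((List.range Φ.slot).map (decV Φ.lay u)) u.length Φ.index == !Φ.neg

def mem (Φ : Spec) (u : List (List Bool)) : Bool :=
  (wordOf Φ.lay (decV Φ.lay u) (decW Φ.lay u) == u) &&
    supportedB Φ.lay u (maxVal Φ.pars (decV Φ.lay u)) && Φ.holdsB u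

/-- The automaton that recognizes the words of the models of `Φ`. -/
def aut (Φ : Spec) : FinAut :=
  nerodeAut Φ.mem (tuples [true, false] Φ.lay.length) (8 * 2 ^ Φ.lay.length * Φ.index)

def lang (Φ : Spec) : Set (List (List Bool)) := wordLang Φ.lay Φ.pars Φ.Holds

theorem holdsB_iff {Φ : Spec} (hΦ : Φ.WellFormed) {u : List (List Bool)}
    (hu : Coherent Φ.lay u) :
    Φ.holdsB u = true ↔ Φ.Holds (decV Φ.lay u) (decW Φ.lay u) := by
  have hval : valOf ((List.range Φ.slot).map (decV Φ.lay u)) = decV Φ.lay u := by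
    funext j
    rw [valOf, getD_map_range]
    split_ifs with h
    · rfl
    · exact (decV_eq_zero (fun hj => h (hΦ.slot_lt j hj).2) hu).symm
  have h0 : decV Φ.lay u 0 = 0 := decV_eq_zero (fun hj => (hΦ.slot_lt 0 hj).1.ne rfl) hu
  have hbody : evalB (fun b => matB Φ.mat Φ.preds Φ.pars (valOf b) (decW Φ.lay u)) Φ.pre
      ((List.range Φ.slot).map (decV Φ.lay u)) u.length Φ.index = true ↔
      Φ.body (decV Φ.lay u) (decW Φ.lay u) := by
    rw [evalB_iff (M := fun v => matB Φ.mat Φ.preds Φ.pars v (decW Φ.lay u) = true)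
      (fun b => Iff.rfl), List.length_map, List.length_range, hval, body]
    refine (evalPre_iff_evalPreB Φ.hasIndex_mat Φ.pre Φ.slot u.length _ hΦ.slot_pos
      Φ.index_eq.ge h0 (fun j => decV_le j) fun i k hi => ?_).symm
    have hnil : u.getD i [] = [] := List.getD_eq_default _ _ hi
    rw [decW, colBit, hnil]
    rfl
  rw [holdsB, beq_iff_eq, Holds, ← hbody]
  cases Φ.neg <;> simp

theorem mem_iff {Φ : Spec} (hΦ : Φ.WellFormed) (u : List (List Bool)) :
    Φ.mem u = true ↔ u ∈ Φ.lang := by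
  simp only [mem, lang, wordLang, Bool.and_eq_true, beq_iff_eq, Set.mem_ofPred_eq, and_assoc]
  refine and_congr_right fun hw => ?_
  have hco := (wordOf_dec_iff.1 hw).1
  rw [holdsB_iff hΦ hco]
  refine and_congr_left fun _ => ?_
  simp only [supportedB, List.all_eq_true, List.mem_range, Bool.or_eq_true, Bool.not_eq_true',
    decide_eq_true_eq]
  constructor
  · intro h i k hik
    have hi : i < u.length := by
      by_contra hi
      have hnil : u.getD i [] = [] := List.getD_eq_default _ _ (not_lt.1 hi)
      rw [decW, colBit, hnil] at hik
      simp at hik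
    -- The test inspects only the predicate columns of the layout; decoded bits of any other
    -- predicate are false by coherence.
    have hk : (false, k) ∈ Φ.lay := by
      by_contra hk
      rw [decW, colBit, hco i hi, List.idxOf_eq_length hk, List.getD_eq_default _ _
        (by simp [letterOf])] at hik
      simp at hik
    rcases h i hi _ hk with (h | h) | h
    · simp at h
    · rw [hik] at h
      simp at h
    · exact h
  · rintro h i hi ⟨_ | _, k⟩ hx
    · rcases hb : decW Φ.lay u i k
      · exact Or.inl (Or.inr rfl)
      · exact Or.inr (h i k hb)
    · exact Or.inl (Or.inl rfl)

theorem lang_aut {Φ : Spec} (hΦ : Φ.WellFormed) : Φ.aut.lang = Φ.lang := by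
  refine lang_nerodeAut Φ.mem (mem_iff hΦ) (fun w hw a ha => ?_) ?_
  · rw [← hw.1] at ha
    obtain ⟨i, -, rfl⟩ := List.mem_map.1 ha
    exact mem_tuples.2 ⟨by simp [letterOf], fun b _ => by cases b <;> simp⟩
  · exact nerodeIndex_wordLang (Φ.hasIndex_holds hΦ.slot_pos)
      (fun h => (hΦ.slot_lt 0 h).1.ne rfl) hΦ.pars_subset

end Spec

/-! ### Computability -/

@[fun_prop] theorem primrec_colBit :
    Primrec fun p : Layout × List (List Bool) × (Bool × ℕ) × ℕ =>
      colBit p.1 p.2.1 p.2.2.1 p.2.2.2 := by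
  unfold colBit
  fun_prop

@[fun_prop] theorem primrec_decV :
    Primrec fun p : Layout × List (List Bool) × ℕ => decV p.1 p.2.1 p.2.2 := by
  unfold decV cnt
  fun_prop

@[fun_prop] theorem primrec_decW :
    Primrec fun p : Layout × List (List Bool) × ℕ × ℕ => decW p.1 p.2.1 p.2.2.1 p.2.2.2 := by
  unfold decW
  fun_prop

@[fun_prop] theorem primrec_numSlots : Primrec numSlots := by
  unfold numSlots
  fun_prop

section

variable {α : Type} [Primcodable α]

@[fun_prop] theorem primrec_maxVal {ps : α → List ℕ} {v : α → ℕ → ℕ} (hps : Primrec ps)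
    (hv : Primrec fun p : α × ℕ => v p.1 p.2) : Primrec fun a => maxVal (ps a) (v a) := by
  unfold maxVal
  fun_prop

@[fun_prop] theorem primrec_intVal {v : α → ℕ → ℕ} {j : α → ℕ}
    (hv : Primrec fun p : α × ℕ => v p.1 p.2) (hj : Primrec j) :
    Primrec fun a => intVal (v a) (j a) := by
  unfold intVal
  fun_prop

@[fun_prop] theorem primrec_instFI : Primrec fun p : FI × FI => instFI p.1 p.2 := by
  unfold instFI
  fun_prop

@[fun_prop] theorem primrec_litFA : Primrec fun p : Bool × FI × FAtom => litFA p.1 p.2.1 p.2.2 := by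
  unfold litFA instFD
  fun_prop

@[fun_prop] theorem primrec_termsFA :
    Primrec fun p : List FAtom × List FAtom => termsFA p.1 p.2 := by
  unfold termsFA
  fun_prop

theorem primrec_constraints {preds c : α → List FAtom} {ps : α → List ℕ} {v : α → ℕ → ℕ}
    {W : α → ℕ → ℕ → Bool} (hp : Primrec preds) (hps : Primrec ps)
    (hv : Primrec fun p : α × ℕ => v p.1 p.2)
    (hW : Primrec fun p : α × ℕ × ℕ => W p.1 p.2.1 p.2.2) (hc : Primrec c) :
    Primrec fun a => constraints (preds a) (ps a) (v a) (W a) (c a) := by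
  have h : Primrec fun p : α × FI => fiEval (intVal (v p.1)) p.2 :=
    primrec_fiEval (by fun_prop) (by fun_prop)
  have hl : Primrec fun p : (α × FI) × ℕ =>
      litFA (W p.1.1 (fiEval (intVal (v p.1.1)) p.1.2 - 1).toNat p.2) p.1.2
        ((preds p.1.1).getD p.2 default) := by
    have h' : Primrec fun p : (α × FI) × ℕ =>
        W p.1.1 (fiEval (intVal (v p.1.1)) p.1.2 - 1).toNat p.2 :=
      Primrec.fun_comp (f := fun p : α × ℕ × ℕ => W p.1 p.2.1 p.2.2)
        (g := fun p : (α × FI) × ℕ =>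
          (p.1.1, (fiEval (intVal (v p.1.1)) p.1.2 - 1).toNat, p.2)) hW (by fun_prop)
    fun_prop
  unfold constraints
  fun_prop

theorem primrec_matB {D : α → List (List FAtom)} {preds : α → List FAtom} {ps : α → List ℕ}
    {v : α → ℕ → ℕ} {W : α → ℕ → ℕ → Bool} (hD : Primrec D) (hp : Primrec preds)
    (hps : Primrec ps) (hv : Primrec fun p : α × ℕ => v p.1 p.2)
    (hW : Primrec fun p : α × ℕ × ℕ => W p.1 p.2.1 p.2.2) :
    Primrec fun a => matB (D a) (preds a) (ps a) (v a) (W a) := by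
  have h₁ : Primrec fun p : α × List FAtom =>
      constraints (preds p.1) (ps p.1) (v p.1) (W p.1) p.2 :=
    primrec_constraints (by fun_prop) (by fun_prop) (by fun_prop) (by fun_prop) (by fun_prop)
  have h₂ : Primrec fun p : (α × List FAtom) × FAtom =>
      faEval (intVal (v p.1.1)) (fun _ _ => 0) p.2 :=
    primrec_faEval (v := fun p : (α × List FAtom) × FAtom => intVal (v p.1.1))
      (A := fun _ _ _ => 0) (by fun_prop) (by fun_prop) (by fun_prop)
  unfold matB
  fun_prop

@[fun_prop] theorem primrec_envs :
    Primrec fun p : List ℕ × ℕ × ℕ × ℕ => envs p.1 p.2.1 p.2.2.1 p.2.2.2 := by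
  unfold envs
  fun_prop

theorem primrec_evalB {m : α → List ℕ → Bool} {pre : α → List Bool} {l : α → List ℕ}
    {U N : α → ℕ} (hm : Primrec fun p : α × List ℕ => m p.1 p.2) (hpre : Primrec pre)
    (hl : Primrec l) (hU : Primrec U) (hN : Primrec N) :
    Primrec fun a => evalB (m a) (pre a) (l a) (U a) (N a) := by
  unfold evalB goodEnvs
  fun_prop

@[fun_prop] theorem primrec_valOf : Primrec fun p : List ℕ × ℕ => valOf p.1 p.2 := by
  unfold valOf
  fun_prop

@[fun_prop] theorem primrec_simIndex : Primrec fun p : ℕ × ℕ => simIndex p.1 p.2 := by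
  unfold simIndex
  fun_prop

@[fun_prop] theorem Spec.primrec_index : Primrec Spec.index := by
  unfold Spec.index Spec.size stepIndex
  fun_prop

@[fun_prop] theorem Spec.primrec_holdsB :
    Primrec fun p : Spec × List (List Bool) => Spec.holdsB p.1 p.2 := by
  have h₁ : Primrec fun p : (Spec × List (List Bool)) × List ℕ =>
      matB p.1.1.mat p.1.1.preds p.1.1.pars (valOf p.2) (decW p.1.1.lay p.1.2) :=
    primrec_matB (by fun_prop) (by fun_prop) (by fun_prop) (by fun_prop) (by fun_prop)
  have h₂ := primrec_evalB
    (m := fun (p : Spec × List (List Bool)) (b : List ℕ) =>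
      matB p.1.mat p.1.preds p.1.pars (valOf b) (decW p.1.lay p.2))
    (pre := fun p : Spec × List (List Bool) => p.1.pre)
    (l := fun p : Spec × List (List Bool) => (List.range p.1.slot).map (decV p.1.lay p.2))
    (U := fun p => p.2.length) (N := fun p => p.1.index) h₁
    (by fun_prop) (by fun_prop) (by fun_prop) (by fun_prop)
  unfold Spec.holdsB
  fun_prop

theorem primrec_wordOf {l : α → Layout} {v : α → ℕ → ℕ} {W : α → ℕ → ℕ → Bool}
    (hl : Primrec l) (hv : Primrec fun p : α × ℕ => v p.1 p.2)
    (hW : Primrec fun p : α × ℕ × ℕ => W p.1 p.2.1 p.2.2) :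
    Primrec fun a => wordOf (l a) (v a) (W a) := by
  have hW' : Primrec fun p : (α × ℕ) × Bool × ℕ => W p.1.1 p.1.2 p.2.2 :=
    Primrec.fun_comp (f := fun p : α × ℕ × ℕ => W p.1 p.2.1 p.2.2)
      (g := fun p : (α × ℕ) × Bool × ℕ => (p.1.1, p.1.2, p.2.2)) hW (by fun_prop)
  have h : Primrec fun p : α × ℕ => letterOf (l p.1) (v p.1) (W p.1) p.2 := by
    unfold letterOf
    fun_prop
  unfold wordOf
  fun_prop

@[fun_prop] theorem primrec_supportedB :
    Primrec fun p : Layout × List (List Bool) × ℕ => supportedB p.1 p.2.1 p.2.2 := by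
  have h : Primrec fun p : ((Layout × List (List Bool) × ℕ) × ℕ) × Bool × ℕ =>
      p.2.1 || !decW p.1.1.1 p.1.1.2.1 p.1.2 p.2.2 || decide (p.1.2 < p.1.1.2.2) := by
    fun_prop
  unfold supportedB
  fun_prop

@[fun_prop] theorem Spec.primrec_mem :
    Primrec fun p : Spec × List (List Bool) => Spec.mem p.1 p.2 := by
  have h₁ : Primrec fun p : Spec × List (List Bool) =>
      wordOf p.1.lay (decV p.1.lay p.2) (decW p.1.lay p.2) :=
    primrec_wordOf (by fun_prop) (by fun_prop) (by fun_prop)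
  have h₂ : Primrec fun p : Spec × List (List Bool) => maxVal p.1.pars (decV p.1.lay p.2) := by
    fun_prop
  unfold Spec.mem
  fun_prop

theorem Spec.primrec_aut : Primrec Spec.aut := by
  unfold Spec.aut
  exact primrec_nerodeAut (by fun_prop) (by fun_prop) (by fun_prop)

end

end Flat

open Flat

/-! ## Reading formulae from their codes -/


section TypedFlat

variable {S : Sig} {n n' : ℕ} [Encodable S.Par] [Encodable S.Idx] [Encodable S.Dat]
  [Encodable S.Arr]

/-- The slot of a variable of the vocabulary. -/
def slotOf (x : S.Int) : ℕ := Encodable.encode x + 2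

/-- Slots 0 and 1 are reserved for the constant zero and for the designated variable of the
predicates. The size of an array is the slot of its parameter. -/
def ITerm.nf (g : Fin n → ℕ) : ITerm S n → FI
  | .var x => (slotOf x, 0)
  | .bvar i => (g i, 0)
  | .const c => (0, c)
  | .size a => (slotOf (.inl (S.size a)), 0)
  | .add t c => ((t.nf g).1, (t.nf g).2 + c)

def ITerm.flats (g : Fin n → ℕ) (t : ITerm S n) : List FI := t.subterms.map (ITerm.nf g)

/-- Data variables become arrays with odd numbers, read at position zero; genuine arrays get the
positive even numbers, and array 0 serves constants. -/
def DTerm.flat (g : Fin n → ℕ) : DTerm S n → FD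
  | .var v => (2 * Encodable.encode v + 1, (0, 0), 0)
  | .const c => (0, (0, 0), c)
  | .read a t => (2 * Encodable.encode a + 2, t.nf g, 0)
  | .add e c => ((e.flat g).1, (e.flat g).2.1, (e.flat g).2.2 + c)

def Atom.flat (g : Fin n → ℕ) : Atom S n → FAtom
  | .idx l c r => (false, c.code, (0, l.nf g, 0), (0, r.nf g, 0), l.flats g ++ r.flats g)
  | .dat l c r => (true, c.code, l.flat g, r.flat g,
      l.indexTerms.map (ITerm.nf g) ++ r.indexTerms.map (ITerm.nf g))

def PNF.flatPre : {n : ℕ} → PNF S n → List Bool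
  | _, .mat _ => []
  | _, .quant e F => e :: F.flatPre

def PNF.flatMat : {n : ℕ} → (Fin n → ℕ) → ℕ → PNF S n → List (List FAtom)
  | _, g, _, .mat D => D.map fun c => c.map (Atom.flat g)
  | _, g, j, .quant _ F => F.flatMat (Fin.cons j g) (j + 1)

theorem ITerm.getD_flats (g : Fin n → ℕ) (t : ITerm S n) : (t.flats g).getD 0 (0, 0) = t.nf g := by
  cases t <;> rfl

theorem ITerm.nf_of_flats {g : Fin n → ℕ} {t : ITerm S n} {j : ℕ} (h : t.flats g = [(j, 0)]) :
    t.nf g = (j, 0) := by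
  rw [← t.getD_flats g, h]
  rfl

/-- Slots are absolute while de Bruijn indices are relative, so replacing variables by terms with
the same slots does not change the flat form. The singleton in the hypothesis excludes proper
subterms. Hence weakening and lifting are invisible after flattening. -/
theorem ITerm.flats_map_id {g : Fin n → ℕ} {g' : Fin n' → ℕ} {θ : Fin n → ITerm S n'}
    (hθ : ∀ i, (θ i).flats g' = [(g i, 0)]) (t : ITerm S n) :
    (t.map (Sig.Hom.id S) θ).nf g' = t.nf g ∧ (t.map (Sig.Hom.id S) θ).flats g' = t.flats g := by
  induction t with
  | var x => rcases x with x | x <;> exact ⟨rfl, rfl⟩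
  | bvar i => exact ⟨ITerm.nf_of_flats (hθ i), hθ i⟩
  | const c => exact ⟨rfl, rfl⟩
  | size a => exact ⟨rfl, rfl⟩
  | add t c ih =>
    have h : ((t.add c).map (Sig.Hom.id S) θ).nf g' = (t.add c).nf g := by
      simp only [ITerm.map, ITerm.nf, ih.1]
    refine ⟨h, ?_⟩
    change ((t.add c).map (Sig.Hom.id S) θ).nf g' :: (t.map (Sig.Hom.id S) θ).flats g' = _
    rw [h, ih.2]
    rfl

theorem DTerm.flat_map_id {g : Fin n → ℕ} {g' : Fin n' → ℕ} {θ : Fin n → ITerm S n'}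
    (hθ : ∀ i, (θ i).flats g' = [(g i, 0)]) (t : DTerm S n) :
    (t.map (Sig.Hom.id S) θ).flat g' = t.flat g ∧
      (t.map (Sig.Hom.id S) θ).indexTerms.map (ITerm.nf g') = t.indexTerms.map (ITerm.nf g) := by
  induction t with
  | var x => exact ⟨rfl, rfl⟩
  | const c => exact ⟨rfl, rfl⟩
  | read a t =>
    obtain ⟨h₁, h₂⟩ := ITerm.flats_map_id hθ t
    refine ⟨?_, h₂⟩
    simp only [DTerm.map, DTerm.flat, h₁]
    rfl
  | add t c ih =>
    refine ⟨?_, ih.2⟩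
    simp only [DTerm.map, DTerm.flat, ih.1]

theorem Atom.flat_map_id {g : Fin n → ℕ} {g' : Fin n' → ℕ} {θ : Fin n → ITerm S n'}
    (hθ : ∀ i, (θ i).flats g' = [(g i, 0)]) (a : Atom S n) :
    (a.map (Sig.Hom.id S) θ).flat g' = a.flat g := by
  cases a with
  | idx l c r =>
    obtain ⟨h₁, h₂⟩ := ITerm.flats_map_id hθ l
    obtain ⟨h₃, h₄⟩ := ITerm.flats_map_id hθ r
    simp only [Atom.map, Atom.flat, h₁, h₂, h₃, h₄]
  | dat l c r =>
    obtain ⟨h₁, h₂⟩ := DTerm.flat_map_id hθ l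
    obtain ⟨h₃, h₄⟩ := DTerm.flat_map_id hθ r
    simp only [Atom.map, Atom.flat, h₁, h₂, h₃, h₄]

theorem ITerm.flats_lift {g : Fin n' → ℕ} {θ : Fin n → ITerm S n'} {h : Fin n → ℕ}
    (hθ : ∀ i, (θ i).flats g = [(h i, 0)]) (j : ℕ) (i : Fin (n + 1)) :
    (ITerm.lift θ i).flats (Fin.cons j g : Fin (n' + 1) → ℕ) =
      [((Fin.cons j h : Fin (n + 1) → ℕ) i, 0)] := by
  refine Fin.cases rfl (fun i => ?_) i
  simp only [ITerm.lift, Fin.cons_succ]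
  rw [(ITerm.flats_map_id (g := g) (fun k => rfl) (θ i)).2, hθ]

theorem PNF.flat_map {m : ℕ} (T : PNF S m) : ∀ {n' : ℕ} {g : Fin m → ℕ} {g' : Fin n' → ℕ}
    {θ : Fin m → ITerm S n'} (_ : ∀ i, (θ i).flats g' = [(g i, 0)]) (j : ℕ),
    (T.map θ).flatPre = T.flatPre ∧ (T.map θ).flatMat g' j = T.flatMat g j := by
  induction T with
  | mat D =>
    intro n' g g' θ hθ j
    refine ⟨rfl, ?_⟩
    simp only [PNF.map, PNF.flatMat, List.map_map]
    refine List.map_congr_left fun c _ => ?_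
    simp only [Function.comp_apply, List.map_map]
    exact List.map_congr_left fun a _ => Atom.flat_map_id hθ a
  | quant e F ih =>
    intro n' g g' θ hθ j
    obtain ⟨h₁, h₂⟩ := ih (ITerm.flats_lift hθ j) (j + 1)
    exact ⟨congrArg (e :: ·) h₁, h₂⟩

/-- `combine` for arbitrary literals. -/
def combineL {α : Type} (d : Bool) (D E : List (List α)) : List (List α) :=
  if d = true then D ++ E else D.flatMap fun c => E.map fun c' => c ++ c'

theorem combineL_map {α β : Type} (f : α → β) (d : Bool) (D E : List (List α)) :
    (combineL d D E).map (List.map f) = combineL d (D.map (List.map f)) (E.map (List.map f)) := by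
  unfold combineL
  split_ifs
  · exact List.map_append
  · simp [List.map_flatMap, List.flatMap_map, Function.comp_def]

theorem weakenMat_flat {g : Fin n → ℕ} (j : ℕ) (D : List (List (Atom S n))) :
    (weakenMat D).map (List.map (Atom.flat (Fin.cons j g : Fin (n + 1) → ℕ))) =
      D.map (List.map (Atom.flat g)) := by
  simp only [weakenMat, List.map_map]
  refine List.map_congr_left fun c _ => ?_
  simp only [Function.comp_apply, List.map_map]
  exact List.map_congr_left fun a _ => Atom.flat_map_id (fun i => rfl) a

theorem PNF.flat_mergeMat (d : Bool) {m : ℕ} (T : PNF S m) :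
    ∀ (D : List (List (Atom S m))) (g : Fin m → ℕ) (j : ℕ),
      (PNF.mergeMat d D T).flatPre = T.flatPre ∧ (PNF.mergeMat d D T).flatMat g j =
        combineL d (D.map (List.map (Atom.flat g))) (T.flatMat g j) := by
  induction T with
  | mat E => exact fun D g j => ⟨rfl, combineL_map _ _ _ _⟩
  | quant e F ih =>
    intro D g j
    obtain ⟨h₁, h₂⟩ := ih (weakenMat D) (Fin.cons j g) (j + 1)
    refine ⟨congrArg (e :: ·) h₁, h₂.trans ?_⟩
    rw [weakenMat_flat]
    rfl

/-- The weakenings of both matrices disappear; what remains is that the quantifiers of the right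
formula use the slots after those of the left one. -/
theorem PNF.flat_merge (d : Bool) {m : ℕ} (T : PNF S m) :
    ∀ (U : PNF S m) (g : Fin m → ℕ) (j : ℕ),
      (PNF.merge d T U).flatPre = T.flatPre ++ U.flatPre ∧ (PNF.merge d T U).flatMat g j =
        combineL d (T.flatMat g j) (U.flatMat g (j + T.flatPre.length)) := by
  induction T with
  | mat D => exact fun U g j => PNF.flat_mergeMat d U D g j
  | quant e F ih =>
    intro U g j
    obtain ⟨h₁, h₂⟩ := ih (U.map fun i => .bvar i.succ) (Fin.cons j g) (j + 1)
    have h₃ := PNF.flat_map U (g := g) (g' := (Fin.cons j g : Fin (_ + 1) → ℕ))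
      (θ := fun i => .bvar i.succ) (fun i => rfl) (j + 1 + F.flatPre.length)
    refine ⟨congrArg (e :: ·) (h₁.trans (by rw [h₃.1]; rfl)), h₂.trans ?_⟩
    rw [h₃.2]
    simp only [PNF.flatMat, PNF.flatPre, List.length_cons]
    rw [show j + 1 + F.flatPre.length = j + (F.flatPre.length + 1) by omega]

theorem Atom.flat_neg (g : Fin n → ℕ) (a : Atom S n) :
    a.neg.flat g = ((a.flat g).1, negCode (a.flat g).2.1, (a.flat g).2.2) := by
  cases a with
  | idx l c r => cases c <;> rfl
  | dat l c r => cases c <;> rfl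

end TypedFlat

/-! ### Terms and atoms -/

namespace Flat

/-- The tables of a map of vocabularies: slots of the index variables, numbers of the data
variables, numbers of the arrays, and slots of the array sizes. -/
abbrev Tabs : Type := List ℕ × List ℕ × List ℕ × List ℕ

/-- Computes, from the code of a term, the flat subterms of its image under a renaming (the tables)
and a substitution (the list of slots), without constructing that image. The head of the list is the
term itself. -/
def rawIStep (a : Tabs × List ℕ) (n : ℕ) (_ l _ : List FI) : List FI :=
  if n.unpair.1 = 1 then [(a.1.1.getD n.unpair.2 0, 0)]
  else if n.unpair.1 = 2 then [(a.2.getD n.unpair.2 0, 0)]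
  else if n.unpair.1 = 3 then [(0, Denumerable.ofNat ℤ n.unpair.2)]
  else if n.unpair.1 = 4 then [(a.1.2.2.2.getD n.unpair.2 0, 0)]
  else ((l.getD 0 (0, 0)).1,
    (l.getD 0 (0, 0)).2 + Denumerable.ofNat ℤ n.unpair.2.unpair.2) :: l

def rawI (a : Tabs × List ℕ) (n : ℕ) : List FI := codeFold rawIStep [] a n

def rawDStep (a : Tabs × List ℕ) (n : ℕ) (_ l _ : FD × List FI) : FD × List FI :=
  if n.unpair.1 = 1 then ((2 * a.1.2.1.getD n.unpair.2 0 + 1, (0, 0), 0), [])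
  else if n.unpair.1 = 2 then ((0, (0, 0), Denumerable.ofNat ℤ n.unpair.2), [])
  else if n.unpair.1 = 3 then
    ((2 * a.1.2.2.1.getD n.unpair.2.unpair.1 0 + 2,
      (rawI a n.unpair.2.unpair.2).getD 0 (0, 0), 0), rawI a n.unpair.2.unpair.2)
  else ((l.1.1, l.1.2.1, l.1.2.2 + Denumerable.ofNat ℤ n.unpair.2.unpair.2), l.2)

def rawD (a : Tabs × List ℕ) (n : ℕ) : FD × List FI :=
  codeFold rawDStep ((0, (0, 0), 0), []) a n

def rawA (a : Tabs × List ℕ) (neg : Bool) (n : ℕ) : FAtom :=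
  let c := if neg = true then negCode n.unpair.2.unpair.1 else n.unpair.2.unpair.1
  let l := n.unpair.2.unpair.2.unpair.1
  let r := n.unpair.2.unpair.2.unpair.2
  if n.unpair.1 = 1 then
    (false, c, (0, (rawI a l).getD 0 (0, 0), 0), (0, (rawI a r).getD 0 (0, 0), 0),
      rawI a l ++ rawI a r)
  else (true, c, (rawD a l).1, (rawD a r).1, (rawD a l).2 ++ (rawD a r).2)

@[fun_prop] theorem primrec_ofNatInt {α : Type} [Primcodable α] {f : α → ℕ} (hf : Primrec f) :
    Primrec fun a => Denumerable.ofNat ℤ (f a) := (Primrec.ofNat ℤ).comp hf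

@[fun_prop] theorem primrec_rawI :
    Primrec fun p : (Tabs × List ℕ) × ℕ => rawI p.1 p.2 := by
  refine primrec_codeFold (G := rawIStep) [] ?_
  unfold rawIStep
  fun_prop

theorem primrec_cases₄ {α σ : Type} [Primcodable α] [Primcodable σ] {a₁ a₃ : α → ℕ → σ}
    {a₂ : ℕ → σ} {a₄ : ℕ → σ → σ} (h₁ : Primrec fun p : α × ℕ => a₁ p.1 p.2) (h₂ : Primrec a₂)
    (h₃ : Primrec fun p : α × ℕ => a₃ p.1 p.2) (h₄ : Primrec fun p : ℕ × σ => a₄ p.1 p.2) :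
    Primrec fun p : α × ℕ × σ × σ × σ =>
      if p.2.1.unpair.1 = 1 then a₁ p.1 p.2.1
      else if p.2.1.unpair.1 = 2 then a₂ p.2.1
      else if p.2.1.unpair.1 = 3 then a₃ p.1 p.2.1
      else a₄ p.2.1 p.2.2.2.1 := by
  have h₁' : Primrec fun p : α × ℕ × σ × σ × σ => a₁ p.1 p.2.1 :=
    h₁.comp (g := fun p : α × ℕ × σ × σ × σ => (p.1, p.2.1)) (by fun_prop)
  have h₃' : Primrec fun p : α × ℕ × σ × σ × σ => a₃ p.1 p.2.1 :=
    h₃.comp (g := fun p : α × ℕ × σ × σ × σ => (p.1, p.2.1)) (by fun_prop)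
  have h₄' : Primrec fun p : α × ℕ × σ × σ × σ => a₄ p.2.1 p.2.2.2.1 :=
    h₄.comp (g := fun p : α × ℕ × σ × σ × σ => (p.2.1, p.2.2.2.1)) (by fun_prop)
  fun_prop

@[fun_prop] theorem primrec_rawD :
    Primrec fun p : (Tabs × List ℕ) × ℕ => rawD p.1 p.2 := by
  refine primrec_codeFold (G := rawDStep) ((0, (0, 0), 0), []) ?_
  unfold rawDStep
  refine primrec_cases₄ (α := Tabs × List ℕ) (σ := FD × List FI)
    (a₁ := fun a n => ((2 * a.1.2.1.getD n.unpair.2 0 + 1, (0, 0), 0), []))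
    (a₂ := fun n => ((0, (0, 0), Denumerable.ofNat ℤ n.unpair.2), []))
    (a₃ := fun a n => ((2 * a.1.2.2.1.getD n.unpair.2.unpair.1 0 + 2,
      (rawI a n.unpair.2.unpair.2).getD 0 (0, 0), 0), rawI a n.unpair.2.unpair.2))
    (a₄ := fun n l =>
      ((l.1.1, l.1.2.1, l.1.2.2 + Denumerable.ofNat ℤ n.unpair.2.unpair.2), l.2)) ?_ ?_ ?_ ?_
  · have h : Primrec fun p : (Tabs × List ℕ) × ℕ => 2 * p.1.1.2.1.getD p.2.unpair.2 0 + 1 := by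
      fun_prop
    exact (h.pair (Primrec.const ((0, 0), 0))).pair (Primrec.const [])
  · have h : Primrec fun n : ℕ => Denumerable.ofNat ℤ n.unpair.2 := by fun_prop
    exact ((Primrec.const 0).pair ((Primrec.const (0, 0)).pair h)).pair (Primrec.const [])
  · have h : Primrec fun p : (Tabs × List ℕ) × ℕ =>
        2 * p.1.1.2.2.1.getD p.2.unpair.2.unpair.1 0 + 2 := by fun_prop
    have h' : Primrec fun p : (Tabs × List ℕ) × ℕ => rawI p.1 p.2.unpair.2.unpair.2 := by fun_prop
    have h'' : Primrec fun l : List FI => l.getD 0 (0, 0) := by fun_prop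
    exact (h.pair ((h''.comp h').pair (Primrec.const 0))).pair h'
  · have h : Primrec fun p : ℤ × ℕ => p.1 + Denumerable.ofNat ℤ p.2.unpair.2.unpair.2 := by fun_prop
    have h₁ : Primrec fun p : ℕ × FD × List FI => p.2.1 := Primrec.fst.comp Primrec.snd
    have h₂ : Primrec fun p : ℕ × FD × List FI => p.2.1.2 := Primrec.snd.comp h₁
    have h₃ : Primrec fun p : ℕ × FD × List FI => p.2.1.2.2 := Primrec.snd.comp h₂
    exact ((Primrec.fst.comp h₁).pair ((Primrec.fst.comp h₂).pair
      (h.comp (h₃.pair Primrec.fst)))).pair (Primrec.snd.comp Primrec.snd)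

@[fun_prop] theorem primrec_rawA :
    Primrec fun p : (Tabs × List ℕ) × Bool × ℕ => rawA p.1 p.2.1 p.2.2 := by
  have hi : Primrec fun p : ℕ × List FI × List FI => ((false, p.1, (0, p.2.1.getD 0 (0, 0), 0),
      (0, p.2.2.getD 0 (0, 0), 0), p.2.1 ++ p.2.2) : FAtom) := by
    have h : Primrec fun l : List FI => ((0, l.getD 0 (0, 0), 0) : FD) := by fun_prop
    have hl : Primrec fun p : ℕ × List FI × List FI => p.2.1 := Primrec.fst.comp Primrec.snd
    have hr : Primrec fun p : ℕ × List FI × List FI => p.2.2 := Primrec.snd.comp Primrec.snd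
    exact (Primrec.const false).pair (Primrec.fst.pair ((h.comp hl).pair
      ((h.comp hr).pair (Primrec.list_append.comp hl hr))))
  have hd : Primrec fun p : ℕ × (FD × List FI) × FD × List FI =>
      ((true, p.1, p.2.1.1, p.2.2.1, p.2.1.2 ++ p.2.2.2) : FAtom) := by
    have hl : Primrec fun p : ℕ × (FD × List FI) × FD × List FI => p.2.1 :=
      Primrec.fst.comp Primrec.snd
    have hr : Primrec fun p : ℕ × (FD × List FI) × FD × List FI => p.2.2 :=
      Primrec.snd.comp Primrec.snd
    exact (Primrec.const true).pair (Primrec.fst.pair ((Primrec.fst.comp hl).pair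
      ((Primrec.fst.comp hr).pair
        (Primrec.list_append.comp (Primrec.snd.comp hl) (Primrec.snd.comp hr)))))
  have hc : Primrec fun p : (Tabs × List ℕ) × Bool × ℕ =>
      if p.2.1 = true then negCode p.2.2.unpair.2.unpair.1 else p.2.2.unpair.2.unpair.1 := by
    fun_prop
  have hl : Primrec fun p : (Tabs × List ℕ) × Bool × ℕ =>
      (p.1, p.2.2.unpair.2.unpair.2.unpair.1) := by fun_prop
  have hr : Primrec fun p : (Tabs × List ℕ) × Bool × ℕ =>
      (p.1, p.2.2.unpair.2.unpair.2.unpair.2) := by fun_prop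
  have ht : Primrec fun p : (Tabs × List ℕ) × Bool × ℕ => decide (p.2.2.unpair.1 = 1) := by
    fun_prop
  exact Primrec.fun_ite ht
    (hi.comp (hc.pair ((primrec_rawI.comp hl).pair (primrec_rawI.comp hr))))
    (hd.comp (hc.pair ((primrec_rawD.comp hl).pair (primrec_rawD.comp hr))))

end Flat

/-! ### Reading terms and atoms from codes agrees with flattening -/

section RawAtoms

variable {S₀ S : Sig} {m n : ℕ} [Encodable S₀.Par] [Encodable S₀.Idx] [Encodable S₀.Dat]
  [Encodable S₀.Arr] [Encodable S.Par] [Encodable S.Idx] [Encodable S.Dat] [Encodable S.Arr]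

/-- The tables describe the map `f` of vocabularies. -/
structure TabsFor (f : Sig.Hom S₀ S) (T : Tabs) : Prop where
  int : ∀ x : S₀.Int, T.1.getD (Encodable.encode x) 0 = slotOf (S := S) (Sum.map f.par f.idx x)
  dat : ∀ x : S₀.Dat, T.2.1.getD (Encodable.encode x) 0 = Encodable.encode (f.dat x)
  arr : ∀ x : S₀.Arr, T.2.2.1.getD (Encodable.encode x) 0 = Encodable.encode (f.arr x)
  size : ∀ x : S₀.Arr,
    T.2.2.2.getD (Encodable.encode x) 0 = slotOf (S := S) (.inl (S.size (f.arr x)))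

variable {f : Sig.Hom S₀ S} {T : Tabs} {L : List ℕ} {θ : Fin m → ITerm S n} {g : Fin n → ℕ}

theorem rawI_code (hT : TabsFor f T) (hθ : ∀ i, (θ i).flats g = [(L.getD i 0, 0)])
    (t : ITerm S₀ m) : rawI (T, L) t.code = (t.map f θ).flats g := by
  have hz : ∀ c : ℤ, Denumerable.ofNat ℤ (Encodable.encode c) = c := Denumerable.ofNat_encode
  induction t with
  | var x =>
    rw [rawI, ITerm.code, codeFold_pair]
    simp only [rawIStep, Nat.unpair_pair, if_true]
    rw [hT.int]
    rfl
  | bvar i =>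
    rw [rawI, ITerm.code, codeFold_pair]
    simp only [rawIStep, Nat.unpair_pair, if_true]
    exact (hθ i).symm
  | const c =>
    rw [rawI, ITerm.code, codeFold_pair]
    simp only [rawIStep, Nat.unpair_pair, if_true, hz]
    rfl
  | size a =>
    rw [rawI, ITerm.code, codeFold_pair]
    simp only [rawIStep, Nat.unpair_pair, if_true]
    rw [hT.size]
    rfl
  | add t c ih =>
    rw [rawI, ITerm.code, codeFold_pair]
    rw [rawI] at ih
    simp only [rawIStep, Nat.unpair_pair, ih, ITerm.getD_flats, hz]
    rfl

theorem getD_rawI_code (hT : TabsFor f T) (hθ : ∀ i, (θ i).flats g = [(L.getD i 0, 0)])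
    (t : ITerm S₀ m) : (rawI (T, L) t.code).getD 0 (0, 0) = (t.map f θ).nf g := by
  rw [rawI_code hT hθ, ITerm.getD_flats]

theorem rawD_code (hT : TabsFor f T) (hθ : ∀ i, (θ i).flats g = [(L.getD i 0, 0)])
    (t : DTerm S₀ m) : rawD (T, L) t.code =
      ((t.map f θ).flat g, (t.map f θ).indexTerms.map (ITerm.nf g)) := by
  have hz : ∀ c : ℤ, Denumerable.ofNat ℤ (Encodable.encode c) = c := Denumerable.ofNat_encode
  induction t with
  | var x =>
    rw [rawD, DTerm.code, codeFold_pair]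
    simp only [rawDStep, Nat.unpair_pair, if_true]
    rw [hT.dat]
    rfl
  | const c =>
    rw [rawD, DTerm.code, codeFold_pair]
    simp only [rawDStep, Nat.unpair_pair, if_true, hz]
    rfl
  | read a t =>
    rw [rawD, DTerm.code, codeFold_pair]
    simp only [rawDStep, Nat.unpair_pair, if_true]
    rw [getD_rawI_code hT hθ, rawI_code hT hθ, hT.arr]
    rfl
  | add t c ih =>
    rw [rawD, DTerm.code, codeFold_pair]
    rw [rawD] at ih
    simp only [rawDStep, Nat.unpair_pair, ih, hz]
    rfl

theorem rawA_code (hT : TabsFor f T) (hθ : ∀ i, (θ i).flats g = [(L.getD i 0, 0)]) (neg : Bool)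
    (a : Atom S₀ m) : rawA (T, L) neg a.code =
      (if neg = true then (a.map f θ).neg else a.map f θ).flat g := by
  have key : ((if neg = true then (a.map f θ).neg else a.map f θ).flat g) =
      (((a.map f θ).flat g).1, if neg = true then negCode ((a.map f θ).flat g).2.1
        else ((a.map f θ).flat g).2.1, ((a.map f θ).flat g).2.2) := by
    cases neg
    · rfl
    · exact Atom.flat_neg g _
  rw [key]
  cases a with
  | idx l c r =>
    simp only [rawA, Atom.code, Nat.unpair_pair, if_true, rawI_code hT hθ, ITerm.getD_flats]
    rfl
  | dat l c r =>
    simp only [rawA, Atom.code, Nat.unpair_pair, rawD_code hT hθ]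
    rfl

end RawAtoms

/-! ### Prenex forms -/

namespace Flat

/-- An atom with a negation flag and the positions of its variables: first the quantified variables
of the prefix, beginning with the innermost, then the free variables. -/
abbrev Clo : Type := Bool × ℕ × List ℕ

/-- A prefix and a matrix. -/
abbrev RawPNF : Type := List Bool × List (List Clo)

def moveClo (r : ℕ → ℕ) (c : Clo) : Clo := (c.1, c.2.1, c.2.2.map r)

/-- Positions count from the innermost quantifier, and the prefix of `Y` ends up inside that of `X`.
So all positions of `X` move up by the length of `Y`'s prefix, while in `Y` only the free variables
move past the prefix of `X`. -/
def mergeRaw (d : Bool) (X Y : RawPNF) : RawPNF :=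
  (X.1 ++ Y.1, combineL d
    (X.2.map fun D => D.map fun c => moveClo (fun i => i + Y.1.length) c)
    (Y.2.map fun D => D.map fun c =>
      moveClo (fun i => if i < Y.1.length then i else i + X.1.length) c))

/-- The prenex forms of a formula and of its negation. -/
def rawFStep (B n : ℕ) (u l r : RawPNF × RawPNF) : RawPNF × RawPNF :=
  if n.unpair.1 = 1 then (([], [[(false, n.unpair.2, List.range B)]]),
    ([], [[(true, n.unpair.2, List.range B)]]))
  else if n.unpair.1 = 2 then (u.2, u.1)
  else if n.unpair.1 = 3 then (mergeRaw true l.1 r.1, mergeRaw false l.2 r.2)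
  else if n.unpair.1 = 4 then (mergeRaw false l.1 r.1, mergeRaw true l.2 r.2)
  else if n.unpair.1 = 5 then ((true :: u.1.1, u.1.2), (false :: u.2.1, u.2.2))
  else ((false :: u.1.1, u.1.2), (true :: u.2.1, u.2.2))

/-- Both polarities are computed together because negation exchanges them. `B` must be at least the
number of variables in scope at any atom, so that `List.range B` can serve there as the identity. -/
def rawF (B n : ℕ) : RawPNF × RawPNF := codeFold rawFStep (([], []), ([], [])) B n

def cloFlat (T : Tabs) (e : ℕ → ℕ) (c : Clo) : FAtom := rawA (T, c.2.2.map e) c.1 c.2.1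

@[fun_prop] theorem primrec_combineL {α : Type} [Primcodable α] :
    Primrec fun p : Bool × List (List α) × List (List α) => combineL p.1 p.2.1 p.2.2 := by
  unfold combineL
  fun_prop

theorem primrec_moveClo {α : Type} [Primcodable α] {r : α → ℕ → ℕ}
    (hr : Primrec fun p : α × ℕ => r p.1 p.2) {f : α → List (List Clo)} (hf : Primrec f) :
    Primrec fun a => (f a).map fun D => D.map fun c => moveClo (r a) c := by
  have h1 : Primrec fun p : α × Clo => moveClo (r p.1) p.2 := by
    unfold moveClo
    fun_prop
  have h2 : Primrec fun p : α × List Clo => p.2.map fun c => moveClo (r p.1) c := by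
    exact Primrec.list_map Primrec.snd (h1.comp ((Primrec.fst.comp Primrec.fst).pair Primrec.snd))
  exact Primrec.list_map hf h2

@[fun_prop] theorem primrec_mergeRaw :
    Primrec fun p : Bool × RawPNF × RawPNF => mergeRaw p.1 p.2.1 p.2.2 := by
  unfold mergeRaw
  have h1 := primrec_moveClo (r := fun (p : Bool × RawPNF × RawPNF) i => i + p.2.2.1.length)
    (by fun_prop) (f := fun p => p.2.1.2) (by fun_prop)
  have h2 := primrec_moveClo (r := fun (p : Bool × RawPNF × RawPNF) i =>
    if i < p.2.2.1.length then i else i + p.2.1.1.length) (by fun_prop) (f := fun p => p.2.2.2) (by fun_prop)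
  have h3 : Primrec fun p : Bool × RawPNF × RawPNF => p.2.1.1 ++ p.2.2.1 := by fun_prop
  exact h3.pair (primrec_combineL.comp (Primrec.fst.pair (h1.pair h2)))

theorem primrec_mergeRaw₂ (d d' : Bool) : Primrec fun p : (RawPNF × RawPNF) × RawPNF × RawPNF =>
    (mergeRaw d p.1.1 p.2.1, mergeRaw d' p.1.2 p.2.2) := by
  have h : ∀ d, Primrec fun p : RawPNF × RawPNF => mergeRaw d p.1 p.2 := fun d =>
    primrec_mergeRaw.comp ((Primrec.const d).pair Primrec.id)
  have h₁ : Primrec fun p : (RawPNF × RawPNF) × RawPNF × RawPNF => (p.1.1, p.2.1) := by fun_prop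
  have h₂ : Primrec fun p : (RawPNF × RawPNF) × RawPNF × RawPNF => (p.1.2, p.2.2) := by fun_prop
  exact ((h d).comp h₁).pair ((h d').comp h₂)

theorem primrec_consPre (b : Bool) : Primrec fun u : RawPNF => ((b :: u.1, u.2) : RawPNF) := by
  fun_prop

theorem primrec_cases₆ {α σ : Type} [Primcodable α] [Primcodable σ] {a₁ : α → ℕ → σ}
    {a₂ a₅ a₆ : σ → σ} {a₃ a₄ : σ → σ → σ} (h₁ : Primrec fun p : α × ℕ => a₁ p.1 p.2)
    (h₂ : Primrec a₂) (h₃ : Primrec fun p : σ × σ => a₃ p.1 p.2)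
    (h₄ : Primrec fun p : σ × σ => a₄ p.1 p.2) (h₅ : Primrec a₅) (h₆ : Primrec a₆) :
    Primrec fun p : α × ℕ × σ × σ × σ =>
      if p.2.1.unpair.1 = 1 then a₁ p.1 p.2.1
      else if p.2.1.unpair.1 = 2 then a₂ p.2.2.1
      else if p.2.1.unpair.1 = 3 then a₃ p.2.2.2.1 p.2.2.2.2
      else if p.2.1.unpair.1 = 4 then a₄ p.2.2.2.1 p.2.2.2.2
      else if p.2.1.unpair.1 = 5 then a₅ p.2.2.1 else a₆ p.2.2.1 := by
  have h₁' : Primrec fun p : α × ℕ × σ × σ × σ => a₁ p.1 p.2.1 :=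
    h₁.comp (g := fun p : α × ℕ × σ × σ × σ => (p.1, p.2.1)) (by fun_prop)
  have h₃' : Primrec fun p : α × ℕ × σ × σ × σ => a₃ p.2.2.2.1 p.2.2.2.2 :=
    h₃.comp (g := fun p : α × ℕ × σ × σ × σ => p.2.2.2) (by fun_prop)
  have h₄' : Primrec fun p : α × ℕ × σ × σ × σ => a₄ p.2.2.2.1 p.2.2.2.2 :=
    h₄.comp (g := fun p : α × ℕ × σ × σ × σ => p.2.2.2) (by fun_prop)
  fun_prop

@[fun_prop] theorem primrec_rawF : Primrec fun p : ℕ × ℕ => rawF p.1 p.2 := by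
  refine primrec_codeFold (G := rawFStep) (([], []), ([], [])) ?_
  unfold rawFStep
  refine primrec_cases₆ (α := ℕ) (σ := RawPNF × RawPNF)
    (a₁ := fun B n => (([], [[(false, n.unpair.2, List.range B)]]),
      ([], [[(true, n.unpair.2, List.range B)]])))
    (a₂ := fun u => (u.2, u.1)) (a₃ := fun l r => (mergeRaw true l.1 r.1, mergeRaw false l.2 r.2))
    (a₄ := fun l r => (mergeRaw false l.1 r.1, mergeRaw true l.2 r.2))
    (a₅ := fun u => ((true :: u.1.1, u.1.2), (false :: u.2.1, u.2.2)))
    (a₆ := fun u => ((false :: u.1.1, u.1.2), (true :: u.2.1, u.2.2)))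
    ?_ (Primrec.snd.pair Primrec.fst) (primrec_mergeRaw₂ true false) (primrec_mergeRaw₂ false true)
    ((primrec_consPre true).comp Primrec.fst |>.pair <| (primrec_consPre false).comp Primrec.snd)
    ((primrec_consPre false).comp Primrec.fst |>.pair <| (primrec_consPre true).comp Primrec.snd)
  have h : ∀ b : Bool, Primrec fun p : ℕ × ℕ =>
      (([], [[(b, p.2.unpair.2, List.range p.1)]]) : RawPNF) := fun b => by fun_prop
  exact (h false).pair (h true)

theorem cloFlat_moveClo (T : Tabs) (e r : ℕ → ℕ) (c : Clo) :
    cloFlat T e (moveClo r c) = cloFlat T (fun i => e (r i)) c := by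
  simp only [cloFlat, moveClo, List.map_map]
  rfl

end Flat

/-! ### Reading prenex forms from codes agrees with the typed prenex form -/

section RawFormulas

variable {S₀ S : Sig} [Encodable S₀.Par] [Encodable S₀.Idx] [Encodable S₀.Dat]
  [Encodable S₀.Arr] [Encodable S.Par] [Encodable S.Idx] [Encodable S.Dat] [Encodable S.Arr]

/-- `R` represents the prenex formula `F`, if `C g h` says that the free variables of the code have
the slots `h`, where the free variables of `F` have the slots `g`. -/
def Represents (T : Tabs) {n : ℕ} (C : (Fin n → ℕ) → (ℕ → ℕ) → Prop) (R : RawPNF)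
    (F : PNF S n) : Prop :=
  F.flatPre = R.1 ∧ ∀ (g : Fin n → ℕ) (j : ℕ) (e : ℕ → ℕ),
    (∀ i < R.1.length, e i = j + (R.1.length - 1 - i)) → C g (fun i => e (i + R.1.length)) →
      F.flatMat g j = R.2.map fun D => D.map (cloFlat T e)

/-- The assignment of slots to the merged prefix restricts, along the two shifts of `mergeRaw`, to
the assignments of the parts: the left prefix starts at `j`, the right one after it. On the free
variables both restrictions are the same. -/
theorem Represents.merge {T : Tabs} {n : ℕ} {C : (Fin n → ℕ) → (ℕ → ℕ) → Prop} {R R' : RawPNF}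
    {F F' : PNF S n} (d : Bool) (h : Represents T C R F) (h' : Represents T C R' F') :
    Represents T C (mergeRaw d R R') (PNF.merge d F F') := by
  have hm := PNF.flat_merge d F F'
  refine ⟨?_, fun g j e he hC => ?_⟩
  · rw [(hm (fun _ => 0) 0).1, h.1, h'.1]
    rfl
  · have hlen : (mergeRaw d R R').1.length = R.1.length + R'.1.length := List.length_append
    rw [hlen] at he hC
    rw [(hm g j).2, h.1]
    have e₁ := h.2 g j (fun i => e (i + R'.1.length))
      (fun i hi => (he _ (by omega)).trans (by omega))
      (by
        refine cast (congrArg (C g) (funext fun i => ?_)) hC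
        rw [add_assoc])
    have e₂ := h'.2 g (j + R.1.length)
      (fun i => e (if i < R'.1.length then i else i + R.1.length))
      (fun i hi => by
        rw [if_pos hi, he _ (by omega)]
        omega)
      (by
        refine cast (congrArg (C g) (funext fun i => ?_)) hC
        rw [if_neg (by omega)]
        congr 1
        omega)
    rw [e₁, e₂]
    simp only [mergeRaw]
    have := combineL_map (cloFlat T e) d
      (R.2.map fun D => D.map fun c => moveClo (fun i => i + R'.1.length) c)
      (R'.2.map fun D => D.map fun c =>
        moveClo (fun i => if i < R'.1.length then i else i + R.1.length) c)
    refine Eq.trans ?_ this.symm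
    simp only [List.map_map, Function.comp_def, cloFlat_moveClo]

theorem Represents.quant {T : Tabs} {n : ℕ} {C : (Fin n → ℕ) → (ℕ → ℕ) → Prop}
    {C' : (Fin (n + 1) → ℕ) → (ℕ → ℕ) → Prop} {R : RawPNF} {F : PNF S (n + 1)}
    (h : Represents T C' R F) (e : Bool)
    (hC : ∀ g j h, C g (fun i => h (i + 1)) → h 0 = j → C' (Fin.cons j g) h) :
    Represents T C (e :: R.1, R.2) (PNF.quant e F) := by
  refine ⟨congrArg (e :: ·) h.1, fun g j ε hε hCε => ?_⟩
  rw [List.length_cons] at hε hCε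
  refine h.2 (Fin.cons j g) (j + 1) ε (fun i hi => ?_) (hC g j _ ?_ ?_)
  · rw [hε i (by omega)]
    omega
  · refine cast (congrArg (C g) (funext fun i => ?_)) hCε
    congr 1
    omega
  · rw [hε _ (by omega)]
    omega

/-- The invariant `m + F.code ≤ B` passes under a quantifier because the number of variables grows
by one and the code drops by at least one. At an atom it ensures that `List.range B` covers all
variables. -/
theorem represents_rawF {f : Sig.Hom S₀ S} {T : Tabs} (hT : TabsFor f T) (B : ℕ) :
    ∀ {m : ℕ} (F : Fml S₀ m), m + F.code ≤ B → ∀ {n : ℕ} (θ : Fin m → ITerm S n),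
      Represents T (fun g h => ∀ i, (θ i).flats g = [(h i, 0)]) (rawF B F.code).1
        ((F.map f θ).toPNF true) ∧
      Represents T (fun g h => ∀ i, (θ i).flats g = [(h i, 0)]) (rawF B F.code).2
        ((F.map f θ).toPNF false) := by
  have hpair : ∀ t u : ℕ, u < Nat.pair (t + 1) u := by
    intro t u
    have := Nat.add_le_pair (t + 1) u
    omega
  have hlift : ∀ {m n : ℕ} (θ : Fin m → ITerm S n) (g : Fin n → ℕ) (j : ℕ) (h : ℕ → ℕ),
      (∀ i : Fin m, (θ i).flats g = [(h (i + 1), 0)]) → h 0 = j →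
        ∀ i, (ITerm.lift θ i).flats (Fin.cons j g : Fin (n + 1) → ℕ) = [(h i, 0)] := by
    intro m n θ g j h hθ h0 i
    rw [ITerm.flats_lift (h := fun i => h (i + 1)) hθ j i]
    refine Fin.cases ?_ (fun i => ?_) i
    · rw [Fin.cons_zero, ← h0]
      rfl
    · rw [Fin.cons_succ]
      rfl
  intro m F
  induction F with
  | atom a =>
    intro hB n θ
    have hrec : rawF B (Fml.atom a).code = (([], [[(false, a.code, List.range B)]]),
        ([], [[(true, a.code, List.range B)]])) := by
      rw [rawF, Fml.code, codeFold_pair]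
      simp only [rawFStep, Nat.unpair_pair, if_true]
    rw [hrec]
    have key : ∀ neg : Bool, Represents T (fun g h => ∀ i, (θ i).flats g = [(h i, 0)])
        ([], [[(neg, a.code, List.range B)]])
        (.mat [[if neg = true then (a.map f θ).neg else a.map f θ]]) := by
      intro neg
      refine ⟨rfl, fun g j e he hC => ?_⟩
      simp only [PNF.flatMat, List.map_cons, List.map_nil, cloFlat]
      rw [rawA_code hT (θ := θ) (g := g)]
      intro i
      rw [hC i, getD_map_range, if_pos (by have := i.2; omega)]
      rfl
    exact ⟨key false, key true⟩
  | not F ih =>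
    intro hB n θ
    have hlt : F.code < Nat.pair 2 F.code := hpair 1 _
    have hrec : rawF B F.not.code = ((rawF B F.code).2, (rawF B F.code).1) := by
      rw [rawF, Fml.code, codeFold_pair]
      simp only [rawFStep, Nat.unpair_pair]
      rfl
    rw [hrec]
    simp only [Fml.code] at hB
    obtain ⟨h₁, h₂⟩ := ih (by omega) θ
    exact ⟨h₂, h₁⟩
  | or F G ihF ihG =>
    intro hB n θ
    have hlt : Nat.pair F.code G.code < Nat.pair 3 (Nat.pair F.code G.code) :=
      hpair 2 _
    have hl := Nat.left_le_pair F.code G.code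
    have hr := Nat.right_le_pair F.code G.code
    have hrec : rawF B (F.or G).code =
        (mergeRaw true (rawF B F.code).1 (rawF B G.code).1,
          mergeRaw false (rawF B F.code).2 (rawF B G.code).2) := by
      rw [rawF, Fml.code, codeFold_pair]
      simp only [rawFStep, Nat.unpair_pair]
      rfl
    rw [hrec]
    simp only [Fml.code] at hB
    obtain ⟨h₁, h₂⟩ := ihF (by omega) θ
    obtain ⟨h₃, h₄⟩ := ihG (by omega) θ
    exact ⟨h₁.merge true h₃, h₂.merge false h₄⟩
  | and F G ihF ihG =>
    intro hB n θ
    have hlt : Nat.pair F.code G.code < Nat.pair 4 (Nat.pair F.code G.code) :=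
      hpair 3 _
    have hl := Nat.left_le_pair F.code G.code
    have hr := Nat.right_le_pair F.code G.code
    have hrec : rawF B (F.and G).code =
        (mergeRaw false (rawF B F.code).1 (rawF B G.code).1,
          mergeRaw true (rawF B F.code).2 (rawF B G.code).2) := by
      rw [rawF, Fml.code, codeFold_pair]
      simp only [rawFStep, Nat.unpair_pair]
      rfl
    rw [hrec]
    simp only [Fml.code] at hB
    obtain ⟨h₁, h₂⟩ := ihF (by omega) θ
    obtain ⟨h₃, h₄⟩ := ihG (by omega) θ
    exact ⟨h₁.merge false h₃, h₂.merge true h₄⟩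
  | ex F ih =>
    intro hB n θ
    have hlt : F.code < Nat.pair 5 F.code := hpair 4 _
    have hrec : rawF B F.ex.code = ((true :: (rawF B F.code).1.1, (rawF B F.code).1.2),
        (false :: (rawF B F.code).2.1, (rawF B F.code).2.2)) := by
      rw [rawF, Fml.code, codeFold_pair]
      simp only [rawFStep, Nat.unpair_pair]
      rfl
    rw [hrec]
    simp only [Fml.code] at hB
    obtain ⟨h₁, h₂⟩ := ih (by omega) (ITerm.lift θ)
    exact ⟨h₁.quant true (hlift θ), h₂.quant false (hlift θ)⟩
  | all F ih =>
    intro hB n θ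
    have hlt : F.code < Nat.pair 6 F.code := hpair 5 _
    have hrec : rawF B F.all.code = ((false :: (rawF B F.code).1.1, (rawF B F.code).1.2),
        (true :: (rawF B F.code).2.1, (rawF B F.code).2.2)) := by
      rw [rawF, Fml.code, codeFold_pair]
      simp only [rawFStep, Nat.unpair_pair]
      rfl
    rw [hrec]
    simp only [Fml.code] at hB
    obtain ⟨h₁, h₂⟩ := ih (by omega) (ITerm.lift θ)
    exact ⟨h₁.quant false (hlift θ), h₂.quant true (hlift θ)⟩

end RawFormulas


/-! ## Abstraction in terms of satisfiability -/

section Satisfiability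

variable {S : Sig} {K : Type} {n : ℕ}

/-- The set of all literals that fail at `a` is itself a candidate clause. If `h` were inconsistent
with the bits of the word, this clause would follow from `h`, although none of its literals holds at
`a`. Conversely, a model consistent with the bits makes some literal of each implied clause true,
and that literal holds at `a`. The model is independent of the index values of `a`. -/
theorem kappaConstr_iff {P : K → Atom S 1} {h : List (Atom S n)} {a : AbsState S K}
    {b : Fin n → ℕ} : kappaConstr P h a b ↔ ∃ (s : State S) (b' : Fin n → ℕ),
      (∀ A ∈ h, A.eval s b') ∧ ∀ t ∈ termsOf P h, 1 ≤ t.eval a.1 b → t.eval a.1 b ≤ a.2.length →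
        ∀ k, ((P k).inst t).eval s b' ↔ letterAt a.2 (t.eval a.1 b - 1).toNat k = true := by
  constructor
  · intro hκ
    by_contra hno
    push Not at hno
    obtain ⟨l, hl, hl'⟩ := hκ {l | l.2.1 ∈ termsOf P h ∧ ¬ kappaLit a b l} (fun l hl => hl.1) (by
      intro s b' hs
      obtain ⟨t, ht, h₁, h₂, k, hk⟩ := hno s b' hs
      rcases hk with ⟨hk, hk'⟩ | ⟨hk, hk'⟩
      · exact ⟨(k, t, true), ⟨ht, fun hc => hk' (hc h₁ h₂)⟩, by simpa using hk⟩
      · exact ⟨(k, t, false), ⟨ht, fun hc => by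
          have := hc h₁ h₂
          simp only at this
          rw [hk'] at this
          exact absurd this (by simp)⟩, by simpa using hk⟩)
    exact hl.2 hl'
  · rintro ⟨s, b', hs, ht⟩ C hC hval
    obtain ⟨l, hl, hl'⟩ := hval s b' hs
    refine ⟨l, hl, fun h₁ h₂ => ?_⟩
    rw [Bool.eq_iff_iff, ← ht _ (hC l hl) h₁ h₂, hl']

end Satisfiability

/-! ## Typed and untyped semantics -/

section Agreement

variable {S : Sig} {K : Type} {n : ℕ} [Encodable S.Par] [Encodable S.Idx] [Encodable S.Dat]
  [Encodable S.Arr]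

/-- The slots of the further free variables. -/
structure Slots (S : Sig) [Encodable S.Par] [Encodable S.Idx] (g : Fin n → ℕ) : Prop where
  two_le : ∀ i, 2 ≤ g i
  inj : Function.Injective g
  ne : ∀ i (x : S.Int), g i ≠ slotOf x

theorem slotOf_injective : Function.Injective (slotOf (S := S)) := fun _ _ h =>
  Encodable.encode_injective (Nat.add_right_cancel h)

structure IntAgree (g : Fin n → ℕ) (t : S.Int → ℕ) (b : Fin n → ℕ) (v : ℕ → ℤ) : Prop where
  zero : v 0 = 0
  var : ∀ x : S.Int, v (slotOf x) = t x
  bvar : ∀ i, v (g i) = b i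

structure Agree (g : Fin n → ℕ) (s : State S) (b : Fin n → ℕ) (v : ℕ → ℤ) (A : ℕ → ℤ → ℤ) :
    Prop where
  int : IntAgree g s.int b v
  zero : ∀ z, A 0 z = 0
  dat : ∀ x, A (2 * Encodable.encode x + 1) 0 = s.dat x
  arr : ∀ x, A (2 * Encodable.encode x + 2) = s.arr x

variable {g : Fin n → ℕ}

theorem IntAgree.eval {t : S.Int → ℕ} {b : Fin n → ℕ} {v : ℕ → ℤ} (h : IntAgree g t b v)
    (u : ITerm S n) : fiEval v (u.nf g) = u.eval t b := by
  induction u with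
  | var x => simp [fiEval, ITerm.nf, ITerm.eval, h.var]
  | bvar i => simp [fiEval, ITerm.nf, ITerm.eval, h.bvar]
  | const c => simp [fiEval, ITerm.nf, ITerm.eval, h.zero]
  | size a => simp [fiEval, ITerm.nf, ITerm.eval, h.var]
  | add u c ih => rw [ITerm.eval, ← ih]; simp [fiEval, ITerm.nf, add_assoc]

theorem Agree.evalD {s : State S} {b : Fin n → ℕ} {v : ℕ → ℤ} {A : ℕ → ℤ → ℤ}
    (h : Agree g s b v A) (d : DTerm S n) : fdEval v A true (d.flat g) = d.eval s b := by
  induction d with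
  | var x => simp [fdEval, fiEval, DTerm.flat, DTerm.eval, h.dat, h.int.zero]
  | const c => simp [fdEval, fiEval, DTerm.flat, DTerm.eval, h.zero]
  | read a t => simp [fdEval, DTerm.flat, DTerm.eval, h.arr, h.int.eval]
  | add d c ih => rw [DTerm.eval, ← ih]; simp [fdEval, DTerm.flat, add_assoc]

theorem cmpB_code (c : Cmp) (x y : ℤ) : cmpB c.code x y = true ↔ c.holds x y := by
  cases c <;> simp [cmpB, Cmp.code, Cmp.holds]

theorem IntAgree.eval_idx {t : S.Int → ℕ} {b : Fin n → ℕ} {v : ℕ → ℤ} (h : IntAgree g t b v)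
    (A : ℕ → ℤ → ℤ) (l : ITerm S n) (c : Cmp) (r : ITerm S n) :
    faEval v A ((Atom.idx l c r).flat g) = true ↔ c.holds (l.eval t b) (r.eval t b) := by
  rw [← cmpB_code, ← h.eval, ← h.eval]
  simp [faEval, Atom.flat, fdEval]

theorem Agree.eval {s : State S} {b : Fin n → ℕ} {v : ℕ → ℤ} {A : ℕ → ℤ → ℤ}
    (h : Agree g s b v A) (a : Atom S n) : faEval v A (a.flat g) = true ↔ a.eval s b := by
  cases a with
  | idx l c r => exact h.int.eval_idx A l c r
  | dat l c r =>
    rw [Atom.eval, ← cmpB_code, ← h.evalD, ← h.evalD]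
    rfl

/-- Slots of different variables are distinct and avoid 0, and parity separates data variables from
arrays, so the required values can be prescribed independently. -/
theorem Slots.exists_agree (hg : Slots S g) (s : State S) (b : Fin n → ℕ) :
    ∃ v A, IsModel v A ∧ Agree g s b v A := by
  refine ⟨Function.extend slotOf (fun x => (s.int x : ℤ))
      (Function.extend g (fun i => (b i : ℤ)) 0),
    fun i => if i = 0 then 0 else if i % 2 = 1 then
      (Function.extend Encodable.encode (fun x z => s.dat x) 0 : ℕ → ℤ → ℤ) (i / 2)
      else (Function.extend Encodable.encode s.arr 0 : ℕ → ℤ → ℤ) (i / 2 - 1), ?_, ?_⟩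
  · refine ⟨?_, fun j => ?_, fun z => rfl⟩
    · rw [Function.extend_apply' _ _ _ (by rintro ⟨x, hx⟩; simp [slotOf] at hx),
        Function.extend_apply' _ _ _ (by rintro ⟨x, hx⟩; have := hg.two_le x; omega)]
      rfl
    · by_cases hj : ∃ x : S.Int, slotOf x = j
      · obtain ⟨x, rfl⟩ := hj
        rw [slotOf_injective.extend_apply]
        positivity
      · rw [Function.extend_apply' _ _ _ hj]
        by_cases hj : ∃ i, g i = j
        · obtain ⟨x, rfl⟩ := hj
          rw [hg.inj.extend_apply]
          positivity
        · rw [Function.extend_apply' _ _ _ hj]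
          rfl
  · refine ⟨⟨?_, fun x => slotOf_injective.extend_apply _ _ _, fun i => ?_⟩, fun z => rfl,
      fun x => ?_, fun x => ?_⟩
    · rw [Function.extend_apply' _ _ _ (by rintro ⟨x, hx⟩; simp [slotOf] at hx),
        Function.extend_apply' _ _ _ (by rintro ⟨x, hx⟩; have := hg.two_le x; omega)]
      rfl
    · rw [Function.extend_apply' _ _ _ (by rintro ⟨x, hx⟩; exact hg.ne i x hx.symm),
        hg.inj.extend_apply]
    · rw [if_neg (by omega), if_pos (by omega), show (2 * Encodable.encode x + 1) / 2 =
        Encodable.encode x by omega, Encodable.encode_injective.extend_apply]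
    · rw [if_neg (by omega), if_neg (by omega), show (2 * Encodable.encode x + 2) / 2 - 1 =
        Encodable.encode x by omega, Encodable.encode_injective.extend_apply]

theorem exists_agree_of_isModel (g : Fin n → ℕ) {v : ℕ → ℤ} {A : ℕ → ℤ → ℤ} (h : IsModel v A) :
    ∃ (s : State S) (b : Fin n → ℕ), Agree g s b v A :=
  ⟨⟨fun x => (v (slotOf x)).toNat, fun x => A (2 * Encodable.encode x + 1) 0,
    fun x => A (2 * Encodable.encode x + 2)⟩, fun i => (v (g i)).toNat,
    ⟨h.1, fun x => (Int.toNat_of_nonneg (h.2.1 _)).symm,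
      fun i => (Int.toNat_of_nonneg (h.2.1 _)).symm⟩, h.2.2, fun _ => rfl, fun _ => rfl⟩

/-- Typed and untyped interpretations have agreeing counterparts in both directions, so
satisfiability transfers. -/
theorem Slots.exists_model_iff (hg : Slots S g) {p : (ℕ → ℤ) → (ℕ → ℤ → ℤ) → Prop}
    {q : State S → (Fin n → ℕ) → Prop} (h : ∀ s b v A, Agree g s b v A → (p v A ↔ q s b)) :
    (∃ v A, IsModel v A ∧ p v A) ↔ ∃ s b, q s b := by
  constructor
  · rintro ⟨v, A, hM, hp⟩
    obtain ⟨s, b, hs⟩ := exists_agree_of_isModel (S := S) g hM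
    exact ⟨s, b, (h _ _ _ _ hs).1 hp⟩
  · rintro ⟨s, b, hq⟩
    obtain ⟨v, A, hM, hs⟩ := hg.exists_agree s b
    exact ⟨v, A, hM, (h _ _ _ _ hs).2 hq⟩

/-! ### Instances of predicates -/

theorem ITerm.nf_inst (u : ITerm S 1) (t : ITerm S n) :
    (u.inst t).nf g = instFI (t.nf g) (u.nf fun _ => 1) := by
  induction u with
  | var x =>
    have : slotOf x ≠ 1 := by simp [slotOf]
    rcases x with x | x <;> simp [ITerm.inst, ITerm.map, ITerm.nf, instFI, this] <;> rfl
  | bvar i => simp [ITerm.inst, ITerm.map, ITerm.nf, instFI]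
  | const c => simp [ITerm.inst, ITerm.map, ITerm.nf, instFI]
  | size a =>
    have : slotOf (S := S) (.inl (S.size a)) ≠ 1 := by simp [slotOf]
    simp [ITerm.inst, ITerm.map, ITerm.nf, instFI, this]
    rfl
  | add u c ih =>
    rw [ITerm.inst] at ih
    simp only [ITerm.inst, ITerm.map, ITerm.nf, ih, instFI]
    by_cases h : (u.nf fun _ => 1).1 = 1 <;> simp [h, add_assoc]

theorem ITerm.bvars_eq_nil (u : ITerm S 1) : u.bvars = [] ↔ (u.nf fun _ => 1).1 ≠ 1 := by
  induction u with
  | var x => simp [ITerm.bvars, ITerm.nf, slotOf]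
  | bvar i => simp [ITerm.bvars, ITerm.nf]
  | const c => simp [ITerm.bvars, ITerm.nf]
  | size a => simp [ITerm.bvars, ITerm.nf, slotOf]
  | add u c ih => exact ih

theorem DTerm.flat_inst (v : ℕ → ℤ) (A : ℕ → ℤ → ℤ) (u : DTerm S 1) (t : ITerm S n) :
    fdEval v A true ((u.map (Sig.Hom.id S) fun _ => t).flat g) =
      fdEval v A true (instFD (t.nf g) (u.flat fun _ => 1)) := by
  induction u with
  | var x => rfl
  | const c => rfl
  | read a u =>
    have := ITerm.nf_inst (g := g) u t
    rw [ITerm.inst] at this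
    simp only [DTerm.map, DTerm.flat, this]
    rfl
  | add u c ih =>
    simp only [fdEval, DTerm.map, DTerm.flat, instFD, if_true] at ih ⊢
    omega

theorem faEval_litFA (v : ℕ → ℤ) (A : ℕ → ℤ → ℤ) (bit : Bool) (t : ITerm S n) (a : Atom S 1) :
    faEval v A (litFA bit (t.nf g) (a.flat fun _ => 1)) =
      (faEval v A ((a.inst t).flat g) == bit) := by
  cases a with
  | idx l c r =>
    have hl := ITerm.nf_inst (g := g) l t
    have hr := ITerm.nf_inst (g := g) r t
    rw [ITerm.inst] at hl hr
    simp only [faEval, litFA, Atom.inst, Atom.map, Atom.flat, instFD, hl, hr]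
    cases bit
    · simp [cmpB_negCode]
    · simp
  | dat l c r =>
    have hl := DTerm.flat_inst v A (g := g) l t
    have hr := DTerm.flat_inst v A (g := g) r t
    simp only [faEval, litFA, Atom.inst, Atom.map, Atom.flat] at hl hr ⊢
    rw [hl, hr]
    cases bit
    · simp [cmpB_negCode]
    · simp

theorem Atom.flat_fst (a : Atom S n) : (a.flat g).1 = a.isDat := by cases a <;> rfl

theorem Atom.flat_terms (a : Atom S n) : (a.flat g).2.2.2.2 = a.indexTerms.map (ITerm.nf g) := by
  cases a <;> simp [Atom.flat, Atom.indexTerms, ITerm.flats]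

/-- `L` lists the predicates `P`, in the order given by `num`. -/
structure ListsPreds (P : K → Atom S 1) (num : K → ℕ) (L : List FAtom) : Prop where
  lt : ∀ k, num k < L.length
  getD : ∀ k, L.getD (num k) default = (P k).flat fun _ => 1
  surj : ∀ i < L.length, ∃ k, num k = i

theorem ListsPreds.mem_iff {P : K → Atom S 1} {num : K → ℕ} {L : List FAtom} (hL : ListsPreds P num L)
    {a : FAtom} : a ∈ L ↔ ∃ k, (P k).flat (fun _ => 1) = a := by
  constructor
  · intro ha
    obtain ⟨i, hi, rfl⟩ := List.getElem_of_mem ha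
    obtain ⟨k, rfl⟩ := hL.surj i hi
    refine ⟨k, ?_⟩
    rw [← hL.getD k, List.getD_eq_getElem _ _ hi]
  · rintro ⟨k, rfl⟩
    rw [← hL.getD k, List.getD_eq_getElem _ _ (hL.lt k)]
    exact List.getElem_mem _

theorem mem_termsFA {P : K → Atom S 1} {num : K → ℕ} {L : List FAtom} (hL : ListsPreds P num L)
    (c : List (Atom S n)) (τ : FI) : τ ∈ termsFA L (c.map (Atom.flat g)) ↔
      ∃ t ∈ termsOf P (c.filter Atom.isDat), t.nf g = τ := by
  have hh : ∀ τ, τ ∈ ((c.map (Atom.flat g)).filter fun a => a.1).flatMap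
      (fun a : FAtom => a.2.2.2.2) ↔
      ∃ a ∈ c.filter Atom.isDat, ∃ t ∈ a.indexTerms, t.nf g = τ := by
    intro τ
    simp only [List.mem_flatMap, List.mem_filter, List.mem_map]
    constructor
    · rintro ⟨_, ⟨⟨a, ha, rfl⟩, ha'⟩, h⟩
      rw [Atom.flat_fst] at ha'
      rw [Atom.flat_terms] at h
      exact ⟨a, ⟨ha, ha'⟩, List.mem_map.1 h⟩
    · rintro ⟨a, ⟨ha, ha'⟩, h⟩
      refine ⟨_, ⟨⟨a, ha, rfl⟩, ?_⟩, ?_⟩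
      · rw [Atom.flat_fst, ha']
      · rw [Atom.flat_terms]
        exact List.mem_map.2 h
  have hp : ∀ u, u ∈ L.flatMap (fun a : FAtom => a.2.2.2.2) ↔
      ∃ k, ∃ t ∈ (P k).indexTerms, t.nf (fun _ => 1) = u := by
    intro u
    rw [List.mem_flatMap]
    constructor
    · rintro ⟨a, ha, h⟩
      obtain ⟨k, rfl⟩ := hL.mem_iff.1 ha
      rw [Atom.flat_terms] at h
      exact ⟨k, List.mem_map.1 h⟩
    · rintro ⟨k, h⟩
      refine ⟨_, hL.mem_iff.2 ⟨k, rfl⟩, ?_⟩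
      rw [Atom.flat_terms]
      exact List.mem_map.2 h
  simp only [termsFA, List.mem_append, hh, List.mem_flatMap (l := L.flatMap _), hp]
  constructor
  · rintro (⟨a, ha, t, ht, rfl⟩ | ⟨_, ⟨k, u, hu, rfl⟩, h⟩)
    · exact ⟨t, Or.inl ⟨a, ha, ht⟩, rfl⟩
    · split_ifs at h with h1
      · obtain ⟨τ', hτ', rfl⟩ := List.mem_map.1 h
        obtain ⟨a, ha, t, ht, rfl⟩ := (hh τ').1 hτ'
        exact ⟨u.inst t, Or.inr ⟨k, u, hu, Or.inr ⟨a, ha, t, ht, rfl⟩⟩, u.nf_inst t⟩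
      · obtain rfl := List.mem_singleton.1 h
        refine ⟨u.inst (.const 0), Or.inr ⟨k, u, hu, Or.inl ⟨u.bvars_eq_nil.2 h1, rfl⟩⟩, ?_⟩
        rw [u.nf_inst, instFI, if_neg h1]
  · rintro ⟨t, ⟨a, ha, ht⟩ | ⟨k, u, hu, ⟨hu', rfl⟩ | ⟨a, ha, t', ht', rfl⟩⟩, rfl⟩
    · exact Or.inl ⟨a, ha, t, ht, rfl⟩
    · refine Or.inr ⟨_, ⟨k, u, hu, rfl⟩, ?_⟩
      have h1 := u.bvars_eq_nil.1 hu'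
      rw [if_neg h1, u.nf_inst, instFI, if_neg h1]
      exact List.mem_singleton_self _
    · by_cases h1 : (u.nf fun _ => 1).1 = 1
      · refine Or.inr ⟨_, ⟨k, u, hu, rfl⟩, ?_⟩
        rw [if_pos h1, u.nf_inst]
        exact List.mem_map_of_mem ((hh _).2 ⟨a, ha, t', ht', rfl⟩)
      · refine Or.inr ⟨_, ⟨k, u, hu, rfl⟩, ?_⟩
        rw [if_neg h1, u.nf_inst, instFI, if_neg h1]
        exact List.mem_singleton_self _

/-! ### Prenex formulae -/

/-- `(v, W)` represents the abstract state `a`. -/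
structure Codes (num : K → ℕ) (pars : List ℕ) (a : AbsState S K) (v : ℕ → ℕ) (W : ℕ → ℕ → Bool) :
    Prop where
  zero : v 0 = 0
  var : ∀ x : S.Int, v (slotOf x) = a.1 x
  len : maxVal pars v = a.2.length
  bit : ∀ i k, W i (num k) = letterAt a.2 i k

theorem satB_constraints {P : K → Atom S 1} {num : K → ℕ} {L : List FAtom} (hL : ListsPreds P num L)
    (hg : Slots S g) {pars : List ℕ} {a : AbsState S K} {v : ℕ → ℕ} {W : ℕ → ℕ → Bool}
    {b : Fin n → ℕ} (ha : Codes num pars a v W) (hv : IntAgree g a.1 b (intVal v))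
    (c : List (Atom S n)) : satB (constraints L pars v W (c.map (Atom.flat g))) = true ↔
      kappaConstr P (c.filter Atom.isDat) a b := by
  rw [satB_iff, kappaConstr_iff, Sat]
  refine hg.exists_model_iff fun s b' v' A h => ?_
  simp only [constraints, List.mem_append, or_imp, forall_and]
  refine and_congr ?_ ?_
  · simp only [List.mem_filter, List.mem_map]
    constructor
    · rintro h' A ⟨hA, hA'⟩
      exact (h.eval A).1 (h' _ ⟨⟨A, hA, rfl⟩, by rw [Atom.flat_fst, hA']⟩)
    · rintro h' _ ⟨⟨A, hA, rfl⟩, hA'⟩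
      rw [Atom.flat_fst] at hA'
      exact (h.eval A).2 (h' _ ⟨hA, hA'⟩)
  · have key : ∀ (t : ITerm S n) (k : K),
        faEval v' A (litFA (W (t.eval a.1 b - 1).toNat (num k)) (t.nf g)
          (L.getD (num k) default)) = true ↔
        (((P k).inst t).eval s b' ↔ letterAt a.2 (t.eval a.1 b - 1).toNat k = true) := by
      intro t k
      rw [hL.getD, faEval_litFA, ← h.eval, ha.bit, beq_iff_eq, Bool.eq_iff_iff]
    constructor
    · intro h' t ht h₁ h₂ k
      rw [← key]
      refine h' _ (List.mem_flatMap.2 ⟨t.nf g, (mem_termsFA hL c _).2 ⟨t, ht, rfl⟩, ?_⟩)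
      rw [hv.eval, if_pos (by rw [ha.len]; simp [h₁, h₂])]
      exact List.mem_map.2 ⟨num k, List.mem_range.2 (hL.lt k), rfl⟩
    · intro h' x hx
      obtain ⟨τ, hτ, hx⟩ := List.mem_flatMap.1 hx
      obtain ⟨t, ht, rfl⟩ := (mem_termsFA hL c _).1 hτ
      rw [hv.eval, ha.len] at hx
      split_ifs at hx with hcond
      · obtain ⟨i, hi, rfl⟩ := List.mem_map.1 hx
        obtain ⟨k, rfl⟩ := hL.surj i (List.mem_range.1 hi)
        rw [Bool.and_eq_true, decide_eq_true_eq, decide_eq_true_eq] at hcond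
        exact (key t k).2 (h' t ht hcond.1 hcond.2 k)
      · simp at hx

theorem matB_iff {P : K → Atom S 1} {num : K → ℕ} {L : List FAtom} (hL : ListsPreds P num L)
    (hg : Slots S g) {pars : List ℕ} {a : AbsState S K} {v : ℕ → ℕ} {W : ℕ → ℕ → Bool}
    {b : Fin n → ℕ} (ha : Codes num pars a v W) (hv : IntAgree g a.1 b (intVal v))
    (D : List (List (Atom S n))) :
    matB (D.map fun c => c.map (Atom.flat g)) L pars v W = true ↔
      (PNF.mat D).absEval P a b := by
  simp only [matB, PNF.absEval, List.any_map, List.any_eq_true, Function.comp_apply,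
    Bool.and_eq_true, satB_constraints hL hg ha hv, List.all_map, List.all_eq_true]
  refine exists_congr fun c => and_congr_right fun _ => and_congr_left fun _ => ?_
  refine forall₂_congr fun A _ => ?_
  cases A with
  | idx l c r =>
    rw [Atom.keep, ← hv.eval_idx (fun _ _ => 0)]
    rw [Atom.flat_fst]
    exact Iff.rfl
  | dat l c r => simp [Atom.keep, Atom.flat_fst, Atom.isDat]

/-- The next slot `j` stays above all slots in use, so assigning a value to it disturbs neither the
vocabulary nor the outer variables. -/
theorem absEval_iff {P : K → Atom S 1} {num : K → ℕ} {L : List FAtom} (hL : ListsPreds P num L)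
    {pars : List ℕ} {a : AbsState S K} {W : ℕ → ℕ → Bool} {n : ℕ} (F : PNF S n) :
    ∀ {g : Fin n → ℕ} (_ : Slots S g) {b : Fin n → ℕ} {v : ℕ → ℕ} (_ : Codes num pars a v W)
      (_ : IntAgree g a.1 b (intVal v)) {j : ℕ} (_ : 2 ≤ j) (_ : ∀ x : S.Int, slotOf x < j)
      (_ : ∀ i, g i < j) (_ : ∀ p ∈ pars, p < j),
      evalPre (fun v => matB (F.flatMat g j) L pars v W = true) F.flatPre j v ↔
        F.absEval P a b := by
  induction F with
  | mat D => exact fun {_} hg {_} {_} ha hv {_} _ _ _ _ => matB_iff hL hg ha hv D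
  | @quant n e F ih =>
    intro g hg b v ha hv j hj hs hgj hp
    have hg' : Slots S (Fin.cons j g : Fin (n + 1) → ℕ) := by
      refine ⟨Fin.cases hj hg.two_le, ?_, Fin.cases (fun x => (hs x).ne') hg.ne⟩
      rw [Fin.cons_injective_iff]
      refine ⟨?_, hg.inj⟩
      rintro ⟨i, hi⟩
      exact (hgj i).ne hi
    have key : ∀ x, evalPre (fun v => matB (F.flatMat (Fin.cons j g) (j + 1)) L pars v W = true)
        F.flatPre (j + 1) (Function.update v j x) ↔ F.absEval P a (Fin.cons x b) := by
      intro x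
      refine ih hg' ⟨?_, fun y => ?_, ?_, ha.bit⟩ ⟨?_, fun y => ?_, ?_⟩ (by omega)
        (fun y => (hs y).trans (by omega)) ?_ (fun p hp' => (hp p hp').trans (by omega))
      · rw [Function.update_of_ne (by omega), ha.zero]
      · rw [Function.update_of_ne (hs y).ne, ha.var]
      · rw [← ha.len, maxVal, maxVal]
        congr 1
        exact List.map_congr_left fun p hp' => Function.update_of_ne (hp p hp').ne _ _
      · rw [intVal, Function.update_of_ne (by omega), ha.zero]
        rfl
      · rw [intVal, Function.update_of_ne (hs y).ne, ha.var]
      · refine Fin.cases ?_ fun i => ?_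
        · simp [intVal]
        · have := hv.bvar i
          simp only [intVal, Fin.cons_succ] at this ⊢
          rw [Function.update_of_ne (hgj i).ne, this]
      · exact Fin.cases (by simp) fun i => (hgj i).trans (by omega)
    cases e
    · exact forall_congr' key
    · exact exists_congr key

end Agreement


/-! ## Semantics of substitutions and prenex forms -/

section Substitution

variable {S S' : Sig}

/-- `s` is the reduct of `s'` along `f`. -/
structure IsReduct (f : Sig.Hom S S') (s : State S) (s' : State S') : Prop where
  int : ∀ x, s'.int (Sum.map f.par f.idx x) = s.int x
  dat : ∀ x, s'.dat (f.dat x) = s.dat x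
  arr : ∀ x, s'.arr (f.arr x) = s.arr x

theorem IsReduct.refl (s : State S) : IsReduct (Sig.Hom.id S) s s :=
  ⟨by rintro (x | x) <;> rfl, fun _ => rfl, fun _ => rfl⟩

variable {f : Sig.Hom S S'} {s : State S} {s' : State S'} {n n' : ℕ}

theorem ITerm.eval_map (h : IsReduct f s s') {θ : Fin n → ITerm S' n'} {b : Fin n → ℕ}
    {b' : Fin n' → ℕ} (hθ : ∀ i, (θ i).eval s'.int b' = b i) (t : ITerm S n) :
    (t.map f θ).eval s'.int b' = t.eval s.int b := by
  induction t with
  | var x => simp [ITerm.map, ITerm.eval, h.int]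
  | bvar i => exact hθ i
  | const c => rfl
  | size a =>
    have := h.int (.inl (S.size a))
    rw [Sum.map_inl] at this
    simp [ITerm.map, ITerm.eval, f.size_arr, this]
  | add t c ih => simp [ITerm.map, ITerm.eval, ih]

theorem DTerm.eval_map (h : IsReduct f s s') {θ : Fin n → ITerm S' n'} {b : Fin n → ℕ}
    {b' : Fin n' → ℕ} (hθ : ∀ i, (θ i).eval s'.int b' = b i) (t : DTerm S n) :
    (t.map f θ).eval s' b' = t.eval s b := by
  induction t with
  | var x => simp [DTerm.map, DTerm.eval, h.dat]
  | const c => rfl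
  | read a t => simp [DTerm.map, DTerm.eval, h.arr, ITerm.eval_map h hθ]
  | add t c ih => simp [DTerm.map, DTerm.eval, ih]

theorem Atom.eval_map (h : IsReduct f s s') {θ : Fin n → ITerm S' n'} {b : Fin n → ℕ}
    {b' : Fin n' → ℕ} (hθ : ∀ i, (θ i).eval s'.int b' = b i) (a : Atom S n) :
    (a.map f θ).eval s' b' ↔ a.eval s b := by
  cases a with
  | idx l c r => simp only [Atom.map, Atom.eval, ITerm.eval_map h hθ]
  | dat l c r => simp only [Atom.map, Atom.eval, DTerm.eval_map h hθ]

theorem ITerm.eval_lift {θ : Fin n → ITerm S n'} {b : Fin n → ℕ} {b' : Fin n' → ℕ}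
    (hθ : ∀ i, (θ i).eval s.int b' = b i) (x : ℕ) (i : Fin (n + 1)) :
    (ITerm.lift θ i).eval s.int (Fin.cons x b') = (Fin.cons x b : Fin (n + 1) → ℕ) i := by
  refine Fin.cases rfl (fun i => ?_) i
  rw [ITerm.lift, Fin.cons_succ, Fin.cons_succ,
    ITerm.eval_map (IsReduct.refl s) (b := b') fun j => rfl, hθ]

theorem Fml.eval_map (h : IsReduct f s s') (F : Fml S n) :
    ∀ {n' : ℕ} {θ : Fin n → ITerm S' n'} {b : Fin n → ℕ} {b' : Fin n' → ℕ}
      (_ : ∀ i, (θ i).eval s'.int b' = b i), (F.map f θ).eval s' b' ↔ F.eval s b := by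
  induction F with
  | atom a => exact fun hθ => Atom.eval_map h hθ a
  | not F ih => exact fun hθ => not_congr (ih hθ)
  | or F G ihF ihG => exact fun hθ => or_congr (ihF hθ) (ihG hθ)
  | and F G ihF ihG => exact fun hθ => and_congr (ihF hθ) (ihG hθ)
  | ex F ih => exact fun hθ => exists_congr fun x => ih (ITerm.eval_lift hθ x)
  | all F ih => exact fun hθ => forall_congr' fun x => ih (ITerm.eval_lift hθ x)

end Substitution

/-! ### Prenex forms preserve the meaning of formulae -/

section Prenex

variable {S : Sig} {s : State S} {n : ℕ}

def PNF.eval (s : State S) : {n : ℕ} → (Fin n → ℕ) → PNF S n → Prop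
  | _, b, .mat D => ∃ c ∈ D, ∀ A ∈ c, A.eval s b
  | _, b, .quant true F => ∃ x : ℕ, F.eval s (Fin.cons x b)
  | _, b, .quant false F => ∀ x : ℕ, F.eval s (Fin.cons x b)

theorem PNF.eval_map (F : PNF S n) : ∀ {n' : ℕ} {θ : Fin n → ITerm S n'} {b : Fin n → ℕ}
    {b' : Fin n' → ℕ} (_ : ∀ i, (θ i).eval s.int b' = b i),
    (F.map θ).eval s b' ↔ F.eval s b := by
  induction F with
  | mat D =>
    intro n' θ b b' hθ
    simp [PNF.map, PNF.eval, Atom.eval_map (IsReduct.refl s) hθ]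
  | quant e F ih =>
    intro n' θ b b' hθ
    cases e
    · exact forall_congr' fun x => ih (ITerm.eval_lift hθ x)
    · exact exists_congr fun x => ih (ITerm.eval_lift hθ x)

/-- Disjunction (`d = true`) or conjunction (`d = false`). -/
def junct (d : Bool) (p q : Prop) : Prop := if d = true then p ∨ q else p ∧ q

/-- Moving a quantifier across a disjunction or conjunction uses that the domain, here `ℕ`, is
nonempty. -/
theorem junct_exists {α : Type} [Nonempty α] (d : Bool) (p : α → Prop) (q : Prop) :
    (∃ x, junct d (p x) q) ↔ junct d (∃ x, p x) q := by
  cases d <;> simp [junct, exists_or, exists_and_right]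

theorem junct_forall {α : Type} [Nonempty α] (d : Bool) (p : α → Prop) (q : Prop) :
    (∀ x, junct d (p x) q) ↔ junct d (∀ x, p x) q := by
  cases d
  · simp [junct, forall_and]
  · simp only [junct, if_true]
    exact forall_or_right

theorem junct_comm (d : Bool) (p q : Prop) : junct d p q ↔ junct d q p := by
  cases d
  · exact and_comm
  · exact or_comm

theorem eval_combine (d : Bool) (D E : List (List (Atom S n))) (b : Fin n → ℕ) :
    (PNF.mat (combine d D E)).eval s b ↔
      junct d ((PNF.mat D).eval s b) ((PNF.mat E).eval s b) := by
  cases d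
  · simp only [combine, PNF.eval, junct, Bool.false_eq_true, if_false, List.mem_flatMap,
      List.mem_map]
    constructor
    · rintro ⟨_, ⟨c, hc, c', hc', rfl⟩, h⟩
      exact ⟨⟨c, hc, fun A hA => h A (List.mem_append_left _ hA)⟩,
        c', hc', fun A hA => h A (List.mem_append_right _ hA)⟩
    · rintro ⟨⟨c, hc, h⟩, c', hc', h'⟩
      exact ⟨_, ⟨c, hc, c', hc', rfl⟩, fun A hA => (List.mem_append.1 hA).elim (h A) (h' A)⟩
  · simp only [combine, PNF.eval, junct, if_true, List.mem_append, or_and_right, exists_or]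

theorem PNF.eval_mergeMat (d : Bool) (F : PNF S n) : ∀ (D : List (List (Atom S n)))
    (b : Fin n → ℕ), (F.mergeMat d D).eval s b ↔
      junct d ((PNF.mat D).eval s b) (F.eval s b) := by
  induction F with
  | mat E => exact fun D b => eval_combine d D E b
  | quant e F ih =>
    intro D b
    have hw : ∀ x, (PNF.mat (weakenMat D)).eval s (Fin.cons x b) ↔ (PNF.mat D).eval s b := by
      intro x
      exact PNF.eval_map (.mat D) (θ := fun i => .bvar i.succ) fun i => by simp [ITerm.eval]
    rw [junct_comm]
    cases e
    · refine Iff.trans ?_ (junct_forall d _ _)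
      exact forall_congr' fun x => by rw [ih, junct_comm, hw]
    · refine Iff.trans ?_ (junct_exists d _ _)
      exact exists_congr fun x => by rw [ih, junct_comm, hw]

theorem PNF.eval_merge (d : Bool) (F : PNF S n) : ∀ (G : PNF S n) (b : Fin n → ℕ),
    (F.merge d G).eval s b ↔ junct d (F.eval s b) (G.eval s b) := by
  induction F with
  | mat D => exact fun G b => PNF.eval_mergeMat d G D b
  | quant e F ih =>
    intro G b
    have hw : ∀ x, (G.map fun i => .bvar i.succ).eval s (Fin.cons x b) ↔ G.eval s b := by
      intro x
      exact PNF.eval_map G fun i => by simp [ITerm.eval]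
    cases e
    · refine Iff.trans ?_ (junct_forall d _ _)
      exact forall_congr' fun x => by rw [ih, hw]
    · refine Iff.trans ?_ (junct_exists d _ _)
      exact exists_congr fun x => by rw [ih, hw]

theorem Atom.eval_neg (a : Atom S n) (b : Fin n → ℕ) : a.neg.eval s b ↔ ¬ a.eval s b := by
  cases a with
  | idx l c r => cases c <;> simp [Atom.neg, Atom.eval, Cmp.neg, Cmp.holds]
  | dat l c r => cases c <;> simp [Atom.neg, Atom.eval, Cmp.neg, Cmp.holds]

theorem Fml.eval_toPNF (F : Fml S n) : ∀ (b : Fin n → ℕ),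
    ((F.toPNF true).eval s b ↔ F.eval s b) ∧ ((F.toPNF false).eval s b ↔ ¬ F.eval s b) := by
  induction F with
  | atom a =>
    intro b
    simp [Fml.toPNF, PNF.eval, Fml.eval, Atom.eval_neg]
  | not F ih =>
    intro b
    exact ⟨(ih b).2, (ih b).1.trans not_not.symm⟩
  | or F G ihF ihG =>
    intro b
    constructor
    · exact (PNF.eval_merge _ _ _ b).trans (or_congr (ihF b).1 (ihG b).1)
    · exact (PNF.eval_merge _ _ _ b).trans ((and_congr (ihF b).2 (ihG b).2).trans not_or.symm)
  | and F G ihF ihG =>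
    intro b
    constructor
    · exact (PNF.eval_merge _ _ _ b).trans (and_congr (ihF b).1 (ihG b).1)
    · exact (PNF.eval_merge _ _ _ b).trans
        ((or_congr (ihF b).2 (ihG b).2).trans not_and_or.symm)
  | ex F ih =>
    intro b
    constructor
    · exact exists_congr fun x => (ih _).1
    · exact (forall_congr' fun x => (ih _).2).trans not_exists.symm
  | all F ih =>
    intro b
    constructor
    · exact forall_congr' fun x => (ih _).1
    · exact (exists_congr fun x => (ih _).2).trans not_forall.symm

end Prenex

/-! ## The abstractions are sound -/

section Soundness

variable {S : Sig} {K : Type} {n : ℕ}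

/-- Index expressions keep their values, and for the data expressions the encoded state `s` itself
is the model that `kappaConstr_iff` asks for. -/
theorem PNF.absEval_of_eval {P : K → Atom S 1} {a : AbsState S K} {s : State S} (hs : a.1 = s.int)
    (he : Encodes P s a.2) (F : PNF S n) :
    ∀ b : Fin n → ℕ, F.eval s b → F.absEval P a b := by
  induction F with
  | mat D =>
    rintro b ⟨c, hc, h⟩
    refine ⟨c, hc, fun A hA => ?_, kappaConstr_iff.2 ⟨s, b, fun A hA => h A
      (List.mem_filter.1 hA).1, fun t _ h₁ h₂ k => ?_⟩⟩
    · have := h A hA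
      cases A with
      | idx l c r =>
        rw [Atom.keep, hs]
        exact this
      | dat l c r => trivial
    -- The letter at the 0-based position `t - 1` records the predicates at the index `t`.
    · rw [← he _ (by omega) k]
      refine Atom.eval_map (IsReduct.refl s) (fun _ => ?_) _
      rw [← hs]
      push_cast
      omega
  | quant e F ih =>
    intro b
    cases e
    · exact fun h x => ih _ (h x)
    · exact fun ⟨x, h⟩ => ⟨x, ih _ h⟩

theorem alpha_subset_abs (P : K → Atom S 1) (F : Fml S 0) : alpha P F.sem ⊆ F.abs P := by
  rintro a ⟨s, hs, h₁, h₂, h₃⟩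
  exact ⟨h₂, PNF.absEval_of_eval h₁ h₃ _ _ ((Fml.eval_toPNF F _).1.2 hs)⟩

/-- The parameters have the same values in both components. -/
theorem AbsState.proper_tau {a a' : AbsState S K} (h : AbsState.Proper a)
    (h' : AbsState.Proper a') (hp : ∀ p : S.Par, a'.1 (.inl p) = a.1 (.inl p)) :
    a'.2.length = a.2.length ∧ AbsState.Proper (tau (a, a')) := by
  have hlen : a'.2.length = a.2.length := by
    rw [h, h']
    exact congrArg _ (funext hp)
  refine ⟨hlen, ?_⟩
  unfold AbsState.Proper
  simp only [tau, convolve, List.length_map, List.length_range, hlen, max_self]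
  exact h

theorem letterAt_map {K' : Type} (w : List (K → Bool)) (f : (K → Bool) → K' → Bool) {i : ℕ}
    (hi : i < w.length) : letterAt (w.map f) i = f (letterAt w i) := by
  simp [letterAt, hi]

theorem letterAt_convolve (u v : List (K → Bool)) (i : ℕ) :
    letterAt (convolve u v) i = Sum.elim (letterAt u i) (letterAt v i) := by
  by_cases hi : i < max u.length v.length
  · simp [letterAt, convolve, hi]
  · have h₁ : ¬ i < u.length := fun h => hi (lt_max_of_lt_left h)
    have h₂ : ¬ i < v.length := fun h => hi (lt_max_of_lt_right h)
    funext k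
    rcases k with k | k <;> simp [letterAt, convolve, hi, h₁, h₂]

theorem list_ext_letterAt {u v : List (K → Bool)} (hlen : u.length = v.length)
    (h : ∀ i < u.length, letterAt u i = letterAt v i) : u = v := by
  refine List.ext_getElem hlen fun i h₁ h₂ => ?_
  have := h i h₁
  simpa [letterAt, h₁, h₂] using this

/-- The components of an abstract state of the vocabulary `V ⊎ V'`. -/
def AbsState.fst (a : AbsState S.trans (K ⊕ K)) : AbsState S K :=
  (Sum.elim (fun p => a.1 (.inl p)) fun x => a.1 (.inr (.inl x)), a.2.map fun l k => l (.inl k))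

def AbsState.snd (a : AbsState S.trans (K ⊕ K)) : AbsState S K :=
  (Sum.elim (fun p => a.1 (.inl p)) fun x => a.1 (.inr (.inr x)), a.2.map fun l k => l (.inr k))

/-- Parameters are shared and letters over `K ⊕ K` split into two halves of the same length, so
every abstract state of the doubled vocabulary comes from a pair. -/
theorem AbsState.tau_fst_snd (a : AbsState S.trans (K ⊕ K)) :
    tau (AbsState.fst a, AbsState.snd a) = a := by
  refine Prod.ext (funext ?_) (list_ext_letterAt
    (by simp [tau, convolve, AbsState.fst, AbsState.snd]) fun i hi => ?_)
  · rintro (p | x | x) <;> rfl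
  · have hi' : i < a.2.length := by simpa [tau, convolve, AbsState.fst, AbsState.snd] using hi
    refine (letterAt_convolve _ _ i).trans ?_
    rw [AbsState.fst, AbsState.snd, letterAt_map _ _ hi', letterAt_map _ _ hi']
    funext k
    rcases k with k | k <;> rfl

theorem alpha_subset_tau (P : K → Atom S 1) (F : Fml S.trans 0) :
    alpha (primePreds P) F.sem ⊆ tau '' F.absTrans P := by
  intro a ha
  have hP : AbsState.Proper a := ha.choose_spec.2.2.1
  refine ⟨(AbsState.fst a, AbsState.snd a), ⟨List.length_map _ |>.trans hP,
    List.length_map _ |>.trans hP, fun p => rfl, ?_⟩, AbsState.tau_fst_snd a⟩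
  rw [AbsState.tau_fst_snd]
  exact alpha_subset_abs _ _ ha

open Classical in
/-- The abstraction of a state. -/
noncomputable def absOf (P : K → Atom S 1) (s : State S) : AbsState S K :=
  (s.int, (List.range (Finset.univ.sup fun p : S.Par => s.int (.inl p))).map fun i k =>
    decide ((P k).eval s fun _ => i + 1))

theorem absOf_proper (P : K → Atom S 1) (s : State S) : AbsState.Proper (absOf P s) := by
  simp [AbsState.Proper, absOf]

theorem encodes_absOf (P : K → Atom S 1) (s : State S) : Encodes P s (absOf P s).2 := by
  intro i hi k
  have hi' : i < Finset.univ.sup fun p : S.Par => s.int (.inl p) := by simpa [absOf] using hi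
  simp [absOf, letterAt, hi']

theorem absOf_mem_abs {P : K → Atom S 1} {F : Fml S 0} {s : State S} (h : s ∈ F.sem) :
    absOf P s ∈ F.abs P :=
  alpha_subset_abs P F ⟨s, h, rfl, absOf_proper P s, encodes_absOf P s⟩

theorem isReduct_unprimed (s t : State S) : IsReduct S.unprimed s (s.join t) :=
  ⟨by rintro (x | x) <;> rfl, fun _ => rfl, fun _ => rfl⟩

theorem isReduct_primed {s t : State S} (h : ∀ p : S.Par, t.int (.inl p) = s.int (.inl p)) :
    IsReduct S.primed t (s.join t) :=
  ⟨by rintro (x | x); exacts [(h x).symm, rfl], fun _ => rfl, fun _ => rfl⟩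

/-- Equal parameters give words of equal length, so `tau` of the two abstractions is an abstraction
of `s.join t`, and soundness for single states applies. -/
theorem absOf_mem_absTrans {P : K → Atom S 1} {F : Fml S.trans 0} {s t : State S}
    (hp : ∀ p : S.Par, t.int (.inl p) = s.int (.inl p)) (h : s.join t ∈ F.sem) :
    (absOf P s, absOf P t) ∈ F.absTrans P := by
  obtain ⟨hlen, hproper⟩ := AbsState.proper_tau (absOf_proper P s) (absOf_proper P t) hp
  refine ⟨absOf_proper P s, absOf_proper P t, hp, alpha_subset_abs _ _
    ⟨s.join t, h, ?_, hproper, fun i hi k => ?_⟩⟩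
  · funext x
    rcases x with x | x | x <;> rfl
  · have hi' : i < (absOf P s).2.length := by
      simpa [tau, convolve, hlen] using hi
    rw [show letterAt (tau (absOf P s, absOf P t)).2 i = _ from letterAt_convolve _ _ i]
    rcases k with k | k
    · rw [Sum.elim_inl, ← encodes_absOf P s i hi' k]
      exact Atom.eval_map (isReduct_unprimed s t) (fun _ => rfl) _
    · rw [Sum.elim_inr, ← encodes_absOf P t i (hlen ▸ hi') k]
      exact Atom.eval_map (isReduct_primed hp) (fun _ => rfl) _

end Soundness

/-! ## Liveness -/

section Liveness

variable {S : Sig}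

theorem TFml.evalAt_alls {s : ℕ → State S} {N : ℕ∞} {i : ℕ} {k : ℕ} (F : TFml S k) :
    (TFml.alls k F).evalAt s N Fin.elim0 i ↔ ∀ b, F.evalAt s N b i := by
  induction k with
  | zero =>
    refine ⟨fun h b => ?_, fun h => h _⟩
    rwa [Subsingleton.elim b Fin.elim0]
  | succ k ih =>
    refine (ih F.all).trans ⟨fun h b => ?_, fun h b x => h _⟩
    rw [← Fin.cons_self_tail b]
    exact h _ _

/-- The expansion of a state by values of the fresh parameters. -/
def State.star {k : ℕ} (s : State S) (c : Fin k → ℕ) : State (S.star k) where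
  int := Sum.elim (Sum.elim (fun p => s.int (.inl p)) c) fun x => s.int (.inr x)
  dat := s.dat
  arr := s.arr

theorem isReduct_toStar {k : ℕ} (s : State S) (c : Fin k → ℕ) :
    IsReduct (S.toStar k) s (s.star c) :=
  ⟨by rintro (x | x) <;> rfl, fun _ => rfl, fun _ => rfl⟩

theorem isReduct_transToStar {k : ℕ} (s t : State S) (c : Fin k → ℕ) :
    IsReduct (S.transToStar k) (s.join t) ((s.star c).join (t.star c)) :=
  ⟨by rintro (x | x | x) <;> rfl, by rintro (x | x) <;> rfl, by rintro (x | x) <;> rfl⟩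

end Liveness

/-! ### Abstract paths from concrete counterexamples -/

namespace Problem

variable (x : Problem)

theorem skolem_eval (ψ : Fml x.V.sig x.prop.k) (s : State x.V.sig) (c : Fin x.prop.k → ℕ) :
    (s.star c) ∈ (x.skolem ψ).sem ↔ ψ.eval s c :=
  Fml.eval_map (isReduct_toStar s c) ψ fun _ => rfl

/-- A path that satisfies the negation of the liveness property gives an abstract path. -/
theorem exists_abstract_path {s : ℕ → State x.V.sig} {N : ℕ∞} (hs : x.sys.IsMaxPath s N)
    (hN : N = ⊤) (hsat : x.prop.toTFml.not.Sat s N) :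
    ∃ π : ℕ → x.Abs, π 0 ∈ x.relI ∧ (∀ i, (π i, π (i + 1)) ∈ x.relT) ∧ ∀ i, π i ∈ x.relE := by
  subst hN
  have h : ¬ (TFml.alls x.prop.k (.or (.base x.prop.pre.not)
    (.eventually (.base x.prop.post)))).evalAt s ⊤ Fin.elim0 0 := hsat
  rw [TFml.evalAt_alls] at h
  push Not at h
  -- The index values `c` that violate the property become the values of the fresh parameters,
  -- constant along the whole path.
  obtain ⟨c, hc⟩ := h
  simp only [TFml.evalAt, Fml.eval, not_or, not_not, not_exists, not_and] at hc
  refine ⟨fun i => absOf x.preds ((s i).star c), absOf_mem_abs ⟨?_, ?_⟩, fun i => ?_,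
    fun i => absOf_mem_abs fun h => ?_⟩
  · exact (Fml.eval_map (isReduct_toStar (s 0) c) _ fun i => i.elim0).2 hs.1.1
  · exact (x.skolem_eval _ _ _).2 hc.1
  · obtain ⟨hp, ht⟩ := hs.1.2 i le_top
    refine absOf_mem_absTrans ?_ ?_
    · rintro (p | p)
      · exact hp p
      · rfl
    · exact (Fml.eval_map (isReduct_transToStar (s i) (s (i + 1)) c) _ fun i => i.elim0).2 ht
  · exact hc.2 i (Nat.zero_le _) le_top ((x.skolem_eval _ _ _).1 h)

end Problem


/-! ## Words that represent abstract states -/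

section Words

variable {S : Sig} {K : Type} [Encodable S.Par] [Encodable S.Idx] [Encodable S.Dat]
  [Encodable S.Arr]

/-- The valuation of the slots given by an abstract state. -/
noncomputable def slotVal (a : AbsState S K) : ℕ → ℕ := Function.extend slotOf a.1 fun _ => 0

noncomputable def slotBit (num : K → ℕ) (a : AbsState S K) (i : ℕ) : ℕ → Bool :=
  Function.extend num (letterAt a.2 i) fun _ => false

noncomputable def absWord (num : K → ℕ) (l : Layout) (a : AbsState S K) : List (List Bool) :=
  wordOf l (slotVal a) (slotBit num a)

/-- The columns are those of the variables and the predicates; `pars` are the parameters. -/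
structure LayoutFor (S : Sig) [Encodable S.Par] [Encodable S.Idx] (num : K → ℕ) (l : Layout)
    (pars : List ℕ) : Prop where
  slots : ∀ j, j ∈ numSlots l ↔ ∃ x : S.Int, slotOf x = j
  cols : ∀ k, (false, k) ∈ l ↔ ∃ κ, num κ = k
  pars : ∀ j, j ∈ pars ↔ ∃ p : S.Par, slotOf (S := S) (.inl p) = j
  inj : Function.Injective num

variable {num : K → ℕ} {l : Layout} {pars : List ℕ}

theorem slotVal_slotOf (a : AbsState S K) (x : S.Int) : slotVal a (slotOf x) = a.1 x :=
  slotOf_injective.extend_apply _ _ _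

theorem slotVal_zero (a : AbsState S K) : slotVal a 0 = 0 :=
  Function.extend_apply' _ _ _ (by rintro ⟨x, hx⟩; simp [slotOf] at hx)

namespace LayoutFor

variable (hl : LayoutFor S num l pars)
include hl

theorem slotBit_num (a : AbsState S K) (i : ℕ) (k : K) :
    slotBit num a i (num k) = letterAt a.2 i k := hl.inj.extend_apply _ _ _

theorem pars_subset : ∀ p ∈ pars, p ∈ numSlots l := fun p hp =>
  have ⟨q, hq⟩ := (hl.pars p).1 hp
  (hl.slots p).2 ⟨_, hq⟩

theorem maxVal_pars {v : ℕ → ℕ} :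
    maxVal pars v = Finset.univ.sup fun p : S.Par => v (slotOf (S := S) (.inl p)) := by
  refine eq_of_forall_lt_iff fun n => ?_
  rw [lt_maxVal_iff, Finset.lt_sup_iff]
  constructor
  · rintro ⟨p, hp, h⟩
    obtain ⟨q, rfl⟩ := (hl.pars p).1 hp
    exact ⟨q, Finset.mem_univ _, h⟩
  · rintro ⟨q, -, h⟩
    exact ⟨_, (hl.pars _).2 ⟨q, rfl⟩, h⟩

theorem maxVal_slotVal {a : AbsState S K} (ha : AbsState.Proper a) :
    maxVal pars (slotVal a) = a.2.length := by
  rw [hl.maxVal_pars, ha]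
  simp only [slotVal_slotOf]

theorem codes {a : AbsState S K} (ha : AbsState.Proper a) :
    Codes num pars a (slotVal a) (slotBit num a) :=
  ⟨slotVal_zero a, slotVal_slotOf a, hl.maxVal_slotVal ha, hl.slotBit_num a⟩

theorem lt_of_slotBit {a : AbsState S K} (ha : AbsState.Proper a) {i k : ℕ}
    (h : slotBit num a i k = true) : i < maxVal pars (slotVal a) ∧ (false, k) ∈ l := by
  by_cases hk : ∃ κ, num κ = k
  · refine ⟨?_, (hl.cols k).2 hk⟩
    obtain ⟨κ, rfl⟩ := hk
    rw [hl.maxVal_slotVal ha]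
    by_contra hi
    rw [hl.slotBit_num, letterAt, List.getElem?_eq_none (not_lt.1 hi)] at h
    exact absurd h (by simp)
  · rw [slotBit, Function.extend_apply' _ _ _ hk] at h
    exact absurd h (by simp)

theorem dec_absWord {a : AbsState S K} (ha : AbsState.Proper a) :
    decV l (absWord num l a) = slotVal a ∧ decW l (absWord num l a) = slotBit num a := by
  constructor
  · refine decV_wordOf _ fun j hj => Function.extend_apply' _ _ _ fun h => hj ((hl.slots j).2 h)
  · refine decW_wordOf fun i k h => ?_
    obtain ⟨h₁, h₂⟩ := hl.lt_of_slotBit ha h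
    exact ⟨h₁.trans_le (maxVal_le fun p hp => le_maxVal (hl.pars_subset p hp)), h₂⟩

theorem absWord_injOn {a a' : AbsState S K} (ha : AbsState.Proper a) (ha' : AbsState.Proper a')
    (h : absWord num l a = absWord num l a') : a = a' := by
  have hv : slotVal a = slotVal a' := by
    rw [← (hl.dec_absWord ha).1, h, (hl.dec_absWord ha').1]
  have hw : slotBit num a = slotBit num a' := by
    rw [← (hl.dec_absWord ha).2, h, (hl.dec_absWord ha').2]
  refine Prod.ext (funext fun x => ?_) (list_ext_letterAt ?_ fun i _ => funext fun k => ?_)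
  · rw [← slotVal_slotOf, hv, slotVal_slotOf]
  · rw [← hl.maxVal_slotVal ha, hv, hl.maxVal_slotVal ha']
  · rw [← hl.slotBit_num, hw, hl.slotBit_num]

theorem exists_absState {v : ℕ → ℕ} {W : ℕ → ℕ → Bool} (hv : ∀ j, j ∉ numSlots l → v j = 0)
    (hW : ∀ i k, W i k = true → i < maxVal pars v ∧ (false, k) ∈ l) :
    ∃ a : AbsState S K, AbsState.Proper a ∧ slotVal a = v ∧ slotBit num a = W := by
  refine ⟨(fun x => v (slotOf x), (List.range (maxVal pars v)).map fun i κ => W i (num κ)),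
    ?_, ?_, ?_⟩
  · simp [AbsState.Proper, hl.maxVal_pars]
  · funext j
    by_cases hj : ∃ x : S.Int, slotOf x = j
    · obtain ⟨x, rfl⟩ := hj
      exact slotVal_slotOf _ x
    · rw [slotVal, Function.extend_apply' _ _ _ hj, hv j fun h => hj ((hl.slots j).1 h)]
  · have hf : ∀ i k, ¬ (i < maxVal pars v ∧ (false, k) ∈ l) → W i k = false := by
      intro i k h
      by_contra hne
      exact h (hW i k (by simpa using hne))
    funext i k
    by_cases hk : ∃ κ, num κ = k
    · obtain ⟨κ, rfl⟩ := hk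
      rw [hl.slotBit_num]
      by_cases hi : i < maxVal pars v
      · simp [letterAt, hi]
      · rw [hf i _ fun h => hi h.1]
        simp [letterAt, hi]
    · rw [slotBit, Function.extend_apply' _ _ _ hk, hf i k fun h => hk ((hl.cols k).1 h.2)]

/-- The values and bits decoded from a representation vanish outside the columns, and support by the
parameters bounds the positions of the bits. So they are the data of a proper abstract state, whose
word is the given one. -/
theorem wordLang_eq (X : (ℕ → ℕ) → (ℕ → ℕ → Bool) → Prop) : wordLang l pars X =
    absWord num l '' {a : AbsState S K | AbsState.Proper a ∧ X (slotVal a) (slotBit num a)} := by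
  ext u
  constructor
  · rintro ⟨h₁, h₂, h₃⟩
    have hcol : ∀ i k, decW l u i k = true → (false, k) ∈ l := by
      intro i k h
      by_contra hk
      rw [← h₁] at h
      rw [decW, colBit, wordOf, getD_map_range, List.idxOf_eq_length hk,
        List.getD_eq_getElem?_getD, List.getElem?_eq_none] at h
      · exact absurd h (by simp)
      · split_ifs <;> simp [letterOf]
    obtain ⟨a, ha, hv, hW⟩ := hl.exists_absState
      (fun j hj => decV_eq_zero hj (wordOf_dec_iff.1 h₁).1)
      fun i k h => ⟨h₂ i k h, hcol i k h⟩
    refine ⟨a, ⟨ha, ?_⟩, ?_⟩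
    · rwa [hv, hW]
    · rw [absWord, hv, hW, h₁]
  · rintro ⟨a, ⟨ha, hX⟩, rfl⟩
    obtain ⟨hv, hW⟩ := hl.dec_absWord ha
    refine ⟨?_, ?_, ?_⟩
    · rw [hv, hW]
      rfl
    · rw [hv, hW]
      exact fun i k h => (hl.lt_of_slotBit ha h).1
    · rwa [hv, hW]

end LayoutFor

/-! ### Specifications of abstractions -/

/-- The slots of the variables of a prefix of length `Q`, then those of the fresh parameters. -/
def slotEnv (Q j i : ℕ) : ℕ := if i < Q then j + (Q - 1 - i) else 4 * (i - Q) + 4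

/-- The specification of the abstraction of the formula that `R` represents. -/
def specOf (neg : Bool) (T : Tabs) (R : RawPNF) (L : List FAtom) (j : ℕ) (pars : List ℕ)
    (l : Layout) : Spec :=
  (neg, R.1, R.2.map fun D => D.map (cloFlat T (slotEnv R.1.length j)), L, j, pars, l)

variable {T : Tabs} {R : RawPNF} {L : List FAtom} {j : ℕ} {P : K → Atom S 1} {F : PNF S 0}
  {C : (Fin 0 → ℕ) → (ℕ → ℕ) → Prop}

theorem LayoutFor.wellFormed (hl : LayoutFor S num l pars) (hj : ∀ x : S.Int, slotOf x < j)
    (hj2 : 2 ≤ j) (neg : Bool) : (specOf neg T R L j pars l).WellFormed := by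
  refine ⟨hl.pars_subset, fun i hi => ?_, show 0 < j by omega⟩
  obtain ⟨x, rfl⟩ := (hl.slots i).1 hi
  exact ⟨Nat.succ_pos _, hj x⟩

theorem LayoutFor.body_iff (hl : LayoutFor S num l pars) (hj : ∀ x : S.Int, slotOf x < j)
    (hj2 : 2 ≤ j) (hL : ListsPreds P num L) (hR : Represents T C R F)
    (hC : C Fin.elim0 fun i => 4 * i + 4) (neg : Bool) {a : AbsState S K}
    (ha : AbsState.Proper a) : (specOf neg T R L j pars l).body (slotVal a) (slotBit num a) ↔
      F.absEval P a Fin.elim0 := by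
  have hg : Slots S (Fin.elim0 : Fin 0 → ℕ) := ⟨fun i => i.elim0, fun i => i.elim0, fun i => i.elim0⟩
  rw [← absEval_iff hL F hg (hl.codes ha) ⟨?_, fun x => ?_, fun i => i.elim0⟩ hj2 hj
    (fun i => i.elim0) fun p hp => ?_]
  · rw [hR.1, hR.2 _ j (slotEnv R.1.length j) (fun i hi => if_pos hi) ?_]
    · exact Iff.rfl
    · refine cast (congrArg (C Fin.elim0) (funext fun i => ?_)) hC
      simp [slotEnv]
  · rw [intVal, slotVal_zero]
    rfl
  · rw [intVal, slotVal_slotOf]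
  · obtain ⟨q, rfl⟩ := (hl.pars p).1 hp
    exact hj _

theorem LayoutFor.lang_specOf (hl : LayoutFor S num l pars) (hj : ∀ x : S.Int, slotOf x < j)
    (hj2 : 2 ≤ j) (hL : ListsPreds P num L) (hR : Represents T C R F)
    (hC : C Fin.elim0 fun i => 4 * i + 4) :
    (specOf false T R L j pars l).aut.lang = absWord num l ''
        {a : AbsState S K | AbsState.Proper a ∧ F.absEval P a Fin.elim0} ∧
      (specOf true T R L j pars l).aut.lang = absWord num l ''
        {a : AbsState S K | AbsState.Proper a ∧ ¬ F.absEval P a Fin.elim0} := by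
  rw [Spec.lang_aut (hl.wellFormed hj hj2 _), Spec.lang_aut (hl.wellFormed hj hj2 _)]
  refine ⟨(hl.wordLang_eq _).trans ?_, (hl.wordLang_eq _).trans ?_⟩
  · congr 1
    ext a
    exact and_congr_right fun ha => hl.body_iff hj hj2 hL hR hC false ha
  · congr 1
    ext a
    exact and_congr_right fun ha => not_congr (hl.body_iff hj hj2 hL hR hC true ha)

theorem primrec_map_map {α β γ : Type} [Primcodable α] [Primcodable β] [Primcodable γ]
    {f : α → List (List β)} {g : α → β → γ} (hf : Primrec f)
    (hg : Primrec fun p : α × β => g p.1 p.2) :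
    Primrec fun a => (f a).map fun D => D.map (g a) := by
  have h : Primrec fun p : α × List β => p.2.map (g p.1) :=
    Primrec.list_map (g := fun (p : α × List β) i => g p.1 i) Primrec.snd
      (hg.comp ((Primrec.fst.comp Primrec.fst).pair Primrec.snd))
  exact Primrec.list_map (g := fun a (D : List β) => D.map (g a)) hf h

theorem primrec_slotEnv : Primrec fun p : (ℕ × ℕ) × ℕ => slotEnv p.1.1 p.1.2 p.2 := by
  unfold slotEnv
  fun_prop

theorem primrec_cloFlat {α : Type} [Primcodable α] {T : α → Tabs} {e : α → ℕ → ℕ}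
    (hT : Primrec T) (he : Primrec fun p : α × ℕ => e p.1 p.2) :
    Primrec fun p : α × Clo => cloFlat (T p.1) (e p.1) p.2 := by
  have h₁ : Primrec fun p : α × List ℕ => p.2.map (e p.1) :=
    Primrec.list_map (g := fun (p : α × List ℕ) i => e p.1 i) Primrec.snd
      (he.comp ((Primrec.fst.comp Primrec.fst).pair Primrec.snd))
  have h₂ : Primrec fun p : α × Clo => p.2.2.2.map (e p.1) :=
    h₁.comp (Primrec.fst.pair (Primrec.snd.comp (Primrec.snd.comp Primrec.snd)))
  have h₃ : Primrec fun p : α × Clo => p.2.1 := Primrec.fst.comp Primrec.snd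
  have h₄ : Primrec fun p : α × Clo => p.2.2.1 :=
    Primrec.fst.comp (Primrec.snd.comp Primrec.snd)
  exact primrec_rawA.comp (((hT.comp Primrec.fst).pair h₂).pair (h₃.pair h₄))

theorem primrec_specMat : Primrec fun p : Tabs × RawPNF × ℕ =>
    p.2.1.2.map fun D => D.map (cloFlat p.1 (slotEnv p.2.1.1.length p.2.2)) := by
  have hR : Primrec fun p : Tabs × RawPNF × ℕ => p.2.1 := Primrec.fst.comp Primrec.snd
  have hQ : Primrec fun p : Tabs × RawPNF × ℕ => (p.2.1.1.length, p.2.2) :=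
    (Primrec.list_length.comp (Primrec.fst.comp hR)).pair (Primrec.snd.comp Primrec.snd)
  have he : Primrec fun q : (Tabs × RawPNF × ℕ) × ℕ => slotEnv q.1.2.1.1.length q.1.2.2 q.2 :=
    primrec_slotEnv.comp ((hQ.comp Primrec.fst).pair Primrec.snd)
  exact primrec_map_map (Primrec.snd.comp hR)
    (primrec_cloFlat (T := fun p : Tabs × RawPNF × ℕ => p.1)
      (e := fun p i => slotEnv p.2.1.1.length p.2.2 i) Primrec.fst he)

theorem primrec_specOf {α : Type} [Primcodable α] (neg : Bool) {T : α → Tabs} {R : α → RawPNF}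
    {L : α → List FAtom} {j : α → ℕ} {pars : α → List ℕ} {l : α → Layout} (hT : Primrec T)
    (hR : Primrec R) (hL : Primrec L) (hj : Primrec j) (hp : Primrec pars) (hl : Primrec l) :
    Primrec fun a => specOf neg (T a) (R a) (L a) (j a) (pars a) (l a) :=
  (Primrec.const neg).pair ((Primrec.fst.comp hR).pair
    ((primrec_specMat.comp (hT.pair (hR.pair hj))).pair (hL.pair (hj.pair (hp.pair hl)))))

end Words


/-! ## Specifications from the input -/

section Input

/-- The components of the code `c` of a problem instance. -/
def inPar (c : List ℕ) : ℕ := c.getD 0 0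
def inIdx (c : List ℕ) : ℕ := c.getD 1 0
def inDat (c : List ℕ) : ℕ := c.getD 2 0
def inArr (c : List ℕ) : ℕ := c.getD 3 0
def inSize (c : List ℕ) (a : ℕ) : ℕ := c.getD (4 + a) 0
def inHead (c : List ℕ) (i : ℕ) : ℕ := c.getD (4 + inArr c + i) 0

/-- A number greater than all codes and slots of variables. -/
def inBound (c : List ℕ) : ℕ := 4 * (inPar c + inIdx c + inDat c + inArr c + inHead c 2) + 8

@[fun_prop] theorem primrec_inPar : Primrec inPar := by unfold inPar; fun_prop
@[fun_prop] theorem primrec_inIdx : Primrec inIdx := by unfold inIdx; fun_prop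
@[fun_prop] theorem primrec_inDat : Primrec inDat := by unfold inDat; fun_prop
@[fun_prop] theorem primrec_inArr : Primrec inArr := by unfold inArr; fun_prop
@[fun_prop] theorem primrec_inSize : Primrec fun p : List ℕ × ℕ => inSize p.1 p.2 := by
  unfold inSize; fun_prop
@[fun_prop] theorem primrec_inHead : Primrec fun p : List ℕ × ℕ => inHead p.1 p.2 := by
  unfold inHead; fun_prop
@[fun_prop] theorem primrec_inBound : Primrec inBound := by unfold inBound; fun_prop

/-- Data variables and arrays are renamed by the same function `fd` of the code. `fz` recovers the
number of the original array, and `4 * p + 2` is the slot of the parameter `p`. -/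
def tabsOf (c : List ℕ) (fi fd fz : ℕ → ℕ) : Tabs :=
  ((List.range (inBound c)).map fi, (List.range (inBound c)).map fd,
    (List.range (inBound c)).map fd, (List.range (inBound c)).map fun a => 4 * inSize c (fz a) + 2)

theorem primrec_tabsOf {fi fd fz : ℕ → ℕ} (hi : Primrec fi) (hd : Primrec fd) (hz : Primrec fz) :
    Primrec fun c => tabsOf c fi fd fz := by
  have h : ∀ {f : ℕ → ℕ}, Primrec f → Primrec fun c => (List.range (inBound c)).map f := by
    intro f hf
    fun_prop
  have hs : Primrec fun c => (List.range (inBound c)).map fun a => 4 * inSize c (fz a) + 2 := by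
    fun_prop
  exact (h hi).pair ((h hd).pair ((h hd).pair hs))

/-- Even codes `2p` are parameters, which move to the slot `4p + 2` because the fresh parameters are
interleaved; odd codes are index variables and keep their code. -/
def starTabs (c : List ℕ) : Tabs :=
  tabsOf c (fun z => if z % 2 = 0 then 2 * z + 2 else z + 2) (fun z => z) fun z => z

def transTabs (c : List ℕ) : Tabs :=
  tabsOf c (fun z => if z % 2 = 0 then 2 * z + 2 else z + 2) (fun z => z) fun z => z / 2

def predTabs (c : List ℕ) : Tabs := tabsOf c (fun z => z + 2) (fun z => z) fun z => z

/-- Parameters, old and fresh, keep their slots. The index variable with code `2y + 1` goes to the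
slot `4y + 3`, and its primed copy to `4y + 5`. -/
def unprimedTabs (c : List ℕ) : Tabs :=
  tabsOf c (fun z => if z % 2 = 0 then z + 2 else 2 * z + 1) (fun z => 2 * z) fun z => z

def primedTabs (c : List ℕ) : Tabs :=
  tabsOf c (fun z => if z % 2 = 0 then z + 2 else 2 * z + 3) (fun z => 2 * z + 1) fun z => z

theorem primrec_starTabs : Primrec starTabs :=
  primrec_tabsOf (by fun_prop) (by fun_prop) (by fun_prop)
theorem primrec_transTabs : Primrec transTabs :=
  primrec_tabsOf (by fun_prop) (by fun_prop) (by fun_prop)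
theorem primrec_predTabs : Primrec predTabs :=
  primrec_tabsOf (by fun_prop) (by fun_prop) (by fun_prop)
theorem primrec_unprimedTabs : Primrec unprimedTabs :=
  primrec_tabsOf (by fun_prop) (by fun_prop) (by fun_prop)
theorem primrec_primedTabs : Primrec primedTabs :=
  primrec_tabsOf (by fun_prop) (by fun_prop) (by fun_prop)

/-- The header entries 0 to 5 are the initial formula, the transition formula, `k`, `ψ₁`, `ψ₂` and
`m`; the predicates follow from 6 on. The list `[1]` gives the designated variable its reserved
slot. -/
def predList (T : Tabs) (c : List ℕ) : List FAtom :=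
  (List.range (inHead c 5)).map fun i => rawA (T, [1]) false (inHead c (6 + i))

theorem primrec_predList {T : List ℕ → Tabs} (hT : Primrec T) :
    Primrec fun c => predList (T c) c := by
  have h₁ : Primrec fun p : List ℕ × ℕ => inHead p.1 (6 + p.2) := by fun_prop
  have h₂ : Primrec fun p : List ℕ × ℕ => rawA (T p.1, [1]) false (inHead p.1 (6 + p.2)) :=
    primrec_rawA.comp (((hT.comp Primrec.fst).pair (Primrec.const [1])).pair
      ((Primrec.const false).pair h₁))
  exact Primrec.list_map (g := fun c i => rawA (T c, [1]) false (inHead c (6 + i)))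
    (by fun_prop) h₂

/-- The slots of the parameters. -/
def parSlots (c : List ℕ) : List ℕ :=
  (List.range (inPar c)).map (fun p => 4 * p + 2) ++
    (List.range (inHead c 2)).map fun p => 4 * p + 4

/-- The columns of an abstract state; the index variable `y` has the slot `s * y + o`, and the
predicate `k` has the number `q + k`. -/
def layPart (c : List ℕ) (s o q : ℕ) : Layout :=
  (List.range (inPar c)).map (fun p => (true, 4 * p + 2)) ++
    (List.range (inHead c 2)).map (fun p => (true, 4 * p + 4)) ++
    (List.range (inIdx c)).map (fun y => (true, s * y + o)) ++
    (List.range (inHead c 5)).map fun k => (false, q + k)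

/-- The parameter columns occur twice, since a pair is written as two complete abstract states. -/
def layTrans (c : List ℕ) : Layout := layPart c 4 3 0 ++ layPart c 4 5 (inHead c 5)

theorem primrec_parSlots : Primrec parSlots := by unfold parSlots; fun_prop

theorem primrec_layPart (s o : ℕ) {q : List ℕ → ℕ} (hq : Primrec q) :
    Primrec fun c => layPart c s o (q c) := by
  have h₁ : Primrec fun c => (List.range (inPar c)).map fun p => (true, 4 * p + 2) := by fun_prop
  have h₂ : Primrec fun c => (List.range (inHead c 2)).map fun p => (true, 4 * p + 4) := by
    fun_prop
  have h₃ : Primrec fun c => (List.range (inIdx c)).map fun y => (true, s * y + o) := by fun_prop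
  have h₄ : Primrec fun c => (List.range (inHead c 5)).map fun k => (false, q c + k) := by
    fun_prop
  exact Primrec.list_append.comp (Primrec.list_append.comp (Primrec.list_append.comp h₁ h₂) h₃) h₄

theorem primrec_layTrans : Primrec layTrans :=
  Primrec.list_append.comp (primrec_layPart 4 3 (Primrec.const 0))
    (primrec_layPart 4 5 (by fun_prop))

/-- A bound for the codes of the formulae. -/
def codeBound (c : List ℕ) : ℕ :=
  inHead c 0 + inHead c 1 + inHead c 2 + inHead c 3 + inHead c 4

def rawInit (c : List ℕ) : RawPNF :=
  mergeRaw false (rawF (codeBound c) (inHead c 0)).1 (rawF (codeBound c) (inHead c 3)).1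

def rawTrans (c : List ℕ) : RawPNF := (rawF (codeBound c) (inHead c 1)).1

def rawNotFin (c : List ℕ) : RawPNF := (rawF (codeBound c) (inHead c 4)).2

theorem primrec_rawF_head (i : ℕ) : Primrec fun c => rawF (codeBound c) (inHead c i) := by
  have h : Primrec fun c => (codeBound c, inHead c i) := by
    unfold codeBound
    fun_prop
  exact primrec_rawF.comp h

theorem primrec_rawInit : Primrec rawInit :=
  primrec_mergeRaw.comp ((Primrec.const false).pair
    ((Primrec.fst.comp (primrec_rawF_head 0)).pair (Primrec.fst.comp (primrec_rawF_head 3))))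

theorem primrec_rawTrans : Primrec rawTrans := Primrec.fst.comp (primrec_rawF_head 1)

theorem primrec_rawNotFin : Primrec rawNotFin := Primrec.snd.comp (primrec_rawF_head 4)

def specInit (c : List ℕ) : Spec :=
  specOf false (starTabs c) (rawInit c) (predList (predTabs c) c) (inBound c) (parSlots c)
    (layPart c 2 3 0)

def specTrans (c : List ℕ) : Spec :=
  specOf false (transTabs c) (rawTrans c)
    (predList (unprimedTabs c) c ++ predList (primedTabs c) c) (inBound c) (parSlots c) (layTrans c)

/-- `relF` is the complement of the abstraction of `¬ψ₂`, not the abstraction of `ψ₂`; hence the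
negation flag in front of the prenex form of `¬ψ₂`. -/
def specFin (c : List ℕ) : Spec :=
  specOf true (starTabs c) (rawNotFin c) (predList (predTabs c) c) (inBound c) (parSlots c)
    (layPart c 2 3 0)

theorem primrec_specInit : Primrec specInit :=
  primrec_specOf _ primrec_starTabs primrec_rawInit (primrec_predList primrec_predTabs)
    primrec_inBound primrec_parSlots (primrec_layPart 2 3 (Primrec.const 0))

theorem primrec_specTrans : Primrec specTrans :=
  primrec_specOf _ primrec_transTabs primrec_rawTrans
    (Primrec.list_append.comp (primrec_predList primrec_unprimedTabs)
      (primrec_predList primrec_primedTabs))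
    primrec_inBound primrec_parSlots primrec_layTrans

theorem primrec_specFin : Primrec specFin :=
  primrec_specOf _ primrec_starTabs primrec_rawNotFin (primrec_predList primrec_predTabs)
    primrec_inBound primrec_parSlots (primrec_layPart 2 3 (Primrec.const 0))

end Input

/-! ### The code of a problem instance -/

namespace Problem

variable (x : Problem)

theorem inPar_code : inPar x.code = x.V.par := rfl
theorem inIdx_code : inIdx x.code = x.V.idx := rfl
theorem inArr_code : inArr x.code = x.V.arr := rfl

theorem inSize_code (a : Fin x.V.arr) : inSize x.code a = x.V.size a := by
  rw [inSize, Problem.code, List.append_assoc, List.append_assoc,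
    List.getD_append_right _ _ _ _ (by simp), List.getD_append _ _ _ _ (by simp)]
  simp [List.getD_eq_getElem?_getD]

theorem inHead_code (i : ℕ) : inHead x.code i =
    ([x.sys.init.code, x.sys.trans.code, x.prop.k, x.prop.pre.code, x.prop.post.code, x.m] ++
      List.ofFn fun k => (x.preds k).code).getD i 0 := by
  rw [inHead, inArr_code, Problem.code, List.append_assoc,
    List.getD_append_right _ _ _ _ (by simp; omega)]
  congr 1
  simp
  omega

theorem inHead_five : inHead x.code 5 = x.m := x.inHead_code 5
theorem inHead_two : inHead x.code 2 = x.prop.k := x.inHead_code 2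

theorem inPred_code (k : Fin x.m) : inHead x.code (6 + k) = (x.preds k).code := by
  rw [inHead_code, List.getD_append_right _ _ _ _ (by simp)]
  simp [List.getD_eq_getElem?_getD]

theorem inBound_code : inBound x.code =
    4 * (x.V.par + x.V.idx + x.V.dat + x.V.arr + x.prop.k) + 8 := by
  rw [inBound, inHead_two]
  rfl

/-! ### Slots -/

/-- Sums are coded by parity, the left summand even and the right one odd. For `(Par ⊕ Fin k) ⊕
Idx`, with two reserved slots, this leads to `4p + 2`, `4c + 4` and `2y + 3`. -/
theorem slotOf_par (p : Fin x.V.par) :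
    slotOf (S := x.sigStar) (.inl (.inl p)) = 4 * (p : ℕ) + 2 := by
  change 2 * (2 * (p : ℕ)) + 2 = _
  omega

theorem slotOf_fresh (p : Fin x.prop.k) :
    slotOf (S := x.sigStar) (.inl (.inr p)) = 4 * (p : ℕ) + 4 := by
  change 2 * (2 * (p : ℕ) + 1) + 2 = _
  omega

theorem slotOf_idx (y : Fin x.V.idx) : slotOf (S := x.sigStar) (.inr y) = 2 * (y : ℕ) + 3 := by
  change 2 * (y : ℕ) + 1 + 2 = _
  omega

theorem slotOf_trans_par (p : x.sigStar.Par) :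
    slotOf (S := x.sigStar.trans) (.inl p) = slotOf (S := x.sigStar) (.inl p) := rfl

theorem slotOf_unprimed (y : Fin x.V.idx) :
    slotOf (S := x.sigStar.trans) (.inr (.inl y)) = 4 * (y : ℕ) + 3 := by
  change 2 * (2 * (y : ℕ)) + 1 + 2 = _
  omega

theorem slotOf_primed (y : Fin x.V.idx) :
    slotOf (S := x.sigStar.trans) (.inr (.inr y)) = 4 * (y : ℕ) + 5 := by
  change 2 * (2 * (y : ℕ) + 1) + 1 + 2 = _
  omega

theorem slotOf_lt (y : x.sigStar.Int) : slotOf y < inBound x.code := by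
  rw [inBound_code]
  rcases y with (p | p) | y
  · rw [slotOf_par]
    omega
  · rw [slotOf_fresh]
    omega
  · rw [slotOf_idx]
    omega

theorem slotOf_trans_lt (y : x.sigStar.trans.Int) : slotOf y < inBound x.code := by
  rcases y with p | y | y
  · exact x.slotOf_lt (.inl p)
  · rw [slotOf_unprimed, inBound_code]
    omega
  · rw [slotOf_primed, inBound_code]
    omega

end Problem

theorem tabsFor_tabsOf {S₀ S : Sig} [Encodable S₀.Par] [Encodable S₀.Idx] [Encodable S₀.Dat]
    [Encodable S₀.Arr] [Encodable S.Par] [Encodable S.Idx] [Encodable S.Dat] [Encodable S.Arr]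
    {f : Sig.Hom S₀ S} {c : List ℕ} {fi fd fz : ℕ → ℕ}
    (hi : ∀ y : S₀.Int, Encodable.encode y < inBound c ∧
      fi (Encodable.encode y) = slotOf (S := S) (Sum.map f.par f.idx y))
    (hd : ∀ y : S₀.Dat, Encodable.encode y < inBound c ∧
      fd (Encodable.encode y) = Encodable.encode (f.dat y))
    (ha : ∀ y : S₀.Arr, Encodable.encode y < inBound c ∧
      fd (Encodable.encode y) = Encodable.encode (f.arr y) ∧
      4 * inSize c (fz (Encodable.encode y)) + 2 = slotOf (S := S) (.inl (S.size (f.arr y)))) :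
    TabsFor f (tabsOf c fi fd fz) := by
  refine ⟨fun y => ?_, fun y => ?_, fun y => ?_, fun y => ?_⟩
  · exact (getD_map_range fi _ _ 0).trans ((if_pos (hi y).1).trans (hi y).2)
  · exact (getD_map_range fd _ _ 0).trans ((if_pos (hd y).1).trans (hd y).2)
  · exact (getD_map_range fd _ _ 0).trans ((if_pos (ha y).1).trans (ha y).2.1)
  · exact (getD_map_range _ _ _ 0).trans ((if_pos (ha y).1).trans (ha y).2.2)

namespace Problem

variable (x : Problem)

theorem tabsFor_star : TabsFor (x.V.sig.toStar x.prop.k) (starTabs x.code) := by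
  have hb := x.inBound_code
  refine tabsFor_tabsOf (fun y => ?_) (fun y => ?_) fun y => ?_
  · rcases y with p | y
    · have e : Encodable.encode (Sum.inl p : x.V.sig.Int) = 2 * (p : ℕ) := rfl
      refine ⟨by omega, ?_⟩
      rw [e, if_pos (by omega)]
      exact Eq.trans (by omega) (x.slotOf_par p).symm
    · have e : Encodable.encode (Sum.inr y : x.V.sig.Int) = 2 * (y : ℕ) + 1 := rfl
      refine ⟨by omega, ?_⟩
      rw [e, if_neg (by omega)]
      exact (x.slotOf_idx y).symm
  · exact ⟨lt_of_lt_of_le y.2 (by omega), rfl⟩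
  · exact ⟨lt_of_lt_of_le y.2 (by omega), rfl, (congrArg (4 * · + 2) (x.inSize_code y)).trans
      (x.slotOf_par _).symm⟩

theorem tabsFor_trans : TabsFor (x.V.sig.transToStar x.prop.k) (transTabs x.code) := by
  have hb := x.inBound_code
  refine tabsFor_tabsOf (fun y => ?_) (fun y => ?_) fun y => ?_
  · rcases y with p | y | y
    · have e : Encodable.encode (Sum.inl p : x.V.sig.trans.Int) = 2 * (p : ℕ) := rfl
      refine ⟨by omega, ?_⟩
      rw [e, if_pos (by omega)]
      exact Eq.trans (by omega) (x.slotOf_par p).symm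
    · have e : Encodable.encode (Sum.inr (.inl y) : x.V.sig.trans.Int) = 2 * (2 * (y : ℕ)) + 1 :=
        rfl
      refine ⟨by omega, ?_⟩
      rw [e, if_neg (by omega)]
      exact Eq.trans (by omega) (x.slotOf_unprimed y).symm
    · have e : Encodable.encode (Sum.inr (.inr y) : x.V.sig.trans.Int) =
        2 * (2 * (y : ℕ) + 1) + 1 := rfl
      refine ⟨by omega, ?_⟩
      rw [e, if_neg (by omega)]
      exact Eq.trans (by omega) (x.slotOf_primed y).symm
  · refine ⟨?_, rfl⟩
    rcases y with y | y
    · have e : Encodable.encode (Sum.inl y : x.V.sig.trans.Dat) = 2 * (y : ℕ) := rfl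
      omega
    · have e : Encodable.encode (Sum.inr y : x.V.sig.trans.Dat) = 2 * (y : ℕ) + 1 := rfl
      omega
  · rcases y with y | y
    · have e : Encodable.encode (Sum.inl y : x.V.sig.trans.Arr) = 2 * (y : ℕ) := rfl
      refine ⟨by omega, rfl, ?_⟩
      rw [e, show 2 * (y : ℕ) / 2 = y by omega, x.inSize_code y]
      exact (x.slotOf_par _).symm
    · have e : Encodable.encode (Sum.inr y : x.V.sig.trans.Arr) = 2 * (y : ℕ) + 1 := rfl
      refine ⟨by omega, rfl, ?_⟩
      rw [e, show (2 * (y : ℕ) + 1) / 2 = y by omega, x.inSize_code y]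
      exact (x.slotOf_par _).symm

theorem encode_lt (y : x.sigStar.Int) : Encodable.encode y < inBound x.code :=
  lt_of_le_of_lt (Nat.le_add_right _ 2) (x.slotOf_lt y)

theorem tabsFor_pred : TabsFor (Sig.Hom.id x.sigStar) (predTabs x.code) := by
  have hb := x.inBound_code
  refine tabsFor_tabsOf (fun y => ⟨x.encode_lt y, ?_⟩) (fun y => ?_) fun y => ?_
  · rcases y with y | y <;> rfl
  · exact ⟨lt_of_lt_of_le y.2 (by omega), rfl⟩
  · exact ⟨lt_of_lt_of_le y.2 (by omega), rfl, (congrArg (4 * · + 2) (x.inSize_code y)).trans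
      (x.slotOf_par _).symm⟩

theorem tabsFor_unprimed : TabsFor x.sigStar.unprimed (unprimedTabs x.code) := by
  have hb := x.inBound_code
  refine tabsFor_tabsOf (fun y => ⟨x.encode_lt y, ?_⟩) (fun y => ?_) fun y => ?_
  · rcases y with p | y
    · have e : Encodable.encode (Sum.inl p : x.sigStar.Int) = 2 * Encodable.encode p := rfl
      rw [if_pos (by omega)]
      rfl
    · have e : Encodable.encode (Sum.inr y : x.sigStar.Int) = 2 * (y : ℕ) + 1 := rfl
      rw [e, if_neg (by omega)]
      exact Eq.trans (by omega) (x.slotOf_unprimed y).symm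
  · exact ⟨lt_of_lt_of_le y.2 (by omega), rfl⟩
  · exact ⟨lt_of_lt_of_le y.2 (by omega), rfl, (congrArg (4 * · + 2) (x.inSize_code y)).trans
      (x.slotOf_par _).symm⟩

theorem tabsFor_primed : TabsFor x.sigStar.primed (primedTabs x.code) := by
  have hb := x.inBound_code
  refine tabsFor_tabsOf (fun y => ⟨x.encode_lt y, ?_⟩) (fun y => ?_) fun y => ?_
  · rcases y with p | y
    · have e : Encodable.encode (Sum.inl p : x.sigStar.Int) = 2 * Encodable.encode p := rfl
      rw [if_pos (by omega)]
      rfl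
    · have e : Encodable.encode (Sum.inr y : x.sigStar.Int) = 2 * (y : ℕ) + 1 := rfl
      rw [e, if_neg (by omega)]
      exact Eq.trans (by omega) (x.slotOf_primed y).symm
  · exact ⟨lt_of_lt_of_le y.2 (by omega), rfl⟩
  · exact ⟨lt_of_lt_of_le y.2 (by omega), rfl, (congrArg (4 * · + 2) (x.inSize_code y)).trans
      (x.slotOf_par _).symm⟩

end Problem


namespace Problem

variable (x : Problem)

/-! ### Predicates and formulae -/

theorem getD_predList (T : Tabs) (k : Fin x.m) {S : Sig} [Encodable S.Par] [Encodable S.Idx]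
    [Encodable S.Dat] [Encodable S.Arr] {f : Sig.Hom x.sigStar S} (hT : TabsFor f T) :
    (predList T x.code).getD k default = ((x.preds k).map f .bvar).flat fun _ => 1 := by
  rw [predList, getD_map_range, inHead_five, if_pos k.2, inPred_code,
    rawA_code hT (θ := .bvar) (g := fun _ => 1)]
  · simp
  · intro i
    rw [Subsingleton.elim i 0]
    rfl

theorem length_predList (T : Tabs) : (predList T x.code).length = x.m := by
  rw [predList, List.length_map, List.length_range, inHead_five]

theorem listsPreds_star :
    ListsPreds x.preds (fun k => (k : ℕ)) (predList (predTabs x.code) x.code) := by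
  refine ⟨fun k => ?_, fun k => ?_, fun i hi => ?_⟩
  · rw [length_predList]
    exact k.2
  · rw [x.getD_predList _ k x.tabsFor_pred]
    exact Atom.flat_map_id (fun _ => rfl) _
  · rw [length_predList] at hi
    exact ⟨⟨i, hi⟩, rfl⟩

/-- The numbers of the predicates `P` and `P'`. -/
def predNum : Fin x.m ⊕ Fin x.m → ℕ := Sum.elim (fun k => k) fun k => x.m + k

theorem listsPreds_trans : ListsPreds (primePreds x.preds) x.predNum
    (predList (unprimedTabs x.code) x.code ++ predList (primedTabs x.code) x.code) := by
  have hlen := x.length_predList (unprimedTabs x.code)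
  refine ⟨fun k => ?_, fun k => ?_, fun i hi => ?_⟩
  · rw [List.length_append, length_predList, length_predList]
    rcases k with k | k <;> simp only [predNum, Sum.elim_inl, Sum.elim_inr] <;> omega
  · rcases k with k | k
    · simp only [predNum, Sum.elim_inl]
      rw [List.getD_append _ _ _ _ (by omega), x.getD_predList _ k x.tabsFor_unprimed]
      rfl
    · simp only [predNum, Sum.elim_inr]
      rw [List.getD_append_right _ _ _ _ (by omega), hlen, Nat.add_sub_cancel_left,
        x.getD_predList _ k x.tabsFor_primed]
      rfl
  · rw [List.length_append, length_predList, length_predList] at hi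
    by_cases h : i < x.m
    · exact ⟨.inl ⟨i, h⟩, rfl⟩
    · refine ⟨.inr ⟨i - x.m, by omega⟩, ?_⟩
      simp only [predNum, Sum.elim_inr]
      omega

theorem codeBound_code : codeBound x.code = x.sys.init.code + x.sys.trans.code + x.prop.k +
    x.prop.pre.code + x.prop.post.code := by
  unfold codeBound
  rw [inHead_code, inHead_code, inHead_code, inHead_code, inHead_code]
  rfl

/-- The free variables of the formulae of the property have the slots of the fresh parameters. -/
def FreshSlots (g : Fin 0 → ℕ) (h : ℕ → ℕ) : Prop :=
  ∀ i : Fin x.prop.k, ((.var (.inl (.inr i)) : ITerm x.sigStar 0)).flats g = [(h i, 0)]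

theorem freshSlots : x.FreshSlots Fin.elim0 fun i => 4 * i + 4 := fun i =>
  congrArg (fun j => [(j, (0 : ℤ))]) (x.slotOf_fresh i)

end Problem

theorem Represents.mono {S : Sig} [Encodable S.Par] [Encodable S.Idx] [Encodable S.Dat]
    [Encodable S.Arr] {T : Tabs} {n : ℕ} {C C' : (Fin n → ℕ) → (ℕ → ℕ) → Prop} {R : RawPNF}
    {F : PNF S n} (h : Represents T C' R F) (hC : ∀ g h, C g h → C' g h) : Represents T C R F :=
  ⟨h.1, fun g j e he hCe => h.2 g j e he (hC _ _ hCe)⟩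

namespace Problem

variable (x : Problem)

theorem represents_init : Represents (starTabs x.code) x.FreshSlots (rawInit x.code)
    (x.initStar.toPNF true) := by
  have hb := x.codeBound_code
  have h₀ : inHead x.code 0 = x.sys.init.code := x.inHead_code 0
  have h₃ : inHead x.code 3 = x.prop.pre.code := x.inHead_code 3
  rw [rawInit, h₀, h₃]
  refine Represents.merge false ?_ ?_
  · exact (represents_rawF x.tabsFor_star _ x.sys.init (by omega) Fin.elim0).1.mono
      fun g h _ i => i.elim0
  · exact (represents_rawF x.tabsFor_star _ x.prop.pre (by omega) _).1

theorem represents_notFin : Represents (starTabs x.code) x.FreshSlots (rawNotFin x.code)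
    (x.notFinStar.toPNF true) := by
  have hb := x.codeBound_code
  have h₄ : inHead x.code 4 = x.prop.post.code := x.inHead_code 4
  rw [rawNotFin, h₄]
  exact (represents_rawF x.tabsFor_star _ x.prop.post (by omega) _).2

theorem represents_trans : Represents (transTabs x.code) (fun _ _ => True) (rawTrans x.code)
    (x.transStar.toPNF true) := by
  have hb := x.codeBound_code
  have h₁ : inHead x.code 1 = x.sys.trans.code := x.inHead_code 1
  rw [rawTrans, h₁]
  exact (represents_rawF x.tabsFor_trans _ x.sys.trans (by omega) Fin.elim0).1.mono
    fun g h _ i => i.elim0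

/-! ### Layouts -/

theorem mem_numSlots_layPart {s o q j : ℕ} : j ∈ numSlots (layPart x.code s o q) ↔
    (∃ p : Fin x.V.par, 4 * (p : ℕ) + 2 = j) ∨ (∃ p : Fin x.prop.k, 4 * (p : ℕ) + 4 = j) ∨
      ∃ y : Fin x.V.idx, s * (y : ℕ) + o = j := by
  simp [mem_numSlots, layPart, inPar_code, inIdx_code, inHead_two, Fin.exists_iff]

theorem false_mem_layPart {s o q k : ℕ} : (false, k) ∈ layPart x.code s o q ↔
    ∃ i : Fin x.m, q + (i : ℕ) = k := by
  simp [layPart, inHead_five, Fin.exists_iff]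

theorem exists_par_slot {j : ℕ} :
    (∃ p : x.sigStar.Par, slotOf (S := x.sigStar) (.inl p) = j) ↔
      (∃ p : Fin x.V.par, 4 * (p : ℕ) + 2 = j) ∨ ∃ p : Fin x.prop.k, 4 * (p : ℕ) + 4 = j :=
  Sum.exists.trans (or_congr (exists_congr fun p => by rw [slotOf_par])
    (exists_congr fun p => by rw [slotOf_fresh]))

theorem mem_parSlots {j : ℕ} : j ∈ parSlots x.code ↔
    ∃ p : x.sigStar.Par, slotOf (S := x.sigStar) (.inl p) = j := by
  rw [x.exists_par_slot]
  simp [parSlots, inPar_code, inHead_two, Fin.exists_iff]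

theorem layoutFor_star : LayoutFor x.sigStar (fun k : Fin x.m => (k : ℕ)) (layPart x.code 2 3 0)
    (parSlots x.code) := by
  refine ⟨fun j => ?_, fun k => ?_, fun j => x.mem_parSlots, Fin.val_injective⟩
  · rw [mem_numSlots_layPart, Sum.exists, exists_par_slot, or_assoc]
    exact or_congr_right (or_congr_right (exists_congr fun y => by rw [slotOf_idx]))
  · rw [false_mem_layPart]
    simp

theorem or_or_distrib_or {A B C D : Prop} : (A ∨ B ∨ C) ∨ A ∨ B ∨ D ↔ (A ∨ B) ∨ C ∨ D := by
  tauto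

theorem layoutFor_trans : LayoutFor x.sigStar.trans x.predNum (layTrans x.code)
    (parSlots x.code) := by
  refine ⟨fun j => ?_, fun k => ?_, fun j => x.mem_parSlots, ?_⟩
  · rw [layTrans, numSlots, List.filter_append, List.map_append, List.mem_append]
    change j ∈ numSlots _ ∨ j ∈ numSlots _ ↔ _
    have h₁ : (∃ y : Fin x.V.idx, slotOf (S := x.sigStar.trans) (.inr (.inl y)) = j) ↔
        ∃ y : Fin x.V.idx, 4 * (y : ℕ) + 3 = j := exists_congr fun y => by rw [slotOf_unprimed]
    have h₂ : (∃ y : Fin x.V.idx, slotOf (S := x.sigStar.trans) (.inr (.inr y)) = j) ↔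
        ∃ y : Fin x.V.idx, 4 * (y : ℕ) + 5 = j := exists_congr fun y => by rw [slotOf_primed]
    have h₃ : (∃ y : Fin x.V.idx ⊕ Fin x.V.idx, slotOf (S := x.sigStar.trans) (.inr y) = j) ↔
        (∃ y : Fin x.V.idx, 4 * (y : ℕ) + 3 = j) ∨ ∃ y : Fin x.V.idx, 4 * (y : ℕ) + 5 = j :=
      Sum.exists.trans (or_congr h₁ h₂)
    have h₄ : (∃ y : x.sigStar.trans.Int, slotOf y = j) ↔ _ :=
      Sum.exists.trans (or_congr (x.exists_par_slot (j := j)) h₃)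
    rw [mem_numSlots_layPart, mem_numSlots_layPart]
    exact or_or_distrib_or.trans h₄.symm
  · rw [layTrans, List.mem_append, false_mem_layPart, false_mem_layPart, Sum.exists, inHead_five]
    simp [predNum]
  · rintro (k | k) (k' | k') h <;> simp only [predNum, Sum.elim_inl, Sum.elim_inr] at h
    · rw [Fin.ext h]
    · omega
    · omega
    · rw [Fin.ext (Nat.add_left_cancel h)]

/-! ### Convolutions -/

/-- In a proper abstract state the word is as long as the largest parameter value, so it does not
contribute to the length of the representation. -/
theorem lt_len_iff {a : x.Abs} (ha : AbsState.Proper a) {n : ℕ} :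
    n < x.len a ↔ ∃ y : x.sigStar.Int, n < a.1 y := by
  rw [len, ha, Sum.exists, Sum.exists]
  simp only [lt_max_iff, Finset.lt_sup_iff, Finset.mem_univ, true_and, Sum.exists]
  tauto

theorem letterOf_layPart {s o q : ℕ} {v : ℕ → ℕ} {W : ℕ → ℕ → Bool} {a : x.Abs} (i : ℕ)
    (h₁ : ∀ p : x.sigStar.Par, v (slotOf (S := x.sigStar) (.inl p)) = a.1 (.inl p))
    (h₂ : ∀ y : Fin x.V.idx, v (s * (y : ℕ) + o) = a.1 (.inr y))
    (h₃ : ∀ k : Fin x.m, W i (q + k) = letterAt a.2 i k) :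
    letterOf (layPart x.code s o q) v W i = x.letter a i := by
  have hr : ∀ {α : Type} (n : ℕ) (f : ℕ → α), (List.range n).map f =
      List.ofFn fun i : Fin n => f i := by
    intro α n f
    exact List.ext_getElem (by simp) fun i _ _ => by simp
  simp only [letterOf, layPart, List.map_append, hr, List.map_ofFn, letter, inPar_code,
    inIdx_code, inHead_two, inHead_five, Function.comp_def]
  congr 1
  · congr 1
    · congr 1
      · refine congrArg List.ofFn (funext fun p => ?_)
        have := h₁ (.inl p)
        rw [slotOf_par] at this
        simp [this]
      · refine congrArg List.ofFn (funext fun p => ?_)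
        have := h₁ (.inr p)
        rw [slotOf_fresh] at this
        simp [this]
    · exact congrArg List.ofFn (funext fun y => by simp [h₂])
  · exact congrArg List.ofFn (funext fun k => by simp [h₃])

theorem absWord_star {a : x.Abs} (ha : AbsState.Proper a) :
    absWord (fun k : Fin x.m => (k : ℕ)) (layPart x.code 2 3 0) a = x.enc a := by
  have hl := x.layoutFor_star
  rw [absWord, wordOf, enc]
  have hlen : maxVal (numSlots (layPart x.code 2 3 0)) (slotVal a) = x.len a := by
    refine eq_of_forall_lt_iff fun n => ?_
    rw [lt_maxVal_iff, x.lt_len_iff ha]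
    constructor
    · rintro ⟨j, hj, h⟩
      obtain ⟨y, rfl⟩ := (hl.slots j).1 hj
      exact ⟨y, by rwa [slotVal_slotOf] at h⟩
    · rintro ⟨y, h⟩
      exact ⟨_, (hl.slots _).2 ⟨y, rfl⟩, by rwa [slotVal_slotOf]⟩
  rw [hlen]
  refine List.map_congr_left fun i _ => x.letterOf_layPart i (fun p => slotVal_slotOf a _)
    (fun y => ?_) fun k => ?_
  · rw [← slotOf_idx, slotVal_slotOf]
  · rw [zero_add]
    exact hl.slotBit_num a i k

theorem absWord_trans {a a' : x.Abs} (ha : AbsState.Proper a) (ha' : AbsState.Proper a')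
    (hp : ∀ p : x.sigStar.Par, a'.1 (.inl p) = a.1 (.inl p)) :
    absWord x.predNum (layTrans x.code) (tau (a, a')) = x.encPair (a, a') := by
  have hl := x.layoutFor_trans
  rw [absWord, wordOf, encPair]
  have hlen : maxVal (numSlots (layTrans x.code)) (slotVal (tau (a, a'))) =
      max (x.len a) (x.len a') := by
    refine eq_of_forall_lt_iff fun n => ?_
    rw [lt_maxVal_iff, lt_max_iff, x.lt_len_iff ha, x.lt_len_iff ha']
    constructor
    · rintro ⟨j, hj, h⟩
      obtain ⟨y, rfl⟩ := (hl.slots j).1 hj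
      rw [slotVal_slotOf] at h
      rcases y with p | y | y
      · exact Or.inl ⟨.inl p, h⟩
      · exact Or.inl ⟨.inr y, h⟩
      · exact Or.inr ⟨.inr y, h⟩
    · have key : (∃ y : x.sigStar.trans.Int, n < (tau (a, a')).1 y) →
          ∃ j ∈ numSlots (layTrans x.code), n < slotVal (tau (a, a')) j := by
        rintro ⟨y, h⟩
        exact ⟨_, (hl.slots _).2 ⟨y, rfl⟩, by rwa [slotVal_slotOf]⟩
      rintro (⟨p | y, h⟩ | ⟨p | y, h⟩)
      · exact key ⟨.inl p, h⟩
      · exact key ⟨.inr (.inl y), h⟩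
      -- The doubled vocabulary has one copy of the parameters, taken from `a`; those of `a'` have
      -- the same values.
      · exact key ⟨.inl p, (hp p) ▸ h⟩
      · exact key ⟨.inr (.inr y), h⟩
  rw [hlen]
  refine List.map_congr_left fun i _ => ?_
  have hbit : ∀ k, slotBit x.predNum (tau (a, a')) i (x.predNum k) =
      Sum.elim (letterAt a.2 i) (letterAt a'.2 i) k := fun k =>
    (hl.slotBit_num _ i k).trans (congrFun (letterAt_convolve a.2 a'.2 i) k)
  rw [layTrans, letterOf, List.map_append]
  refine congrArg₂ (· ++ ·) (x.letterOf_layPart i (fun p => ?_) (fun y => ?_) fun k => ?_)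
    (x.letterOf_layPart i (fun p => ?_) (fun y => ?_) fun k => ?_)
  · rw [← slotOf_trans_par, slotVal_slotOf]
    rfl
  · rw [← slotOf_unprimed, slotVal_slotOf]
    rfl
  · rw [zero_add]
    exact hbit (.inl k)
  · rw [← slotOf_trans_par, slotVal_slotOf]
    exact (hp p).symm
  · rw [← slotOf_primed, slotVal_slotOf]
    rfl
  · rw [inHead_five]
    exact hbit (.inr k)

theorem enc_injOn {a a' : x.Abs} (ha : AbsState.Proper a) (ha' : AbsState.Proper a')
    (h : x.enc a = x.enc a') : a = a' := by
  rw [← x.absWord_star ha, ← x.absWord_star ha'] at h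
  exact x.layoutFor_star.absWord_injOn ha ha' h

/-! ### Languages -/

theorem lang_specInit : (specInit x.code).aut.lang = x.enc '' x.relI := by
  refine (x.layoutFor_star.lang_specOf x.slotOf_lt (by rw [inBound_code]; omega)
    x.listsPreds_star x.represents_init x.freshSlots).1.trans ?_
  exact Set.image_congr fun a ha => x.absWord_star ha.1

theorem lang_specFin : (specFin x.code).aut.lang = x.enc '' x.relF := by
  refine (x.layoutFor_star.lang_specOf x.slotOf_lt (by rw [inBound_code]; omega)
    x.listsPreds_star x.represents_notFin x.freshSlots).2.trans ?_
  have : {a : x.Abs | AbsState.Proper a ∧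
      ¬ (x.notFinStar.toPNF true).absEval x.preds a Fin.elim0} = x.relF := by
    ext a
    exact and_congr_right fun ha => not_congr ⟨fun h => ⟨ha, h⟩, fun h => h.2⟩
  rw [this]
  exact Set.image_congr fun a ha => x.absWord_star ha.1

theorem lang_specTrans : (specTrans x.code).aut.lang = x.encPair '' x.relT := by
  refine (x.layoutFor_trans.lang_specOf x.slotOf_trans_lt (by rw [inBound_code]; omega)
    x.listsPreds_trans x.represents_trans trivial).1.trans ?_
  ext u
  constructor
  · rintro ⟨a, ha, rfl⟩
    -- Every abstract state of the doubled vocabulary is `tau` of a pair, so the automaton accepts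
    -- nothing but encoded pairs.
    have h : (AbsState.fst a, AbsState.snd a) ∈ x.relT :=
      ⟨(List.length_map _).trans ha.1, (List.length_map _).trans ha.1, fun p => rfl, by
        rw [AbsState.tau_fst_snd]
        exact ha⟩
    refine ⟨_, h, ?_⟩
    rw [← x.absWord_trans h.1 h.2.1 h.2.2.1, AbsState.tau_fst_snd]
  · rintro ⟨⟨a, a'⟩, h, rfl⟩
    exact ⟨tau (a, a'), h.2.2.2, x.absWord_trans h.1 h.2.1 h.2.2.1⟩

end Problem

/-! ### The main theorem -/

theorem mainTheorem3 :
    ∃ compute : List ℕ → FinAut × FinAut × FinAut, Computable compute ∧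
      ∀ x : Problem, x.sys.Abstractable → x.prop.toTFml.neg.Abstractable →
        ∃ I T F : FinAut, compute x.code = (I, T, F) ∧
          -- the automata recognize the regular abstractions computed from the predicates
          I.lang = x.enc '' x.relI ∧
          T.lang = x.encPair '' x.relT ∧
          F.lang = x.enc '' x.relF ∧
          alpha x.preds x.initStar.sem ⊆ x.relI ∧
          alpha (primePreds x.preds) x.transStar.sem ⊆ tau '' x.relT ∧
          alpha x.preds x.notFinStar.sem ⊆ x.relE ∧
          -- and they are sound for the liveness property
          (x.sys.Progressing x.prop.toTFml.not → x.Live I T F → x.sys.Holds x.prop.toTFml) := by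
  refine ⟨fun c => ((specInit c).aut, (specTrans c).aut, (specFin c).aut), Primrec.to_comp ?_,
    fun x _ _ => ⟨_, _, _, rfl, x.lang_specInit, x.lang_specTrans, x.lang_specFin,
      alpha_subset_abs _ _, alpha_subset_tau _ _, alpha_subset_abs _ _,
      fun hprog hlive s N hs hsat => ?_⟩⟩
  · exact (Spec.primrec_aut.comp primrec_specInit).pair
      ((Spec.primrec_aut.comp primrec_specTrans).pair (Spec.primrec_aut.comp primrec_specFin))
  -- Progress makes the violating path infinite; its abstraction obeys the automata for `I` and `T`,
  -- so by liveness some state has its word in the language of `F`.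
  · obtain ⟨π, hI, hT, hE⟩ := x.exists_abstract_path hs (hprog s N hs hsat) hsat
    obtain ⟨i, hi⟩ := hlive π (fun i => (hE i).1) (x.lang_specInit ▸ Set.mem_image_of_mem _ hI)
      fun i => x.lang_specTrans ▸ Set.mem_image_of_mem _ (hT i)
    rw [x.lang_specFin] at hi
    obtain ⟨a, ha, h⟩ := hi
    -- The accepted word could a priori represent another abstract state; injectivity of the
    -- encoding excludes this.
    obtain rfl := x.enc_injOn ha.1 (hE i).1 h
    exact ha.2 (hE i)
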